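/- **Setting.** A quadratic-like map is a holomorphic branched covering $f:U'\to U$ of degree two between topological disks in $\mathbb C$ with $\overline{U'}$ compact and contained in $U$, normalized so that its critical point is $0$; its filled Julia set is $K(f)=\{z: f^n z\in U' \text{ for all } n\ge 0\}$. Both fixed points of $f$ are assumed to be repelling. Fix a conjugacy $h$ from $f$ near $K(f)$ to a quadratic polynomial $P_c: z\mapsto z^2+c$ near its filled Julia set $K(P_c)$ (a homeomorphism between neighbourhoods of $K(f)$ and $K(P_c)$ that maps $K(f)$ onto $K(P_c)$ and conjugates the maps). External rays and equipotentials of $f$ near $K(f)$ are the preimages under $h$ of those of $P_c$, which are defined by the Böttcher function of $P_c$ on the complement of (the connected set) $K(P_c)$. Equipotentials below are taken so close to $K(f)$ that they and their images under $f$ are closed curves in the domain where this makes sense. For a set $S$, $f^{-n}S$ denotes the set of points whose first $n$ iterates are defined and whose $n$-th iterate is in $S$. **DH-renormalizable.** Let $\bar a$ be a repelling cycle of $f$ with at least two external rays landing at each of its points, let $\mathcal R$ be the union of $\bar a$ and these rays, and let $E$ be an equipotential. Let $\Omega$ be the component containing $0$ of the domain bounded by $E$ with $f^{-1}\mathcal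 R$ removed, let $a\in\partial\Omega$ be a point of $\bar a$, let $p_a$ be the period of the rays landing at $a$, and let $\Omega'$ be the component of $f^{-p_a}(\overline\Omega)$ containing $a$. The map $f$ is DH-renormalizable if $\bar a, E, a$ can be chosen so that $0\in\Omega'$ and $f^{p_ak}(0)\in\Omega'$ for all $k\ge0$. **Principal nest.** Let $\alpha$ be the fixed point of $f$ at which at least two external rays land, let $p$ be the period of these rays, and let $E$ be an equipotential. The puzzle pieces of depth $0$ are the closures of the components of the domain bounded by $E$ with $\alpha$ and the rays landing at $\alpha$ removed; the pieces of depth $n$ are the closures of the components of $f^{-n}(\operatorname{int}Q)$, $Q$ a piece of depth $0$. For $f^l z\in\operatorname{int}W$, the pull-back of $W$ along $z,\dots,f^lz$ is the closure of the component of $f^{-l}(\operatorname{int} W)$ containing $z$. Let $Z_i$ be the pieces of depth $1$ that do not contain $0$ and contain the preimage $\alpha'\neq\alpha$ of $\alpha$. If there is a $t$ with $f^{tp}0\in\bigcup_i\operatorname{int}Z_i$, take the smallest one and let $V^0$ be the pull-back of the corresponding $Z_i$ along $0,\dots,f^{tp}0$ (if there is none, the nest is empty). As long as $0$ returns to $\operatorname{int}V^n$,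 let $V^{n+1}$ be the pull-back of $V^n$ along $0,\dots,f^l0$, where $l>0$ is the first return time of $0$ to $\operatorname{int}V^n$. **Generalized renormalization.** For $n\ge1$ for which $V^{n-1}$ is defined, let $V^n_i$ be the pull-backs of $V^{n-1}$ corresponding to the first returns to $\operatorname{int}V^{n-1}$ of the points $z\in\operatorname{int}V^{n-1}$ which return there, and let $g_n:\bigcup_iV^n_i\to V^{n-1}$ be the first return map. The generalized renormalization $T^nf$ is $g_n$ restricted to the union of those pieces $V_i^n$ which meet the $\omega$-limit set $\omega(0)$ of the critical point. **Lemma 3.10.** If $f$ is a DH-renormalizable quadratic-like map, then all maps $T^nf$ are of finite type: for every $n\ge1$ for which $V^{n-1}$ is defined, only finitely many of the pieces $V^n_i$ meet $\omega(0)$. -/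

import Mathlib

open Set Filter Topology

noncomputable section

/-- A (Douady-Hubbard) quadratic-like map `f : U' → U`, normalized so that its critical point
is the origin: a holomorphic branched covering of degree two between topological disks with `U'`
compactly contained in `U`.  The values of `toFun` outside `U'` are irrelevant. -/
structure QuadraticLike where
  toFun : ℂ → ℂ
  /-- the domain of the map -/
  U' : Set ℂ
  /-- the range of the map -/
  U : Set ℂ
  isOpen_U' : IsOpen U'
  isOpen_U : IsOpen U
  simplyConnected_U' : IsSimplyConnected U'
  simplyConnected_U : IsSimplyConnected U
  isCompact_closure_U' : IsCompact (closure U')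
  closure_U'_subset : closure U' ⊆ U
  mapsTo : MapsTo toFun U' U
  holomorphic : DifferentiableOn ℂ toFun U'
  proper : ∀ C : Set ℂ, C ⊆ U → IsCompact C → IsCompact (U' ∩ toFun ⁻¹' C)
  zero_mem : (0 : ℂ) ∈ U'
  critical : ∀ z ∈ U', (deriv toFun z = 0 ↔ z = 0)
  fiber_critical_value : ∀ z ∈ U', toFun z = toFun 0 → z = 0
  fiber : ∀ w ∈ U, w ≠ toFun 0 → {z | z ∈ U' ∧ toFun z = w}.ncard = 2

namespace QuadraticLike

variable (F : QuadraticLike)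

/-- `f⁻ⁿ S`: the points of `U'` whose first `n` iterates are defined and such that the `n`-th
iterate lies in `S`. -/
def preim (n : ℕ) (S : Set ℂ) : Set ℂ :=
  {z | (∀ k < n, F.toFun^[k] z ∈ F.U') ∧ F.toFun^[n] z ∈ S}

/-- The filled Julia set `K(f)`. -/
def filledJulia : Set ℂ := {z | ∀ n : ℕ, F.toFun^[n] z ∈ F.U'}

/-- All fixed points of `f` are repelling.  (There are two of them, counted with multiplicity;
a multiple fixed point has multiplier one.) -/
def FixedPointsRepelling : Prop :=
  ∀ z ∈ F.U', F.toFun z = z → 1 < ‖deriv F.toFun z‖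

/-- The critical set `ω(0)`. -/
def criticalOmega : Set ℂ := omegaLimit atTop (fun (n : ℕ) (z : ℂ) => F.toFun^[n] z) {0}

end QuadraticLike

/-- The filled Julia set of `z ↦ z ^ 2 + c`: the complement of the basin of infinity. -/
def polyFilledJulia (c : ℂ) : Set ℂ :=
  {z | ¬ Tendsto (fun n : ℕ => ‖(fun w : ℂ => w ^ 2 + c)^[n] z‖) atTop atTop}

/-- `ψ` is the inverse of the Böttcher function of `z ↦ z ^ 2 + c` on the whole basin of infinity
(the filled Julia set being connected): the conformal isomorphism from `{|w| > 1}` onto the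
basin which conjugates `w ↦ w ^ 2` to the polynomial and is tangent to the identity at infinity. -/
structure IsBottcherInverse (c : ℂ) (ψ : ℂ → ℂ) : Prop where
  holomorphic : DifferentiableOn ℂ ψ {w | 1 < ‖w‖}
  bijective : BijOn ψ {w | 1 < ‖w‖} (polyFilledJulia c)ᶜ
  conj : ∀ w, 1 < ‖w‖ → ψ (w ^ 2) = ψ w ^ 2 + c
  asymptotic : Tendsto (fun w => ψ w / w) (cocompact ℂ) (𝓝 1)

/-- A choice of a conjugacy between a quadratic-like map and a quadratic polynomial
`z ↦ z ^ 2 + c`: a homeomorphism `h` of a neighbourhood of `K(f)` onto a neighbourhood of the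
filled Julia set of the polynomial which carries one filled Julia set to the other and
conjugates the two maps. External rays and equipotentials of `f` are defined through it. -/
structure PolyConjugacy (F : QuadraticLike) where
  c : ℂ
  h : OpenPartialHomeomorph ℂ ℂ
  filledJulia_subset : F.filledJulia ⊆ h.source
  image_filledJulia : h '' F.filledJulia = polyFilledJulia c
  conj : ∀ z ∈ h.source, z ∈ F.U' → F.toFun z ∈ h.source → h (F.toFun z) = h z ^ 2 + c

namespace PolyConjugacy

variable {F : QuadraticLike} (φ : PolyConjugacy F)

/-- The point `z`, near `K(f)`, has the external (Böttcher) coordinate `w`, `|w| > 1`. -/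
def HasCoord (w z : ℂ) : Prop :=
  z ∈ φ.h.source ∧ 1 < ‖w‖ ∧ ∃ ψ, IsBottcherInverse φ.c ψ ∧ ψ w = φ.h z

/-- The external ray (near `K(f)`) whose angle is the point `u` of the unit circle. -/
def ray (u : Circle) : Set ℂ := {z | ∃ r : ℝ, 1 < r ∧ φ.HasCoord (r * u) z}

/-- The external ray of angle `u` lands at `a`. -/
def Lands (u : Circle) (a : ℂ) : Prop :=
  ∀ N ∈ 𝓝 a, ∀ᶠ r : ℝ in 𝓝[>] 1, ∃ z ∈ N, φ.HasCoord (r * u) z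

/-- At least two external rays land at `a`. -/
def IsDividing (a : ℂ) : Prop := ∃ u v : Circle, u ≠ v ∧ φ.Lands u a ∧ φ.Lands v a

/-- The union of the external rays landing at points of `A`, with their landing points. -/
def rays (A : Set ℂ) : Set ℂ := A ∪ {z | ∃ a ∈ A, ∃ u, φ.Lands u a ∧ z ∈ φ.ray u}

/-- The period of the rays landing at `a`: the least `p > 0` such that the `p`-th iterate of angle
doubling fixes the angles of all rays landing at `a`. -/
def rayPeriod (a : ℂ) : ℕ := sInf {p | 0 < p ∧ ∀ u, φ.Lands u a → u ^ (2 ^ p) = u}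

/-- The equipotential `E = {|w| = ρ}` is so close to `K(f)` that it is, together with everything
between `E` and `K(f)`, contained in the domain of the external coordinate and in `U'`, and so is
its image `f E = {|w| = ρ ^ 2}` (in the domain of the coordinate). -/
def GoodLevel (ρ : ℝ) : Prop :=
  1 < ρ ∧ ∀ w : ℂ, 1 < ‖w‖ → ‖w‖ ≤ ρ →
    ∃ z ∈ F.U', φ.HasCoord w z ∧ φ.HasCoord (w ^ 2) (F.toFun z)

/-- The open domain bounded by the equipotential of level `ρ`. -/
def disk (ρ : ℝ) : Set ℂ := F.filledJulia ∪ {z | ∃ w : ℂ, ‖w‖ < ρ ∧ φ.HasCoord w z}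

/-- The component `Ω ∋ 0` of the domain bounded by the equipotential cut along the rays landing
at the cycle of `a` and along the symmetric rays, `f⁻¹ R = R ∪ R'`. -/
def renormRange (ρ : ℝ) (a : ℂ) : Set ℂ :=
  connectedComponentIn
    (φ.disk ρ \ F.preim 1 (φ.rays {b | ∃ k : ℕ, b = F.toFun^[k] a})) 0

/-- The closed renormalization domain `Ω'`: the component, attached to `a`, of the preimage of the
closed domain `Ω` under `f^p`, where `p` is the period of the rays landing at `a`. -/
def renormDomain (ρ : ℝ) (a : ℂ) : Set ℂ :=
  connectedComponentIn (F.preim (φ.rayPeriod a) (closure (φ.renormRange ρ a))) a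

/-- `f` is DH-renormalizable: there is a dividing repelling cycle, with a point `a` of it on the
boundary of `Ω`, such that `Ω'` contains `0` and `0` does not escape `Ω'` under the iterates
of `f^p`. -/
def IsDHRenormalizable : Prop :=
  ∃ (ρ : ℝ) (a : ℂ), φ.GoodLevel ρ ∧
    a ∈ F.filledJulia ∧ a ∈ Function.periodicPts F.toFun ∧
    1 < ‖deriv (F.toFun^[Function.minimalPeriod F.toFun a]) a‖ ∧
    (∀ k : ℕ, φ.IsDividing (F.toFun^[k] a)) ∧
    a ∈ frontier (φ.renormRange ρ a) ∧
    0 < φ.rayPeriod a ∧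
    0 ∈ φ.renormDomain ρ a ∧
    ∀ k : ℕ, F.toFun^[φ.rayPeriod a * k] 0 ∈ φ.renormDomain ρ a

end PolyConjugacy

/-- The data of the Yoccoz puzzle: an equipotential close to `K(f)` and the dividing fixed
point `α`. -/
structure YoccozPuzzle {F : QuadraticLike} (φ : PolyConjugacy F) where
  ρ : ℝ
  goodLevel : φ.GoodLevel ρ
  α : ℂ
  α_mem : α ∈ F.U'
  fixed : F.toFun α = α
  dividing : φ.IsDividing α

namespace QuadraticLike

variable (F : QuadraticLike)

/-- The last piece (containing `z`) of the pull-back of `W` along `z, f z, …, f^l z`: the closure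
of the component of `f⁻ˡ (int W)` containing `z`. -/
def pullBack (W : Set ℂ) (l : ℕ) (z : ℂ) : Set ℂ :=
  closure (connectedComponentIn (F.preim l (interior W)) z)

/-- `l` is the first positive moment at which the orbit of `z` hits `int V`. -/
def IsFirstReturnTime (V : Set ℂ) (z : ℂ) (l : ℕ) : Prop :=
  0 < l ∧ z ∈ F.preim l (interior V) ∧ ∀ k, 0 < k → k < l → z ∉ F.preim k (interior V)

/-- The closed pieces `V_i` on whose interiors the first return map to `int V` is defined: the
pull-backs of `V` corresponding to the first returns of points of `int V`. -/
def returnPieces (V : Set ℂ) : Set (Set ℂ) :=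
  {P | ∃ z ∈ interior V, ∃ l, F.IsFirstReturnTime V z l ∧ P = F.pullBack V l z}

/-- The pieces `V_i` of the domain of the first return map to `V` which meet `ω(0)`. For
`V = V^{n-1}` in the principal nest, the map `f^l` (with `l` the first return time)
on the union of these pieces is the generalized renormalization `T^n f`. -/
def generalizedRenormPieces (V : Set ℂ) : Set (Set ℂ) :=
  {P | P ∈ F.returnPieces V ∧ (P ∩ F.criticalOmega).Nonempty}

end QuadraticLike

namespace YoccozPuzzle

variable {F : QuadraticLike} {φ : PolyConjugacy F} (Y : YoccozPuzzle φ)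

/-- `P` is a (closed) puzzle piece of depth zero. -/
def IsPieceZero (P : Set ℂ) : Prop :=
  ∃ z ∈ φ.disk Y.ρ \ φ.rays {Y.α},
    P = closure (connectedComponentIn (φ.disk Y.ρ \ φ.rays {Y.α}) z)

/-- `P` is a (closed) puzzle piece of depth `n`. -/
def IsPiece (n : ℕ) (P : Set ℂ) : Prop :=
  ∃ Q, Y.IsPieceZero Q ∧ ∃ z ∈ F.preim n (interior Q), P = F.pullBack Q n z

/-- `Z` is one of the pieces `Z_i` of depth one: the non-critical pieces of depth one attached to
the preimage `α' ≠ α` of `α`. -/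
def IsZPiece (Z : Set ℂ) : Prop :=
  Y.IsPiece 1 Z ∧ 0 ∉ Z ∧ ∃ α' ∈ F.U', F.toFun α' = Y.α ∧ α' ≠ Y.α ∧ α' ∈ Z

/-- `V` is the piece `V^n` of the principal nest `V^0 ⊃ V^1 ⊃ …`.  With `p` the period of the rays
landing at `α`, the piece `V^0` is the pull-back of `Z_i` along `0, …, f^{tp} 0`, where `t` is
the first moment at which `f^{tp} 0` lies in (the interior of) one of the pieces `Z_i`; there is no
such moment, and hence no nest, if `f` is immediately renormalizable.  `V^{n+1}` is the pull-back
of `V^n` corresponding to the first return of `0` to `int V^n`, if `0` does return. -/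
inductive IsNestPiece : ℕ → Set ℂ → Prop
  | zero (Z : Set ℂ) (t : ℕ) (hZ : Y.IsZPiece Z)
      (ht : 0 ∈ F.preim (t * φ.rayPeriod Y.α) (interior Z))
      (hmin : ∀ s < t, ∀ Z', Y.IsZPiece Z' →
        0 ∉ F.preim (s * φ.rayPeriod Y.α) (interior Z')) :
      IsNestPiece 0 (F.pullBack Z (t * φ.rayPeriod Y.α) 0)
  | succ (n : ℕ) (V : Set ℂ) (l : ℕ) (hV : IsNestPiece n V)
      (hl : F.IsFirstReturnTime V 0 l) : IsNestPiece (n + 1) (F.pullBack V l 0)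

end YoccozPuzzle

end

noncomputable section

/-! ### Connected components of subsets -/

/-! Write `q z = z ^ 2 + c`, carry the situation to the plane of `q` by the conjugacy, and let `p`
be the period of the rays landing at the point `a` of the renormalization cycle. Everything depends
on whether `a` is `α`.

If `a ≠ α`, the successive pull-backs of the renormalization domain under the `p`-th iterate
decrease to a continuum `C` that contains `0`, is invariant under this iterate and contains no
preimage of `α` (`exists_renormalization_continuum`). The interior of a nest piece `V` is the
component of `0` in some `f⁻ᴺ` of the equipotential disk cut along the rays at `α`. Since `C` is
connected and never hits `α`, it lies in `int V`. Now `ω(0)` is covered by `C, f C, …, f^(p-1) C`,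
so each of its points enters `int V` within `p` steps. A return piece meeting `ω(0)` therefore has
return time `l ≤ p`; its interior is mapped onto `int V`, so it contains one of the finitely many
points of `f⁻ˡ(0)`, and this point and `l` determine the piece.

If `a = α`, the nest is empty (`IsNestPiece.false_of_isCriticalPair`). The points `f^{tp} 0` stay in
the renormalization domain, so their images lie in the sector at `α` containing the critical value.
No ray at `α` enters this sector, hence a piece of depth one with such a point in its interior
contains `0` and is not one of the `Z_i`.

The continuum comes from the geometry of sectors. Among the arcs between rays landing together on
the cycle, a shortest one bounds a sector that contains the critical value and no ray of the cycle,
and its vertex has to be `q a`. Let `M` be the set of points, in a large ball, whose image is not in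
the complementary open sector, and let `W` be the component of `q^{-p} M` at `a`. Because the
iterates of `q` preserve the sides of the rays near the cycle, `W` cannot cross the rays bounding
`M`, and its intermediate images stay in closed lateral sectors, where `q` is injective. So `W ⊆ M`,
and `0` is the only point of `W` over `q^p 0`. This total ramification makes every relevant
component of a further pull-back contain `0`, so the orbit of `0` is never lost
(`exists_invariant_continuum`).

Sectors rest on a separation theorem: two rays with a common landing point cut the plane into
exactly two components. At least two, because otherwise continuous logarithms off the single rays
would glue to a logarithm on a punctured plane; at most two, because every component contains points
of rays, a bounded open set having uncountable frontier. -/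

theorem closure_connectedComponentIn_inter_subset {X : Type*} [TopologicalSpace X] (M : Set X)
    (z : X) : closure (connectedComponentIn M z) ∩ M ⊆ connectedComponentIn M z := by
  rintro y ⟨hy, hyM⟩
  by_cases hz : z ∈ M
  · have h1 : IsPreconnected (insert y (connectedComponentIn M z)) :=
      isPreconnected_connectedComponentIn.subset_closure (subset_insert _ _)
        (insert_subset hy subset_closure)
    exact h1.subset_connectedComponentIn (mem_insert_of_mem _ (mem_connectedComponentIn hz))
      (insert_subset hyM (connectedComponentIn_subset _ _)) (mem_insert _ _)
  · rw [connectedComponentIn_eq_empty hz] at hy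
    simp at hy

theorem frontier_connectedComponentIn_inter {M : Set ℂ} (hM : IsOpen M) (z : ℂ) :
    frontier (connectedComponentIn M z) ⊆ closure (connectedComponentIn M z) \ M := by
  intro y hy
  refine ⟨hy.1, fun hyM => hy.2 ?_⟩
  rw [hM.connectedComponentIn.interior_eq]
  exact closure_connectedComponentIn_inter_subset M z ⟨hy.1, hyM⟩

/-- A bounded nonempty open subset of the plane has an uncountable frontier. -/
theorem not_countable_frontier {O : Set ℂ} (hO : IsOpen O) (hne : O.Nonempty)
    (hb : Bornology.IsBounded O) : ¬ (frontier O).Countable := by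
  intro hfr
  have hrank : 1 < Module.rank ℝ ℂ := by
    rw [Complex.rank_real_complex]; exact Nat.one_lt_ofNat
  -- The complement of a countable set is connected and dense in the plane, yet `O` and the exterior
  -- of `O` would split it.
  have hc := (hfr.isConnected_compl_of_one_lt_rank hrank).isPreconnected
  have hd := hfr.dense_compl ℝ
  have h1 : ((frontier O)ᶜ ∩ O).Nonempty := by
    obtain ⟨x, hx, hx'⟩ := hd.inter_open_nonempty O hO hne
    exact ⟨x, hx', hx⟩
  have hne2 : ((closure O)ᶜ).Nonempty := by
    by_contra h
    rw [not_nonempty_iff_eq_empty, compl_empty_iff] at h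
    have := hb.closure
    rw [h] at this
    exact NormedSpace.unbounded_univ ℝ ℂ this
  have h2 : ((frontier O)ᶜ ∩ (closure O)ᶜ).Nonempty := by
    obtain ⟨x, hx, hx'⟩ := hd.inter_open_nonempty _ isClosed_closure.isOpen_compl hne2
    exact ⟨x, hx', hx⟩
  obtain ⟨x, -, hx1, hx2⟩ := hc O (closure O)ᶜ hO isClosed_closure.isOpen_compl (by
    intro x hx
    by_cases h : x ∈ closure O
    · left
      by_contra h'
      exact hx ⟨h, by rwa [hO.interior_eq]⟩
    · exact Or.inr h) h1 h2
  exact hx2 (subset_closure hx1)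

/-- A component of the preimage of a compact connected set under a continuous open map is mapped
onto this set. -/
theorem image_connectedComponentIn_preimage {g : ℂ → ℂ} (hc : Continuous g) (ho : IsOpenMap g)
    {Q : Set ℂ} (hQ : IsPreconnected Q) (hE : IsCompact (g ⁻¹' Q)) {z : ℂ}
    (hz : g z ∈ Q) : g '' connectedComponentIn (g ⁻¹' Q) z = Q := by
  apply Subset.antisymm
  · rintro _ ⟨x, hx, rfl⟩
    exact connectedComponentIn_subset (g ⁻¹' Q) _ hx
  intro q hq
  have hz' : z ∈ g ⁻¹' Q := hz
  have : CompactSpace (g ⁻¹' Q) := isCompact_iff_compactSpace.1 hE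
  let x : (g ⁻¹' Q) := ⟨z, hz'⟩
  -- A clopen part of the preimage has clopen image in the connected set `Q`, hence maps onto it.
  -- The component of `z` is the intersection of the clopen parts containing it, and compactness
  -- provides a common point over `q`.
  have key : ∀ S : Set (g ⁻¹' Q), IsClopen S → x ∈ S → ∃ e ∈ S, g e = q := by
    intro S hS hxS
    have : PreconnectedSpace Q := isPreconnected_iff_preconnectedSpace.1 hQ
    let G : (g ⁻¹' Q) → Q := fun e => ⟨g e, e.2⟩
    have hG : Continuous G := by
      apply Continuous.subtype_mk
      exact hc.comp continuous_subtype_val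
    have hGo : IsOpenMap G := ho.restrictPreimage Q
    have hcl : IsClopen (G '' S) := by
      constructor
      · have : T2Space Q := inferInstance
        exact (hS.1.isCompact.image hG).isClosed
      · exact hGo _ hS.2
    have := hcl.eq_univ ⟨G x, mem_image_of_mem _ hxS⟩
    have h2 : (⟨q, hq⟩ : Q) ∈ G '' S := by rw [this]; trivial
    obtain ⟨e, he, he'⟩ := h2
    exact ⟨e, he, congrArg Subtype.val he'⟩
  have hcomp := connectedComponent_eq_iInter_isClopen x
  let ι := { s : Set (g ⁻¹' Q) // IsClopen s ∧ x ∈ s }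
  let t : ι → Set (g ⁻¹' Q) := fun s => s.1 ∩ {e | g e = q}
  have hclosed : IsClosed {e : (g ⁻¹' Q) | g e = q} :=
    isClosed_eq (hc.comp continuous_subtype_val) continuous_const
  have : Nonempty ι := ⟨⟨univ, isClopen_univ, mem_univ _⟩⟩
  have hne : (⋂ i, t i).Nonempty := by
    apply IsCompact.nonempty_iInter_of_directed_nonempty_isCompact_isClosed
    · intro s s'
      refine ⟨⟨s.1 ∩ s'.1, s.2.1.inter s'.2.1, s.2.2, s'.2.2⟩, ?_, ?_⟩
      · exact inter_subset_inter_left _ inter_subset_left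
      · exact inter_subset_inter_left _ inter_subset_right
    · rintro ⟨s, hs, hxs⟩
      obtain ⟨e, he, he'⟩ := key s hs hxs
      exact ⟨e, he, he'⟩
    · intro s
      exact (s.2.1.1.inter hclosed).isCompact
    · intro s
      exact s.2.1.1.inter hclosed
  obtain ⟨e, he⟩ := hne
  rw [mem_iInter] at he
  refine ⟨e, ?_, (he ⟨univ, isClopen_univ, mem_univ _⟩).2⟩
  rw [connectedComponentIn_eq_image hz']
  refine ⟨e, ?_, rfl⟩
  rw [hcomp, mem_iInter]
  intro s
  exact (he s).1

/-- A decreasing sequence of compact preconnected sets has preconnected intersection. -/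
theorem isPreconnected_iInter_antitone {C : ℕ → Set ℂ} (hanti : Antitone C)
    (hcomp : ∀ n, IsCompact (C n)) (hconn : ∀ n, IsPreconnected (C n)) :
    IsPreconnected (⋂ n, C n) := by
  have hcl : IsClosed (⋂ n, C n) := isClosed_iInter fun n => (hcomp n).isClosed
  have hK : IsCompact (⋂ n, C n) := (hcomp 0).of_isClosed_subset hcl (iInter_subset _ _)
  rw [isPreconnected_iff_subset_of_disjoint_closed]
  intro u v hu hv huv hdis
  have hA : IsCompact ((⋂ n, C n) ∩ u) := hK.inter_right hu
  have hB : IsCompact ((⋂ n, C n) ∩ v) := hK.inter_right hv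
  have hAB : Disjoint ((⋂ n, C n) ∩ u) ((⋂ n, C n) ∩ v) := by
    rw [disjoint_iff_inter_eq_empty, ← inter_inter_distrib_left, hdis]
  obtain ⟨U, V, hU, hV, hAU, hBV, hUV⟩ := SeparatedNhds.of_isCompact_isCompact hA hB hAB
  obtain ⟨n, hn⟩ : ∃ n, C n ⊆ U ∪ V := by
    by_contra hcon
    push Not at hcon
    have hne : (⋂ n, C n ∩ (U ∪ V)ᶜ).Nonempty := by
      apply IsCompact.nonempty_iInter_of_sequence_nonempty_isCompact_isClosed
      · intro i
        exact inter_subset_inter_left _ (hanti (Nat.le_succ i))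
      · intro i
        obtain ⟨x, hx, hx'⟩ := not_subset.1 (hcon i)
        exact ⟨x, hx, hx'⟩
      · exact (hcomp 0).inter_right (hU.union hV).isClosed_compl
      · intro i
        exact (hcomp i).isClosed.inter (hU.union hV).isClosed_compl
    obtain ⟨x, hx⟩ := hne
    rw [mem_iInter] at hx
    have hxC : x ∈ ⋂ n, C n := mem_iInter.2 fun n => (hx n).1
    rcases huv hxC with h | h
    · exact (hx 0).2 (Or.inl (hAU ⟨hxC, h⟩))
    · exact (hx 0).2 (Or.inr (hBV ⟨hxC, h⟩))
  have hsub : (⋂ n, C n) ⊆ C n := iInter_subset _ _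
  rcases (isPreconnected_iff_subset_of_disjoint.1 (hconn n)) U V hU hV hn (by
      rw [hUV.inter_eq, inter_empty]) with h | h
  · left
    intro x hx
    rcases huv hx with h' | h'
    · exact h'
    · exact absurd (hBV ⟨hx, h'⟩) (fun hv' => hUV.le_bot ⟨h (hsub hx), hv'⟩)
  · right
    intro x hx
    rcases huv hx with h' | h'
    · exact absurd (hAU ⟨hx, h'⟩) (fun hv' => hUV.le_bot ⟨hv', h (hsub hx)⟩)
    · exact h'

/-! ### Continuous logarithms -/

/-- The family in `s` deforms the constant function `1` into the given function through nonvanishing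
functions, so the logarithm `0` of `1` can be lifted along it through the covering `exp`. -/
theorem exists_log_of_homotopy {S : Set ℂ} {z₀ : ℂ} (η : C(unitInterval, ℂ)) (h0 : η 0 = 0)
    (hne : ∀ z ∈ S, ∀ s, 1 + (z - z₀) * η s ≠ 0) :
    ∃ L : ℂ → ℂ, ContinuousOn L S ∧ ∀ z ∈ S, Complex.exp (L z) = 1 + (z - z₀) * η 1 := by
  let H : C(unitInterval × S, {z : ℂ // z ≠ 0}) :=
    ⟨fun q => ⟨1 + ((q.2 : ℂ) - z₀) * η q.1, hne _ q.2.2 _⟩, by fun_prop⟩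
  let f : C(S, ℂ) := ContinuousMap.const _ 0
  have H0 : ∀ a, H (0, a) = ⟨Complex.exp (f a), Complex.exp_ne_zero _⟩ := by
    intro a
    apply Subtype.ext
    simp [H, f, h0]
  let G := Complex.isCoveringMap_exp.liftHomotopy H f H0
  have hG := Complex.isCoveringMap_exp.liftHomotopy_lifts H f H0
  classical
  refine ⟨fun z => if hz : z ∈ S then G (1, ⟨z, hz⟩) else 0, ?_, ?_⟩
  · rw [continuousOn_iff_continuous_domRestrict]
    have : S.domRestrict (fun z => if hz : z ∈ S then G (1, ⟨z, hz⟩) else 0) =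
        fun a => G (1, a) := by
      funext a
      simp [Set.domRestrict]
    rw [this]
    fun_prop
  · intro z hz
    simp only [hz, dif_pos]
    have := congrArg Subtype.val (congrFun hG (1, ⟨z, hz⟩))
    simpa [H, G] using this

/-- Distinct points with equal exponentials are at least `2π` apart, so `exp` is locally injective
and a continuous lift of a constant on a connected set is constant. -/
theorem eq_of_exp_eq_of_isPreconnected {X : Type*} [TopologicalSpace X] {S : Set X}
    (hS : IsPreconnected S) {g : X → ℂ} (hg : ContinuousOn g S) {κ : ℂ}
    (h : ∀ x ∈ S, Complex.exp (g x) = κ) {x y : X} (hx : x ∈ S) (hy : y ∈ S) : g x = g y := by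
  have hcov : IsLocallyInjective (fun z : ℂ => Complex.exp z) :=
    fun z => ⟨Metric.ball z 1, Metric.isOpen_ball, Metric.mem_ball_self one_pos, by
      intro x hx y hy hxy
      obtain ⟨n, hn⟩ := Complex.exp_eq_exp_iff_exists_int.1 hxy
      have h1 : ‖x - y‖ < 2 := by
        rw [← dist_eq_norm]
        rw [Metric.mem_ball] at hx hy
        calc dist x y ≤ dist x z + dist y z := dist_triangle_right _ _ _
          _ < 2 := by linarith
      rw [hn] at h1
      simp only [add_sub_cancel_left, norm_mul, Complex.norm_intCast, Complex.norm_two,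
        Complex.norm_I, mul_one, Complex.norm_real, Real.norm_eq_abs,
        abs_of_pos Real.pi_pos] at h1
      by_cases hn0 : n = 0
      · simpa [hn0] using hn
      · exfalso
        have : (1 : ℝ) ≤ |(n : ℝ)| := by
          rw [← Int.cast_abs]
          exact_mod_cast Int.one_le_abs hn0
        nlinarith [Real.pi_gt_three]⟩
  exact (T2Space.isSeparatedMap Complex.exp).eqOn_of_comp_eqOn hcov hS hg continuousOn_const
    (fun s hs => by simp [h s hs, h y hy]) hy rfl hx

/-- There is no continuous logarithm of a nonzero multiple of `z - b` around `b`. -/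
theorem no_log_punctured {b κ : ℂ} (hκ : κ ≠ 0) (L : ℂ → ℂ) (hL : ContinuousOn L {b}ᶜ)
    (h : ∀ z, z ≠ b → Complex.exp (L z) = (z - b) * κ) : False := by
  -- The exponential of `g` is constant, so `g` is constant; but after one turn around `b` the value
  -- of `L` is the same while `t * I` has grown by `2πi`.
  let g : ℝ → ℂ := fun t => L (b + Complex.exp (t * Complex.I)) - t * Complex.I
  have hmem : ∀ t : ℝ, b + Complex.exp (t * Complex.I) ∈ ({b}ᶜ : Set ℂ) := by
    intro t
    simp [Complex.exp_ne_zero]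
  have hg : Continuous g := by
    apply Continuous.sub
    · exact hL.comp_continuous (by fun_prop) hmem
    · fun_prop
  have hexp : ∀ t, Complex.exp (g t) = κ := by
    intro t
    simp only [g]
    rw [Complex.exp_sub, h _ (hmem t)]
    have := Complex.exp_ne_zero (t * Complex.I)
    field_simp
    ring
  have hconst : ∀ t, g t = g 0 := fun t =>
    eq_of_exp_eq_of_isPreconnected isPreconnected_univ hg.continuousOn
      (fun s _ => hexp s) (mem_univ t) (mem_univ 0)
  have h1 := hconst (2 * Real.pi)
  simp only [g] at h1
  have h2 : Complex.exp (((2 * Real.pi : ℝ) : ℂ) * Complex.I) = Complex.exp ((0 : ℝ) * Complex.I) := by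
    push_cast
    rw [Complex.exp_two_pi_mul_I]; simp
  rw [h2] at h1
  have h3 : ((2 * Real.pi : ℝ) : ℂ) * Complex.I = 0 := by
    have := sub_right_injective h1
    simp at this
  simp [Real.pi_ne_zero] at h3

/-! ### Oriented angles on the circle -/

/-- The length, in `[0, 2π)`, of the positively oriented arc from `u` to `v`. -/
def ang (u v : Circle) : ℝ := toIcoMod Real.two_pi_pos 0 (Complex.arg (v / u : Circle))

theorem ang_nonneg (u v : Circle) : 0 ≤ ang u v := left_le_toIcoMod _ _ _

theorem ang_lt (u v : Circle) : ang u v < 2 * Real.pi := by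
  have := toIcoMod_lt_right Real.two_pi_pos 0 (Complex.arg (v / u : Circle))
  simpa [ang] using this

theorem mul_exp_ang (u v : Circle) : u * Circle.exp (ang u v) = v := by
  have h : Circle.exp (ang u v) = v / u := by
    rw [ang, toIcoMod, Circle.exp_sub, Circle.exp_arg, Circle.exp_zsmul, Circle.exp_two_pi]
    simp
  rw [h, mul_div_cancel]

theorem ang_eq_of_mul_exp {u v : Circle} {θ : ℝ} (h : v = u * Circle.exp θ) (h0 : 0 ≤ θ)
    (h1 : θ < 2 * Real.pi) : ang u v = θ := by
  have h2 : Circle.exp (ang u v) = Circle.exp θ := by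
    have := mul_exp_ang u v
    rw [h] at this ⊢
    exact mul_left_cancel this
  obtain ⟨m, hm⟩ := Circle.exp_eq_exp.1 h2
  have h3 := ang_nonneg u v
  have h4 := ang_lt u v
  have hpi := Real.pi_pos
  have hm0 : m = 0 := by
    have h5 : (m : ℝ) < 1 := by
      by_contra hc
      push Not at hc
      nlinarith
    have h6 : (-1 : ℝ) < m := by
      by_contra hc
      push Not at hc
      nlinarith
    have h7 : m < 1 := by exact_mod_cast h5
    have h8 : -1 < m := by exact_mod_cast h6
    omega
  simpa [hm0] using hm

@[simp] theorem ang_self (u : Circle) : ang u u = 0 :=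
  ang_eq_of_mul_exp (by simp) le_rfl Real.two_pi_pos

theorem ang_pos {u v : Circle} (h : u ≠ v) : 0 < ang u v := by
  refine lt_of_le_of_ne (ang_nonneg u v) fun h0 => h ?_
  have := mul_exp_ang u v
  rwa [← h0, Circle.exp_zero, mul_one] at this

theorem ang_pos_iff {u v : Circle} : 0 < ang u v ↔ u ≠ v :=
  ⟨fun h e => by simp [e] at h, ang_pos⟩

/-- Oriented angles add up to a possible full turn. This dichotomy turns the statements on cyclic
order below into linear arithmetic. -/
theorem ang_add (u v w : Circle) :
    ang u v + ang v w = ang u w ∨ ang u v + ang v w = ang u w + 2 * Real.pi := by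
  have h : w = u * Circle.exp (ang u v + ang v w) := by
    rw [Circle.exp_add, ← mul_assoc, mul_exp_ang, mul_exp_ang]
  have h1 := ang_nonneg u v
  have h2 := ang_nonneg v w
  have h3 := ang_lt u v
  have h4 := ang_lt v w
  by_cases hlt : ang u v + ang v w < 2 * Real.pi
  · left
    rw [ang_eq_of_mul_exp h (by linarith) hlt]
  · right
    have h' : w = u * Circle.exp (ang u v + ang v w - 2 * Real.pi) := by
      rw [Circle.exp_sub, Circle.exp_two_pi, div_one]
      exact h
    rw [ang_eq_of_mul_exp h' (by linarith) (by linarith)]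
    ring

theorem ang_add_ang_swap {u v : Circle} (h : u ≠ v) : ang u v + ang v u = 2 * Real.pi := by
  have h1 := ang_pos h
  have h2 := ang_pos h.symm
  rcases ang_add u v u with h3 | h3 <;> rw [ang_self] at h3 <;> linarith

theorem ang_inj {u v w : Circle} (h : ang u v = ang u w) : v = w := by
  rw [← mul_exp_ang u v, h, mul_exp_ang]

theorem ang_mul_left (w u v : Circle) : ang (w * u) (w * v) = ang u v := by
  refine ang_eq_of_mul_exp ?_ (ang_nonneg _ _) (ang_lt _ _)
  rw [mul_assoc, mul_exp_ang]

@[simp] theorem ang_neg_neg (u v : Circle) : ang (-u) (-v) = ang u v := by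
  have := ang_mul_left (-1) u v
  simpa using this

theorem Circle.exp_pi_eq : Circle.exp Real.pi = -1 := by
  apply Circle.ext
  simp [Circle.coe_exp]

@[simp] theorem ang_neg_right_self (u : Circle) : ang u (-u) = Real.pi := by
  refine ang_eq_of_mul_exp ?_ Real.pi_pos.le (by linarith [Real.pi_pos])
  rw [Circle.exp_pi_eq]
  simp

@[simp] theorem ang_neg_left_self (u : Circle) : ang (-u) u = Real.pi := by
  have := ang_neg_right_self (-u)
  rwa [neg_neg] at this

theorem ang_sq_of_lt {u v : Circle} (h : ang u v < Real.pi) : ang (u ^ 2) (v ^ 2) = 2 * ang u v := by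
  refine ang_eq_of_mul_exp ?_ (by linarith [ang_nonneg u v]) (by linarith)
  conv_lhs => rw [← mul_exp_ang u v]
  rw [mul_pow, two_mul, Circle.exp_add, sq (Circle.exp _)]

theorem ang_sq_of_le {u v : Circle} (h : Real.pi ≤ ang u v) :
    ang (u ^ 2) (v ^ 2) = 2 * ang u v - 2 * Real.pi := by
  refine ang_eq_of_mul_exp ?_ (by linarith [ang_nonneg u v]) (by linarith [ang_lt u v])
  conv_lhs => rw [← mul_exp_ang u v]
  rw [mul_pow, two_mul, Circle.exp_sub, Circle.exp_add, sq (Circle.exp _), Circle.exp_two_pi,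
    div_one]

theorem Circle.eq_or_eq_neg_of_sq_eq {u v : Circle} (h : u ^ 2 = v ^ 2) : u = v ∨ u = -v := by
  have h' : (u : ℂ) ^ 2 = (v : ℂ) ^ 2 := by exact_mod_cast congrArg (fun z : Circle => (z : ℂ)) h
  rcases sq_eq_sq_iff_eq_or_eq_neg.1 h' with h1 | h1
  · exact Or.inl (Circle.ext h1)
  · right
    apply Circle.ext
    simpa using h1

theorem ang_ne_pi {u v : Circle} (h : u ^ 2 ≠ v ^ 2) : ang u v ≠ Real.pi := by
  intro hp
  apply h
  have := mul_exp_ang u v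
  rw [hp, Circle.exp_pi_eq] at this
  rw [← this]
  simp

/-- The open positively oriented arc from `u` to `v`. -/
def arc (u v : Circle) : Set Circle := {s | 0 < ang u s ∧ ang u s < ang u v}

theorem mem_arc_iff {u v s : Circle} : s ∈ arc u v ↔ s ≠ u ∧ ang u s < ang u v := by
  rw [arc, mem_ofPred_eq, ang_pos_iff, ne_comm]

theorem mem_arc_of_add {u s v : Circle} (h1 : u ≠ s) (h2 : s ≠ v)
    (h : ang u s + ang s v < 2 * Real.pi) : s ∈ arc u v := by
  have h3 := ang_pos h1
  have h4 := ang_pos h2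
  have h5 := ang_nonneg u v
  refine ⟨h3, ?_⟩
  rcases ang_add u s v with h | h <;> linarith

theorem ang_add_of_mem_arc {u s v : Circle} (h : s ∈ arc u v) : ang u s + ang s v = ang u v := by
  have h1 := ang_lt s v
  rcases ang_add u s v with h' | h'
  · exact h'
  · linarith [h.2]

theorem ne_of_mem_arc {u s v : Circle} (h : s ∈ arc u v) : s ≠ u ∧ s ≠ v ∧ u ≠ v := by
  refine ⟨(mem_arc_iff.1 h).1, ?_, ?_⟩
  · rintro rfl
    exact lt_irrefl _ h.2
  · rintro rfl
    have := h.1.trans h.2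
    simp at this

theorem mem_arc_or_mem_arc {u v s : Circle} (huv : u ≠ v) (hu : s ≠ u) (hv : s ≠ v) :
    s ∈ arc u v ∨ s ∈ arc v u := by
  have h1 := ang_pos hu.symm
  have h2 := ang_pos hv.symm
  have h3 := ang_add_ang_swap huv
  have h4 := ang_lt u s
  have h5 := ang_lt v s
  rcases lt_trichotomy (ang u s) (ang u v) with h | h | h
  · exact Or.inl ⟨h1, h⟩
  · exact absurd (ang_inj h) hv
  · right
    refine ⟨h2, ?_⟩
    rcases ang_add u v s with h' | h' <;> linarith

theorem not_mem_arc_swap {u v s : Circle} (h : s ∈ arc u v) : s ∉ arc v u := by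
  intro h'
  obtain ⟨h1, h2, h3⟩ := ne_of_mem_arc h
  have h4 := ang_add_of_mem_arc h
  have h5 := ang_add_of_mem_arc h'
  have h6 := ang_add_ang_swap h1
  have h7 := ang_add_ang_swap h2
  have h8 := ang_add_ang_swap h3
  have := Real.pi_pos
  linarith

theorem mem_arc_rotate {u v s : Circle} (h : s ∈ arc u v) : v ∈ arc s u := by
  obtain ⟨h1, h2, h3⟩ := ne_of_mem_arc h
  refine mem_arc_of_add h2 h3.symm ?_
  have h4 := ang_add_of_mem_arc h
  have h6 := ang_add_ang_swap h3
  have := ang_pos h1.symm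
  linarith

theorem arc_subset_of_mem {u v s : Circle} (h : s ∈ arc u v) : arc u s ⊆ arc u v :=
  fun _ ht => ⟨ht.1, ht.2.trans h.2⟩

theorem neg_mem_arc_neg {u v s : Circle} (h : s ∈ arc u v) : -s ∈ arc (-u) (-v) := by
  simpa [arc] using h

theorem mem_arc_neg_of_lt_pi {u v : Circle} (h : ang u v < Real.pi) (huv : u ≠ v) :
    u ∈ arc (-v) (-u) ∧ v ∈ arc (-v) (-u) := by
  have hp := Real.pi_pos
  have h1 := ang_add_ang_swap huv
  have h2 := ang_pos huv
  have hu : u ≠ -u := (Circle.neg_ne_self u).symm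
  have hv : v ≠ -v := (Circle.neg_ne_self v).symm
  refine ⟨⟨?_, ?_⟩, ⟨?_, ?_⟩⟩
  · rw [ang_pos_iff]
    intro e
    rw [← e, neg_eq_iff_eq_neg.1 e, ang_neg_left_self] at h
    exact lt_irrefl _ h
  · rw [ang_neg_neg]
    have h3 := ang_add (-v) (-u) u
    rw [ang_neg_neg, ang_neg_left_self] at h3
    have h4 := ang_nonneg (-v) u
    have h5 := ang_lt (-v) u
    rcases h3 with h3 | h3 <;> linarith
  · simpa using hp
  · simp only [ang_neg_left_self, ang_neg_neg]
    linarith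

/-- An arc shorter than `π` is mapped by squaring onto the arc between the squares. -/
theorem sq_mem_arc_of_lt_pi {u v s : Circle} (h : ang u v < Real.pi) (hs : s ∈ arc u v) :
    s ^ 2 ∈ arc (u ^ 2) (v ^ 2) := by
  have h1 := hs.2
  have h0 := hs.1
  refine ⟨?_, ?_⟩
  · rw [ang_sq_of_lt (h1.trans h)]; linarith
  · rw [ang_sq_of_lt (h1.trans h), ang_sq_of_lt h]; linarith

/-- The hypotheses put `s` in the arc from `v` to `-u` or in the antipodal arc from `-v` to `u`.
Both have length `π - ang u v`, and squaring stretches each of them onto the arc from `v ^ 2` to `u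
^ 2`. -/
theorem sq_mem_arc_swap_of_lt_pi {u v s : Circle} (h : ang u v < Real.pi) 
    (hs : s ∈ arc v u) (hs' : s ∈ arc (-v) (-u)) : s ^ 2 ∈ arc (v ^ 2) (u ^ 2) := by
  have hp := Real.pi_pos
  obtain ⟨n1, n2, n3⟩ := ne_of_mem_arc hs
  have hvu := ang_add_ang_swap n3
  have h1 := hs.1
  have h2 := hs.2
  have h3 := hs'.1
  have h4 := hs'.2
  rw [ang_neg_neg] at h4
  have h5 := ang_pos n3.symm
  have h6 := ang_add (-v) v s
  rw [ang_neg_left_self] at h6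
  have h7 := ang_lt (-v) s
  have h8 := ang_lt v s
  rw [arc, mem_ofPred_eq, ang_sq_of_le (show Real.pi ≤ ang v u by linarith)]
  rcases lt_or_ge (ang v s) Real.pi with h9 | h9
  · rw [ang_sq_of_lt h9]
    rcases h6 with h6 | h6 <;> constructor <;> linarith
  · rw [ang_sq_of_le h9]
    rcases h6 with h6 | h6
    · linarith
    · constructor <;> linarith

/-- If one of the arcs between three cyclically ordered points is longer than `π`, then squaring
preserves their cyclic order. -/
theorem sq_mem_arc_of_cyclic {u v w : Circle} (h : v ∈ arc u w)
    (hl : Real.pi < ang u v ∨ Real.pi < ang v w ∨ Real.pi < ang w u) :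
    v ^ 2 ∈ arc (u ^ 2) (w ^ 2) := by
  have hp := Real.pi_pos
  obtain ⟨n1, n2, n3⟩ := ne_of_mem_arc h
  have h1 := ang_add_of_mem_arc h
  have h2 := ang_add_ang_swap n3
  have p1 := ang_pos n1.symm
  have p2 := ang_pos n2
  have p3 := ang_pos n3.symm
  have key : ang (u ^ 2) (v ^ 2) + ang (v ^ 2) (w ^ 2) + ang (w ^ 2) (u ^ 2) = 2 * Real.pi ∧
      0 < ang (u ^ 2) (v ^ 2) ∧ 0 < ang (v ^ 2) (w ^ 2) ∧ 0 < ang (w ^ 2) (u ^ 2) := by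
    rcases hl with hl | hl | hl
    · rw [ang_sq_of_le hl.le, ang_sq_of_lt (show ang v w < Real.pi by linarith),
        ang_sq_of_lt (show ang w u < Real.pi by linarith)]
      refine ⟨?_, ?_, ?_, ?_⟩ <;> linarith
    · rw [ang_sq_of_le hl.le, ang_sq_of_lt (show ang u v < Real.pi by linarith),
        ang_sq_of_lt (show ang w u < Real.pi by linarith)]
      refine ⟨?_, ?_, ?_, ?_⟩ <;> linarith
    · rw [ang_sq_of_le hl.le, ang_sq_of_lt (show ang u v < Real.pi by linarith),
        ang_sq_of_lt (show ang v w < Real.pi by linarith)]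
      refine ⟨?_, ?_, ?_, ?_⟩ <;> linarith
  obtain ⟨k1, k2, k3, k4⟩ := key
  exact mem_arc_of_add (ang_pos_iff.1 k2) (ang_pos_iff.1 k3) (by linarith)

/-! ### The Böttcher coordinate of a quadratic polynomial -/

/-- The quadratic polynomial `z ↦ z ^ 2 + c`. -/
def qmap (c : ℂ) : ℂ → ℂ := fun w => w ^ 2 + c

theorem mem_polyFilledJulia {c z : ℂ} : z ∈ polyFilledJulia c ↔
    ¬ Tendsto (fun n : ℕ => ‖(qmap c)^[n] z‖) atTop atTop := Iff.rfl

theorem continuous_qmap (c : ℂ) : Continuous (qmap c) := by unfold qmap; fun_prop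

theorem qmap_neg (c z : ℂ) : qmap c (-z) = qmap c z := by simp [qmap]

theorem qmap_eq_iff {c z w : ℂ} : qmap c z = qmap c w ↔ z = w ∨ z = -w := by
  simp [qmap, sq_eq_sq_iff_eq_or_eq_neg]

theorem qmap_mem_iff {c z : ℂ} : qmap c z ∈ polyFilledJulia c ↔ z ∈ polyFilledJulia c := by
  rw [mem_polyFilledJulia, mem_polyFilledJulia, not_iff_not]
  rw [← tendsto_add_atTop_iff_nat (f := fun n : ℕ => ‖(qmap c)^[n] z‖) 1]
  simp [Function.iterate_succ_apply]

theorem neg_mem_polyFilledJulia {c z : ℂ} : -z ∈ polyFilledJulia c ↔ z ∈ polyFilledJulia c := by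
  rw [← qmap_mem_iff, qmap_neg, qmap_mem_iff]

theorem two_mul_norm_le_norm_qmap {c z : ℂ} (h : ‖c‖ + 3 ≤ ‖z‖) : 2 * ‖z‖ ≤ ‖qmap c z‖ := by
  have h1 : ‖z ^ 2‖ ≤ ‖qmap c z‖ + ‖c‖ := by
    have : z ^ 2 = qmap c z - c := by simp [qmap]
    rw [this]
    exact norm_sub_le _ _
  rw [norm_pow] at h1
  nlinarith [norm_nonneg c, norm_nonneg z]

theorem not_mem_polyFilledJulia_of_norm {c z : ℂ} (h : ‖c‖ + 3 ≤ ‖z‖) :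
    z ∉ polyFilledJulia c := by
  rw [mem_polyFilledJulia, not_not]
  have key : ∀ n : ℕ, (2 : ℝ) ^ n * ‖z‖ ≤ ‖(qmap c)^[n] z‖ := by
    intro n
    induction n with
    | zero => simp
    | succ n ih =>
      rw [Function.iterate_succ_apply']
      have h1 : (1 : ℝ) ≤ 2 ^ n := one_le_pow₀ (by norm_num)
      have h2 : ‖z‖ ≤ 2 ^ n * ‖z‖ := le_mul_of_one_le_left (norm_nonneg _) h1
      have := two_mul_norm_le_norm_qmap (h.trans (h2.trans ih))
      rw [pow_succ]
      linarith
  refine tendsto_atTop_mono key ?_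
  exact (tendsto_pow_atTop_atTop_of_one_lt (by norm_num)).atTop_mul_const
    (by linarith [norm_nonneg c])

theorem isBounded_polyFilledJulia (c : ℂ) : Bornology.IsBounded (polyFilledJulia c) := by
  refine (Metric.isBounded_closedBall (x := (0 : ℂ)) (r := ‖c‖ + 3)).subset fun z hz => ?_
  rw [mem_closedBall_zero_iff]
  by_contra h
  exact not_mem_polyFilledJulia_of_norm (not_le.1 h).le hz

theorem isOpen_exterior : IsOpen {w : ℂ | 1 < ‖w‖} := isOpen_lt continuous_const continuous_norm

theorem norm_real_mul_circle {r : ℝ} (hr : 0 ≤ r) (u : Circle) : ‖(r : ℂ) * u‖ = r := by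
  rw [norm_mul, Circle.norm_coe, mul_one, Complex.norm_real, Real.norm_of_nonneg hr]

theorem exists_polar (w : ℂ) : ∃ u : Circle, w = (‖w‖ : ℝ) * (u : ℂ) :=
  ⟨Circle.exp (Complex.arg w), by rw [Circle.coe_exp, Complex.norm_mul_exp_arg_mul_I]⟩

theorem real_mul_circle_inj {r s : ℝ} (hr : 0 < r) (hs : 0 < s) {u v : Circle}
    (h : (r : ℂ) * u = s * v) : r = s ∧ u = v := by
  have h1 : r = s := by
    have := congrArg norm h
    rwa [norm_real_mul_circle hr.le, norm_real_mul_circle hs.le] at this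
  subst h1
  refine ⟨rfl, Circle.ext ?_⟩
  exact mul_left_cancel₀ (by exact_mod_cast hr.ne') h

/-- The external ray of angle `u` lands at `b`. -/
def RayLands (ψ : ℂ → ℂ) (u : Circle) (b : ℂ) : Prop :=
  Tendsto (fun r : ℝ => ψ (r * u)) (𝓝[>] 1) (𝓝 b)

/-- The external ray of angle `u`, together with its landing point `b`. -/
def landedRay (ψ : ℂ → ℂ) (u : Circle) (b : ℂ) : Set ℂ :=
  insert b {z | ∃ r : ℝ, 1 < r ∧ z = ψ (r * u)}

theorem RayLands.eq {ψ : ℂ → ℂ} {u : Circle} {b b' : ℂ} (h : RayLands ψ u b)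
    (h' : RayLands ψ u b') : b = b' := tendsto_nhds_unique h h'

namespace IsBottcherInverse

variable {c : ℂ} {ψ : ℂ → ℂ} (H : IsBottcherInverse c ψ)
include H

theorem qmap_apply {w : ℂ} (hw : 1 < ‖w‖) : qmap c (ψ w) = ψ (w ^ 2) := (H.conj w hw).symm

theorem not_mem {w : ℂ} (hw : 1 < ‖w‖) : ψ w ∉ polyFilledJulia c := H.bijective.mapsTo hw

theorem exists_of_not_mem {z : ℂ} (hz : z ∉ polyFilledJulia c) : ∃ w, 1 < ‖w‖ ∧ ψ w = z :=
  H.bijective.surjOn hz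

theorem injOn : InjOn ψ {w | 1 < ‖w‖} := H.bijective.injOn

theorem inj {w w' : ℂ} (hw : 1 < ‖w‖) (hw' : 1 < ‖w'‖) (h : ψ w = ψ w') : w = w' :=
  H.injOn hw hw' h

/-- Both values have the same image under `q`, so they agree up to sign, and injectivity of `ψ`
excludes equality. -/
theorem apply_neg {w : ℂ} (hw : 1 < ‖w‖) : ψ (-w) = -ψ w := by
  have hw' : 1 < ‖-w‖ := by rwa [norm_neg]
  have h : qmap c (ψ (-w)) = qmap c (ψ w) := by
    rw [H.qmap_apply hw', H.qmap_apply hw, neg_sq]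
  rcases qmap_eq_iff.1 h with h1 | h1
  · exfalso
    have h2 := H.inj hw' hw h1
    rw [neg_eq_self] at h2
    simp [h2] at hw
    linarith
  · exact h1

theorem continuousOn : ContinuousOn ψ {w | 1 < ‖w‖} := H.holomorphic.continuousOn

theorem continuousAt {w : ℂ} (hw : 1 < ‖w‖) : ContinuousAt ψ w :=
  H.continuousOn.continuousAt (isOpen_exterior.mem_nhds hw)

theorem tendsto_cobounded : Tendsto ψ (cocompact ℂ) (cocompact ℂ) := by
  rw [← Metric.cobounded_eq_cocompact, ← tendsto_norm_atTop_iff_cobounded]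
  have h1 : Tendsto (fun w => ‖ψ w / w‖) (Bornology.cobounded ℂ) (𝓝 1) := by
    have := H.asymptotic.norm
    rwa [norm_one, ← Metric.cobounded_eq_cocompact] at this
  refine (h1.pos_mul_atTop one_pos tendsto_norm_cobounded_atTop).congr' ?_
  have h2 : ∀ᶠ w : ℂ in Bornology.cobounded ℂ, 0 < ‖w‖ :=
    tendsto_norm_cobounded_atTop.eventually_gt_atTop 0
  filter_upwards [h2] with w hw
  rw [norm_div, div_mul_cancel₀ _ hw.ne']

theorem isClosed_image {E : Set ℂ} (hE : IsClosed E) (hE1 : ∀ w ∈ E, 1 < ‖w‖) :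
    IsClosed (ψ '' E) := by
  rw [← isOpen_compl_iff, isOpen_iff_mem_nhds]
  intro z hz
  have hev : ∀ᶠ w in cocompact ℂ, ψ w ∉ Metric.closedBall z 1 :=
    H.tendsto_cobounded ((isCompact_closedBall z 1).compl_mem_cocompact)
  obtain ⟨B, hB, hBs⟩ := mem_cocompact.1 hev
  have hc : IsClosed (ψ '' (E ∩ B)) := by
    apply IsCompact.isClosed
    refine IsCompact.image_of_continuousOn (hB.inter_left hE) ?_
    exact H.continuousOn.mono fun w hw => hE1 w hw.1
  have hz' : z ∈ (ψ '' (E ∩ B))ᶜ := fun h => hz (image_mono inter_subset_left h)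
  filter_upwards [hc.isOpen_compl.mem_nhds hz', Metric.closedBall_mem_nhds z one_pos] with y h1 h2
  rintro ⟨w, hw, rfl⟩
  by_cases hwB : w ∈ B
  · exact h1 ⟨w, ⟨hw, hwB⟩, rfl⟩
  · exact hBs hwB h2

theorem isOpen_image {O : Set ℂ} (hO : IsOpen O) (hO1 : ∀ w ∈ O, 1 < ‖w‖) : IsOpen (ψ '' O) := by
  rw [isOpen_iff_mem_nhds]
  rintro _ ⟨w, hw, rfl⟩
  have han : AnalyticAt ℂ ψ w :=
    H.holomorphic.analyticAt (isOpen_exterior.mem_nhds (hO1 w hw))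
  refine (han.eventually_constant_or_nhds_le_map_nhds.resolve_left fun hconst => ?_)
    (image_mem_map (hO.mem_nhds hw))
  have h1 : ∀ᶠ z in 𝓝 w, z = w := by
    filter_upwards [hconst, hO.mem_nhds hw] with z hz hzO
    exact H.inj (hO1 z hzO) (hO1 w hw) hz
  have h2 : ∃ᶠ z in 𝓝 w, z ≠ w :=
    (frequently_iff_neBot.2 (inferInstance : (𝓝[≠] w).NeBot))
  exact h2 (h1.mono fun z hz => not_not.2 hz)

theorem isOpen_compl : IsOpen (polyFilledJulia c)ᶜ := by
  rw [← H.bijective.image_eq]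
  exact H.isOpen_image isOpen_exterior fun _ h => h

theorem isCompact_polyFilledJulia : IsCompact (polyFilledJulia c) :=
  Metric.isCompact_of_isClosed_isBounded ⟨H.isOpen_compl⟩ (isBounded_polyFilledJulia c)

theorem not_mem_ray {r : ℝ} (hr : 1 < r) (u : Circle) : ψ (r * u) ∉ polyFilledJulia c :=
  H.not_mem (by rwa [norm_real_mul_circle (by linarith)])

theorem ray_inj {r s : ℝ} (hr : 1 < r) (hs : 1 < s) {u v : Circle} (h : ψ (r * u) = ψ (s * v)) :
    r = s ∧ u = v :=
  real_mul_circle_inj (by linarith) (by linarith)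
    (H.inj (by rwa [norm_real_mul_circle (by linarith)])
      (by rwa [norm_real_mul_circle (by linarith)]) h)

theorem exists_ray_of_not_mem {z : ℂ} (hz : z ∉ polyFilledJulia c) :
    ∃ (r : ℝ) (u : Circle), 1 < r ∧ z = ψ (r * u) := by
  obtain ⟨w, hw, rfl⟩ := H.exists_of_not_mem hz
  obtain ⟨u, hu⟩ := exists_polar w
  exact ⟨‖w‖, u, hw, by rw [← hu]⟩

theorem qmap_ray {r : ℝ} (hr : 1 < r) (u : Circle) :
    qmap c (ψ (r * u)) = ψ ((r ^ 2 : ℝ) * (u ^ 2 : Circle)) := by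
  rw [H.qmap_apply (by rwa [norm_real_mul_circle (by linarith)])]
  congr 1
  push_cast
  ring

theorem neg_ray {r : ℝ} (hr : 1 < r) (u : Circle) : -ψ (r * u) = ψ (r * (-u : Circle)) := by
  rw [← H.apply_neg (by rwa [norm_real_mul_circle (by linarith)])]
  congr 1
  push_cast
  ring

/-- A landing point `ψ w` off the filled Julia set would have the neighbourhood `ψ {s < ‖·‖}` with
`1 < s < ‖w‖`, which the ray leaves once its radius is below `s`. -/
theorem landing_mem {u : Circle} {b : ℂ} (h : RayLands ψ u b) : b ∈ polyFilledJulia c := by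
  by_contra hb
  obtain ⟨w, hw, rfl⟩ := H.exists_of_not_mem hb
  obtain ⟨s, hs1, hs2⟩ := exists_between hw
  have hO : IsOpen (ψ '' {w | s < ‖w‖}) :=
    H.isOpen_image (isOpen_lt continuous_const continuous_norm) fun w h => hs1.trans h
  have h2 : ∀ᶠ r : ℝ in 𝓝[>] 1, 1 < r ∧ r < s := Ioo_mem_nhdsGT hs1
  obtain ⟨r, ⟨w', hw', hw''⟩, hr1, hr2⟩ := ((h.eventually (hO.mem_nhds ⟨w, hs2, rfl⟩)).and h2).exists
  have hw1 : 1 < ‖w'‖ := hs1.trans hw'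
  have h3 := H.inj hw1 (by rwa [norm_real_mul_circle (by linarith)]) hw''
  have h4 : s < ‖w'‖ := hw'
  rw [h3, norm_real_mul_circle (by linarith)] at h4
  linarith

theorem rayLands_neg {u : Circle} {b : ℂ} (h : RayLands ψ u b) : RayLands ψ (-u) (-b) := by
  refine (Tendsto.neg h).congr' ?_
  filter_upwards [self_mem_nhdsWithin] with r hr
  exact H.neg_ray hr u

theorem rayLands_sq {u : Circle} {b : ℂ} (h : RayLands ψ u b) :
    RayLands ψ (u ^ 2) (qmap c b) := by
  have h1 : Tendsto Real.sqrt (𝓝[>] 1) (𝓝[>] 1) := by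
    refine tendsto_nhdsWithin_iff.2 ⟨?_, ?_⟩
    · have : Tendsto Real.sqrt (𝓝 1) (𝓝 (Real.sqrt 1)) := Real.continuous_sqrt.tendsto 1
      rw [Real.sqrt_one] at this
      exact this.mono_left nhdsWithin_le_nhds
    · filter_upwards [self_mem_nhdsWithin] with r hr
      exact Real.lt_sqrt_of_sq_lt (by simpa using hr)
  have h2 := ((continuous_qmap c).tendsto b).comp (h.comp h1)
  refine h2.congr' ?_
  filter_upwards [self_mem_nhdsWithin] with r hr
  have hr1 : 1 < Real.sqrt r := Real.lt_sqrt_of_sq_lt (by simpa using hr)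
  simp only [Function.comp_apply]
  rw [H.qmap_ray hr1, Real.sq_sqrt (by linarith [show (1:ℝ) < r from hr])]

/-- The end of the ray with radius close to `1` is near `b`, and the rest is the image of a closed
set under `ψ`, closed because `ψ` is proper at infinity. -/
theorem isClosed_landedRay {u : Circle} {b : ℂ} (h : RayLands ψ u b) :
    IsClosed (landedRay ψ u b) := by
  rw [← isOpen_compl_iff, isOpen_iff_mem_nhds]
  intro z hz
  have hzb : z ≠ b := fun e => hz (Or.inl e)
  obtain ⟨N, N', hN, hN', hbN, hzN', hdisj⟩ := t2_separation hzb.symm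
  have h1 := h (hN.mem_nhds hbN)
  obtain ⟨s, hs, hs'⟩ := (mem_nhdsGT_iff_exists_Ioo_subset (a := (1 : ℝ))).1 h1
  have hs1 : (1 : ℝ) < s := hs
  have hcl : IsClosed {w : ℂ | ∃ r : ℝ, s ≤ r ∧ w = r * u} := by
    have : {w : ℂ | ∃ r : ℝ, s ≤ r ∧ w = r * u} = {w : ℂ | w = (‖w‖ : ℝ) * (u : ℂ) ∧ s ≤ ‖w‖} := by
      ext w
      constructor
      · rintro ⟨r, hr, rfl⟩
        have : ‖(r : ℂ) * u‖ = r := norm_real_mul_circle (by linarith) u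
        constructor
        · rw [this]
        · rwa [this]
      · rintro ⟨h1, h2⟩
        exact ⟨‖w‖, h2, h1⟩
    rw [this]
    exact (isClosed_eq continuous_id (by fun_prop)).inter
      (isClosed_le continuous_const continuous_norm)
  have hcl2 := H.isClosed_image hcl (by
    rintro w ⟨r, hr, rfl⟩
    rw [norm_real_mul_circle (by linarith)]
    linarith)
  have hz2 : z ∈ (ψ '' {w : ℂ | ∃ r : ℝ, s ≤ r ∧ w = r * u})ᶜ := by
    rintro ⟨w, ⟨r, hr, rfl⟩, rfl⟩
    exact hz (Or.inr ⟨r, by linarith, rfl⟩)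
  filter_upwards [hcl2.isOpen_compl.mem_nhds hz2, hN'.mem_nhds hzN'] with y h2 h3
  rintro (rfl | ⟨r, hr, rfl⟩)
  · exact hdisj.le_bot ⟨hbN, h3⟩
  · by_cases hrs : r < s
    · exact hdisj.le_bot ⟨hs' ⟨hr, hrs⟩, h3⟩
    · exact h2 ⟨_, ⟨r, not_lt.1 hrs, rfl⟩, rfl⟩

/-- Moving the point `γ` along the ray from infinity to `b` deforms the constant `1` into `(z - b) /
(z₀ - b)` through the functions `(z - γ) / (z₀ - γ)`, which have no zeros off the ray. -/
theorem exists_log_compl_landedRay {u : Circle} {b z₀ : ℂ} (h : RayLands ψ u b)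
    (hz₀ : z₀ ∉ landedRay ψ u b) :
    ∃ L : ℂ → ℂ, ContinuousOn L (landedRay ψ u b)ᶜ ∧
      ∀ z ∉ landedRay ψ u b, Complex.exp (L z) = (z - b) * (z₀ - b)⁻¹ := by
  have hzb : z₀ - b ≠ 0 := sub_ne_zero.2 fun e => hz₀ (Or.inl e)
  -- The parameter is `s = 1 / r`: infinity corresponds to `s = 0`, where `e` takes the value `0`,
  -- and the landing point to `s = 1`. For `s > 0` one has `1 + (z - z₀) * e s = (z - γ s) / (z₀ - γ
  -- s)`.
  let γ : ℝ → ℂ := fun s => if s < 1 then ψ ((s⁻¹ : ℝ) * u) else b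
  let e : ℝ → ℂ := fun s => if s ≤ 0 then 0 else (z₀ - γ s)⁻¹
  have hγ : ∀ s, 0 < s → γ s ∈ landedRay ψ u b := by
    intro s hs
    simp only [γ]
    split_ifs with h1
    · exact Or.inr ⟨s⁻¹, (one_lt_inv₀ hs).2 h1, rfl⟩
    · exact Or.inl rfl
  have hcont : ContinuousOn e (Icc 0 1) := by
    intro x hx
    rcases hx.1.eq_or_lt with rfl | hx0
    · have : Icc (0 : ℝ) 1 = insert 0 (Ioc 0 1) := (Ioc_insert_left zero_le_one).symm
      rw [this, continuousWithinAt_insert_self]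
      have e0 : e 0 = 0 := by simp [e]
      rw [ContinuousWithinAt, e0]
      have h1 : Tendsto (fun s : ℝ => (z₀ - ψ ((s⁻¹ : ℝ) * u))⁻¹) (𝓝[>] 0) (𝓝 0) := by
        have ha : Tendsto (fun s : ℝ => ((s⁻¹ : ℝ) : ℂ) * u) (𝓝[>] 0) (cocompact ℂ) := by
          rw [← Metric.cobounded_eq_cocompact, ← tendsto_norm_atTop_iff_cobounded]
          refine tendsto_inv_nhdsGT_zero.congr' ?_
          filter_upwards [self_mem_nhdsWithin] with s hs
          rw [norm_real_mul_circle (inv_nonneg.2 (le_of_lt hs))]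
        have hb := H.tendsto_cobounded.comp ha
        rw [← Metric.cobounded_eq_cocompact] at hb
        have hc : Tendsto (fun s : ℝ => z₀ - ψ ((s⁻¹ : ℝ) * u)) (𝓝[>] 0)
            (Bornology.cobounded ℂ) := by
          have := (tendsto_const_sub_cobounded z₀).comp hb
          exact this
        exact tendsto_inv₀_cobounded.comp hc
      refine (h1.mono_left (nhdsWithin_mono _ Ioc_subset_Ioi_self)).congr' ?_
      have h2 : ∀ᶠ s : ℝ in 𝓝[Ioc 0 1] 0, s < 1 :=
        nhdsWithin_le_nhds (Iio_mem_nhds one_pos)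
      filter_upwards [self_mem_nhdsWithin, h2] with s hs hs1
      simp only [e, γ, if_neg (not_le.2 hs.1), if_pos hs1]
    rcases hx.2.eq_or_lt with rfl | hx1
    · have : Icc (0 : ℝ) 1 = insert 1 (Ico 0 1) := (Ico_insert_right zero_le_one).symm
      rw [this, continuousWithinAt_insert_self]
      have e1 : e 1 = (z₀ - b)⁻¹ := by simp [e, γ]
      rw [ContinuousWithinAt, e1]
      have h1 : Tendsto (fun s : ℝ => s⁻¹) (𝓝[<] 1) (𝓝[>] 1) := by
        refine tendsto_nhdsWithin_iff.2 ⟨?_, ?_⟩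
        · have : Tendsto (fun s : ℝ => s⁻¹) (𝓝 1) (𝓝 1⁻¹) := tendsto_inv₀ one_ne_zero
          rw [inv_one] at this
          exact this.mono_left nhdsWithin_le_nhds
        · have h2 : ∀ᶠ s : ℝ in 𝓝[<] 1, 0 < s := nhdsWithin_le_nhds (Ioi_mem_nhds one_pos)
          filter_upwards [self_mem_nhdsWithin, h2] with s hs hs0
          exact (one_lt_inv₀ hs0).2 hs
      have h2 : Tendsto (fun s : ℝ => (z₀ - ψ ((s⁻¹ : ℝ) * u))⁻¹) (𝓝[<] 1) (𝓝 (z₀ - b)⁻¹) :=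
        ((h.comp h1).const_sub z₀).inv₀ hzb
      refine (h2.mono_left (nhdsWithin_mono _ Ico_subset_Iio_self)).congr' ?_
      have h3 : ∀ᶠ s : ℝ in 𝓝[Ico 0 1] 1, 0 < s := nhdsWithin_le_nhds (Ioi_mem_nhds one_pos)
      filter_upwards [self_mem_nhdsWithin, h3] with s hs hs0
      simp only [e, γ, if_neg (not_le.2 hs0), if_pos hs.2]
    · apply ContinuousAt.continuousWithinAt
      have hx2 : 1 < x⁻¹ := (one_lt_inv₀ hx0).2 hx1
      have hne : z₀ - ψ ((x⁻¹ : ℝ) * u) ≠ 0 :=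
        sub_ne_zero.2 fun e' => hz₀ (Or.inr ⟨x⁻¹, hx2, e'⟩)
      have h1 : ContinuousAt (fun s : ℝ => (z₀ - ψ ((s⁻¹ : ℝ) * u))⁻¹) x := by
        refine ContinuousAt.inv₀ (continuousAt_const.sub ?_) hne
        refine ContinuousAt.comp (g := ψ) (f := fun s : ℝ => ((s⁻¹ : ℝ) : ℂ) * u) ?_ ?_
        · exact H.continuousAt (by rwa [norm_real_mul_circle (by linarith)])
        · refine ContinuousAt.mul ?_ continuousAt_const
          exact Complex.continuous_ofReal.continuousAt.comp (continuousAt_inv₀ hx0.ne')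
      refine h1.congr ?_
      filter_upwards [Ioo_mem_nhds hx0 hx1] with s hs
      simp only [e, γ, if_neg (not_le.2 hs.1), if_pos hs.2]
  let η : C(unitInterval, ℂ) := ⟨fun s => e s, by
    exact continuousOn_iff_continuous_domRestrict.1 hcont⟩
  obtain ⟨L, hL, hL'⟩ := exists_log_of_homotopy (S := (landedRay ψ u b)ᶜ) (z₀ := z₀) η
    (if_pos le_rfl) (by
      intro z hz s
      change 1 + (z - z₀) * e s ≠ 0
      simp only [e]
      split_ifs with hs
      · simp
      · push Not at hs
        have h1 : z₀ - γ s ≠ 0 := sub_ne_zero.2 fun e' => hz₀ (e' ▸ hγ s hs)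
        have h2 : z - γ s ≠ 0 := sub_ne_zero.2 fun e' => hz (e' ▸ hγ s hs)
        have : 1 + (z - z₀) * (z₀ - γ s)⁻¹ = (z - γ s) * (z₀ - γ s)⁻¹ := by
          field_simp
          ring
        rw [this]
        exact mul_ne_zero h2 (inv_ne_zero h1))
  refine ⟨L, hL, fun z hz => ?_⟩
  rw [hL' z hz]
  have : η 1 = (z₀ - b)⁻¹ := by
    change e 1 = _
    simp [e, γ]
  rw [this]
  field_simp
  ring

end IsBottcherInverse

/-! ### Sectors cut out by pairs of external rays with a common landing point -/

/-- Two distinct external rays landing at the same point. -/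
structure IsRayPair (ψ : ℂ → ℂ) (u v : Circle) (b : ℂ) : Prop where
  ne : u ≠ v
  left : RayLands ψ u b
  right : RayLands ψ v b

theorem IsRayPair.swap {ψ : ℂ → ℂ} {u v : Circle} {b : ℂ} (h : IsRayPair ψ u v b) :
    IsRayPair ψ v u b := ⟨h.ne.symm, h.right, h.left⟩

/-- Two rays with their common landing point. -/
def cut (ψ : ℂ → ℂ) (u v : Circle) (b : ℂ) : Set ℂ := landedRay ψ u b ∪ landedRay ψ v b

theorem cut_comm (ψ : ℂ → ℂ) (u v : Circle) (b : ℂ) : cut ψ u v b = cut ψ v u b := union_comm _ _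

/-- The component, containing the rays with angles in the arc from `u` to `v`, of the complement
of two rays with a common landing point. -/
def sector (ψ : ℂ → ℂ) (u v : Circle) (b : ℂ) : Set ℂ :=
  connectedComponentIn (cut ψ u v b)ᶜ (ψ ((2 : ℝ) * (u * Circle.exp (ang u v / 2) : Circle)))

theorem arc_eq_image (u v : Circle) :
    arc u v = (fun θ : ℝ => u * Circle.exp θ) '' Ioo 0 (ang u v) := by
  ext s
  constructor
  · intro hs
    exact ⟨ang u s, hs, mul_exp_ang u s⟩
  · rintro ⟨θ, hθ, rfl⟩
    have : ang u (u * Circle.exp θ) = θ :=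
      ang_eq_of_mul_exp rfl hθ.1.le (hθ.2.trans (ang_lt u v))
    simpa [arc, this] using hθ

theorem mid_mem_arc {u v : Circle} (h : u ≠ v) : u * Circle.exp (ang u v / 2) ∈ arc u v := by
  rw [arc_eq_image]
  have := ang_pos h
  exact ⟨_, ⟨by linarith, by linarith⟩, rfl⟩

theorem isPreconnected_arc (u v : Circle) : IsPreconnected (arc u v) := by
  rw [arc_eq_image]
  exact isPreconnected_Ioo.image _ (by fun_prop)

/-- The open domain bounded by the equipotential of level `ρ`. -/
def levelDisk (c : ℂ) (ψ : ℂ → ℂ) (ρ : ℝ) : Set ℂ :=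
  polyFilledJulia c ∪ ψ '' {w | 1 < ‖w‖ ∧ ‖w‖ < ρ}

/-- The closed domain bounded by the equipotential of level `ρ`. -/
def closedLevelDisk (c : ℂ) (ψ : ℂ → ℂ) (ρ : ℝ) : Set ℂ :=
  polyFilledJulia c ∪ ψ '' {w | 1 < ‖w‖ ∧ ‖w‖ ≤ ρ}

theorem isPreconnected_norm_gt (R : ℝ) : IsPreconnected {w : ℂ | R < ‖w‖} := by
  have h1 := (isPreconnected_Ioi.prod isPreconnected_univ).image
    (fun q : ℝ × ℝ => (q.1 : ℂ) * Complex.exp (q.2 * Complex.I))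
    (s := Ioi R ×ˢ univ) (by fun_prop)
  convert h1 using 1
  ext w
  constructor
  · intro hw
    exact ⟨(‖w‖, Complex.arg w), ⟨hw, mem_univ _⟩, Complex.norm_mul_exp_arg_mul_I w⟩
  · rintro ⟨⟨r, θ⟩, ⟨hr, -⟩, rfl⟩
    have hr' : R < r := hr
    change R < ‖_‖
    rw [norm_mul, Complex.norm_exp_ofReal_mul_I, mul_one, Complex.norm_real, Real.norm_eq_abs]
    exact hr'.trans_le (le_abs_self r)

namespace IsBottcherInverse

variable {c : ℂ} {ψ : ℂ → ℂ} (H : IsBottcherInverse c ψ)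
include H

theorem apply_mem_levelDisk_iff {ρ : ℝ} {w : ℂ} (hw : 1 < ‖w‖) :
    ψ w ∈ levelDisk c ψ ρ ↔ ‖w‖ < ρ := by
  constructor
  · rintro (h | ⟨w', h, h'⟩)
    · exact absurd h (H.not_mem hw)
    · rw [← H.inj h.1 hw h']
      exact h.2
  · intro h
    exact Or.inr ⟨w, ⟨hw, h⟩, rfl⟩

theorem apply_mem_closedLevelDisk_iff {ρ : ℝ} {w : ℂ} (hw : 1 < ‖w‖) :
    ψ w ∈ closedLevelDisk c ψ ρ ↔ ‖w‖ ≤ ρ := by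
  constructor
  · rintro (h | ⟨w', h, h'⟩)
    · exact absurd h (H.not_mem hw)
    · rw [← H.inj h.1 hw h']
      exact h.2
  · intro h
    exact Or.inr ⟨w, ⟨hw, h⟩, rfl⟩

theorem isOpen_levelDisk {ρ : ℝ} (hρ : 1 < ρ) : IsOpen (levelDisk c ψ ρ) := by
  have h1 : IsClosed (ψ '' {w | ρ ≤ ‖w‖}) :=
    H.isClosed_image (isClosed_le continuous_const continuous_norm) fun w hw => hρ.trans_le hw
  have h2 : levelDisk c ψ ρ = (ψ '' {w | ρ ≤ ‖w‖})ᶜ := by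
    ext z
    constructor
    · rintro hz ⟨w, hw, rfl⟩
      have hw' : ρ ≤ ‖w‖ := hw
      rw [H.apply_mem_levelDisk_iff (hρ.trans_le hw)] at hz
      linarith
    · intro hz
      by_cases hK : z ∈ polyFilledJulia c
      · exact Or.inl hK
      · obtain ⟨w, hw, rfl⟩ := H.exists_of_not_mem hK
        rw [H.apply_mem_levelDisk_iff hw]
        by_contra hc
        exact hz ⟨w, not_lt.1 hc, rfl⟩
  rw [h2]
  exact h1.isOpen_compl

theorem isClosed_closedLevelDisk {ρ : ℝ} (hρ : 1 < ρ) : IsClosed (closedLevelDisk c ψ ρ) := by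
  have h1 : IsOpen (ψ '' {w | ρ < ‖w‖}) :=
    H.isOpen_image (isOpen_lt continuous_const continuous_norm) fun w hw => hρ.trans hw
  have h2 : closedLevelDisk c ψ ρ = (ψ '' {w | ρ < ‖w‖})ᶜ := by
    ext z
    constructor
    · rintro hz ⟨w, hw, rfl⟩
      have hw' : ρ < ‖w‖ := hw
      rw [H.apply_mem_closedLevelDisk_iff (hρ.trans hw)] at hz
      linarith
    · intro hz
      by_cases hK : z ∈ polyFilledJulia c
      · exact Or.inl hK
      · obtain ⟨w, hw, rfl⟩ := H.exists_of_not_mem hK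
        rw [H.apply_mem_closedLevelDisk_iff hw]
        by_contra hc
        exact hz ⟨w, not_le.1 hc, rfl⟩
  rw [h2]
  exact h1.isClosed_compl

/-- Far out, the plane is covered by two disjoint open sets, the level disk and the outside of the
equipotential. The exterior of a large ball is connected and meets the second, so it misses the
first. -/
theorem isBounded_levelDisk {ρ : ℝ} (hρ : 1 < ρ) :
    Bornology.IsBounded (levelDisk c ψ ρ) := by
  have hcirc : IsCompact (ψ '' {w | ‖w‖ = ρ}) := by
    refine IsCompact.image_of_continuousOn ?_ (H.continuousOn.mono fun w hw => ?_)
    · have : {w : ℂ | ‖w‖ = ρ} = Metric.sphere 0 ρ := by ext; simp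
      rw [this]
      exact isCompact_sphere _ _
    · change 1 < ‖w‖
      rwa [show ‖w‖ = ρ from hw]
  obtain ⟨R, hR⟩ := hcirc.isBounded.subset_closedBall (0 : ℂ)
  set R' := max R 0
  have hopen2 : IsOpen (ψ '' {w | ρ < ‖w‖}) :=
    H.isOpen_image (isOpen_lt continuous_const continuous_norm) fun w hw => hρ.trans hw
  have hcover : {z : ℂ | R' < ‖z‖} ⊆ levelDisk c ψ ρ ∪ ψ '' {w | ρ < ‖w‖} := by
    intro z hz
    by_cases hK : z ∈ polyFilledJulia c
    · exact Or.inl (Or.inl hK)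
    · obtain ⟨w, hw, rfl⟩ := H.exists_of_not_mem hK
      rcases lt_trichotomy ‖w‖ ρ with h | h | h
      · exact Or.inl (Or.inr ⟨w, ⟨hw, h⟩, rfl⟩)
      · exfalso
        have h1 := hR ⟨w, h, rfl⟩
        rw [mem_closedBall_zero_iff] at h1
        have h2 : R' < ‖ψ w‖ := hz
        linarith [le_max_left R 0]
      · exact Or.inr ⟨w, h, rfl⟩
  have hdisj : ¬ ({z : ℂ | R' < ‖z‖} ∩ (levelDisk c ψ ρ ∩ ψ '' {w | ρ < ‖w‖})).Nonempty := by
    rintro ⟨_, -, h1, w, hw, rfl⟩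
    have hw' : ρ < ‖w‖ := hw
    rw [H.apply_mem_levelDisk_iff (hρ.trans hw)] at h1
    linarith
  have hne2 : ({z : ℂ | R' < ‖z‖} ∩ ψ '' {w | ρ < ‖w‖}).Nonempty := by
    have h1 : ∀ᶠ w in cocompact ℂ, R' < ‖ψ w‖ := by
      have := tendsto_norm_cocompact_atTop.comp H.tendsto_cobounded
      exact this.eventually_gt_atTop R'
    have h2 : ∀ᶠ w : ℂ in cocompact ℂ, ρ < ‖w‖ :=
      tendsto_norm_cocompact_atTop.eventually_gt_atTop ρ
    obtain ⟨w, hw1, hw2⟩ := (h1.and h2).exists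
    exact ⟨ψ w, hw1, w, hw2, rfl⟩
  refine (Metric.isBounded_closedBall (x := (0 : ℂ)) (r := R')).subset fun z hz => ?_
  rw [mem_closedBall_zero_iff]
  by_contra hc
  exact hdisj (isPreconnected_norm_gt R' _ _ (H.isOpen_levelDisk hρ) hopen2 hcover
    ⟨z, not_le.1 hc, hz⟩ hne2)

theorem isCompact_closedLevelDisk {ρ : ℝ} (hρ : 1 < ρ) : IsCompact (closedLevelDisk c ψ ρ) := by
  have hcl := H.isClosed_closedLevelDisk hρ
  refine Metric.isCompact_of_isClosed_isBounded hcl ?_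
  refine (H.isBounded_levelDisk (show 1 < ρ + 1 by linarith)).subset ?_
  rintro z (hz | ⟨w, hw, rfl⟩)
  · exact Or.inl hz
  · exact Or.inr ⟨w, ⟨hw.1, by linarith [hw.2]⟩, rfl⟩

theorem landedRay_inter {u : Circle} {b z : ℂ} (hz : z ∈ landedRay ψ u b)
    (hK : z ∈ polyFilledJulia c) : z = b := by
  rcases hz with h | ⟨r, hr, rfl⟩
  · exact h
  · exact absurd hK (H.not_mem_ray hr u)

theorem cut_inter {u v : Circle} {b z : ℂ} (hz : z ∈ cut ψ u v b)
    (hK : z ∈ polyFilledJulia c) : z = b :=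
  hz.elim (fun h => H.landedRay_inter h hK) fun h => H.landedRay_inter h hK

theorem ray_mem_landedRay_iff {u s : Circle} {b : ℂ} (hb : b ∈ polyFilledJulia c) {r : ℝ}
    (hr : 1 < r) : ψ (r * s) ∈ landedRay ψ u b ↔ s = u := by
  constructor
  · rintro (h | ⟨r', hr', h⟩)
    · exact absurd (h ▸ hb) (H.not_mem_ray hr s)
    · exact (H.ray_inj hr hr' h).2
  · rintro rfl
    exact Or.inr ⟨r, hr, rfl⟩

theorem ray_mem_cut_iff {u v s : Circle} {b : ℂ} (hb : b ∈ polyFilledJulia c) {r : ℝ}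
    (hr : 1 < r) : ψ (r * s) ∈ cut ψ u v b ↔ s = u ∨ s = v := by
  rw [cut, mem_union, H.ray_mem_landedRay_iff hb hr, H.ray_mem_landedRay_iff hb hr]

theorem isClosed_cut {u v : Circle} {b : ℂ} (h : IsRayPair ψ u v b) :
    IsClosed (cut ψ u v b) :=
  (H.isClosed_landedRay h.left).union (H.isClosed_landedRay h.right)

theorem isPreconnected_rays {I : Set ℝ} (hI : IsPreconnected I) (hI1 : I ⊆ Ioi 1) (u v : Circle) :
    IsPreconnected {z | ∃ r ∈ I, ∃ s ∈ arc u v, z = ψ (r * s)} := by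
  have h1 := (hI.prod (isPreconnected_arc u v)).image (fun q : ℝ × Circle => ψ (q.1 * q.2)) (by
    refine H.continuousOn.comp (f := fun q : ℝ × Circle => (q.1 : ℂ) * q.2) ?_ ?_
    · fun_prop
    · rintro ⟨r, s⟩ ⟨hr, -⟩
      have := hI1 hr
      change 1 < ‖(r : ℂ) * s‖
      rwa [norm_real_mul_circle (by linarith [show (1 : ℝ) < r from this])])
  convert h1 using 1
  ext z
  constructor
  · rintro ⟨r, hr, s, hs, rfl⟩
    exact ⟨(r, s), ⟨hr, hs⟩, rfl⟩
  · rintro ⟨⟨r, s⟩, ⟨hr, hs⟩, rfl⟩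
    exact ⟨r, hr, s, hs, rfl⟩

/-- A component of an open set with countable trace of its boundary on the filled Julia set
contains points of external rays. -/
theorem exists_ray_mem_component {M : Set ℂ} (hM : IsOpen M)
    (hK : ((polyFilledJulia c ∩ closure M) \ M).Countable) {z : ℂ} (hz : z ∈ M) :
    ∃ (r : ℝ) (s : Circle), 1 < r ∧ ψ (r * s) ∈ connectedComponentIn M z := by
  by_contra hcon
  push Not at hcon
  have hsub : connectedComponentIn M z ⊆ polyFilledJulia c := by
    intro y hy
    by_contra hyK
    obtain ⟨r, s, hr, rfl⟩ := H.exists_ray_of_not_mem hyK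
    exact hcon r s hr hy
  refine not_countable_frontier hM.connectedComponentIn ⟨z, mem_connectedComponentIn hz⟩
    ((isBounded_polyFilledJulia c).subset hsub) (hK.mono ?_)
  intro y hy
  have := frontier_connectedComponentIn_inter hM z hy
  exact ⟨⟨closure_minimal hsub H.isCompact_polyFilledJulia.isClosed this.1,
    closure_mono (connectedComponentIn_subset _ _) this.1⟩, this.2⟩

/-- On a connected complement the logarithms of `(z - b) / (z₀ - b)` off the two single rays would
differ by a constant. After correcting this constant they would agree there and give a logarithm on
the whole plane punctured at `b`, since the rays meet only at `b`. -/
theorem not_isPreconnected_compl_cut {u v : Circle} {b : ℂ} (h : IsRayPair ψ u v b) :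
    ¬ IsPreconnected (cut ψ u v b)ᶜ := by
  intro hpre
  have hb := H.landing_mem h.left
  have hmid := mid_mem_arc h.ne
  have hz₀ : ψ ((2 : ℝ) * (u * Circle.exp (ang u v / 2) : Circle)) ∉ cut ψ u v b := by
    rw [H.ray_mem_cut_iff hb (by norm_num)]
    have := ne_of_mem_arc hmid
    tauto
  set z₀ := ψ ((2 : ℝ) * (u * Circle.exp (ang u v / 2) : Circle))
  obtain ⟨L₁, hL₁, hL₁'⟩ := H.exists_log_compl_landedRay h.left fun hz => hz₀ (Or.inl hz)
  obtain ⟨L₂, hL₂, hL₂'⟩ := H.exists_log_compl_landedRay h.right fun hz => hz₀ (Or.inr hz)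
  have hd : ∀ z ∉ cut ψ u v b, L₁ z - L₂ z = L₁ z₀ - L₂ z₀ := by
    intro z hz
    refine eq_of_exp_eq_of_isPreconnected hpre (g := fun z => L₁ z - L₂ z) (κ := 1) ?_ ?_ hz hz₀
    · exact (hL₁.mono (compl_subset_compl.2 subset_union_left)).sub
        (hL₂.mono (compl_subset_compl.2 subset_union_right))
    · intro z hz
      have hz1 : z ∉ landedRay ψ u b := fun h' => hz (Or.inl h')
      have hz2 : z ∉ landedRay ψ v b := fun h' => hz (Or.inr h')
      rw [Complex.exp_sub, hL₁' z hz1, hL₂' z hz2, div_self]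
      rw [← hL₁' z hz1]
      exact Complex.exp_ne_zero _
  have hz1 : z₀ ∉ landedRay ψ u b := fun h' => hz₀ (Or.inl h')
  have hz2 : z₀ ∉ landedRay ψ v b := fun h' => hz₀ (Or.inr h')
  have hκ : Complex.exp (L₁ z₀ - L₂ z₀) = 1 := by
    rw [Complex.exp_sub, hL₁' _ hz1, hL₂' _ hz2, div_self]
    rw [← hL₁' _ hz1]
    exact Complex.exp_ne_zero _
  classical
  let L : ℂ → ℂ := fun z => if z ∈ landedRay ψ u b then L₂ z + (L₁ z₀ - L₂ z₀) else L₁ z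
  have hLe1 : ∀ z ∉ landedRay ψ u b, L z = L₁ z := fun z hz => if_neg hz
  have hLe2 : ∀ z ∉ landedRay ψ v b, L z = L₂ z + (L₁ z₀ - L₂ z₀) := by
    intro z hz
    by_cases h1 : z ∈ landedRay ψ u b
    · exact if_pos h1
    · rw [hLe1 z h1, ← hd z (fun h' => h'.elim h1 hz)]
      ring
  have hcov : ∀ z, z ≠ b → z ∉ landedRay ψ u b ∨ z ∉ landedRay ψ v b := by
    intro z hz
    by_contra hc
    push Not at hc
    obtain ⟨h1 | ⟨r, hr, h1⟩, h2 | ⟨r', hr', h2⟩⟩ := hc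
    · exact hz h1
    · exact hz h1
    · exact hz h2
    · exact h.ne (H.ray_inj hr hr' (h1.symm.trans h2)).2
  refine no_log_punctured (b := b) (κ := (z₀ - b)⁻¹) ?_ L ?_ ?_
  · exact inv_ne_zero (sub_ne_zero.2 fun e => hz1 (Or.inl e))
  · intro z hz
    apply ContinuousAt.continuousWithinAt
    rcases hcov z hz with h1 | h1
    · have ho := (H.isClosed_landedRay h.left).isOpen_compl.mem_nhds h1
      refine (hL₁.continuousAt ho).congr ?_
      filter_upwards [ho] with y hy
      exact (hLe1 y hy).symm
    · have ho := (H.isClosed_landedRay h.right).isOpen_compl.mem_nhds h1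
      refine ((hL₂.continuousAt ho).add (continuousAt_const (y := L₁ z₀ - L₂ z₀))).congr ?_
      filter_upwards [ho] with y hy
      exact (hLe2 y hy).symm
  · intro z hz
    rcases hcov z hz with h1 | h1
    · rw [hLe1 z h1, hL₁' z h1]
    · rw [hLe2 z h1, Complex.exp_add, hκ, hL₂' z h1, mul_one]

variable {u v : Circle} {b : ℂ}

theorem isOpen_sector (h : IsRayPair ψ u v b) : IsOpen (sector ψ u v b) :=
  (H.isClosed_cut h).isOpen_compl.connectedComponentIn

omit H in
theorem _root_.isPreconnected_sector : IsPreconnected (sector ψ u v b) :=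
  isPreconnected_connectedComponentIn

omit H in
theorem _root_.sector_subset : sector ψ u v b ⊆ (cut ψ u v b)ᶜ := connectedComponentIn_subset _ _

theorem rays_subset_compl_cut (h : IsRayPair ψ u v b) :
    {z | ∃ r ∈ Ioi (1 : ℝ), ∃ s ∈ arc u v, z = ψ (r * s)} ⊆ (cut ψ u v b)ᶜ := by
  rintro _ ⟨r, hr, s, hs, rfl⟩
  rw [mem_compl_iff, H.ray_mem_cut_iff (H.landing_mem h.left) hr]
  have := ne_of_mem_arc hs
  tauto

theorem ray_mem_sector (h : IsRayPair ψ u v b) {s : Circle} (hs : s ∈ arc u v) {r : ℝ}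
    (hr : 1 < r) : ψ (r * s) ∈ sector ψ u v b :=
  (H.isPreconnected_rays isPreconnected_Ioi subset_rfl u v).subset_connectedComponentIn
    ⟨2, by norm_num, _, mid_mem_arc h.ne, rfl⟩ (H.rays_subset_compl_cut h) ⟨r, hr, s, hs, rfl⟩

theorem countable_inter_cut :
    ((polyFilledJulia c ∩ closure (cut ψ u v b)ᶜ) \ (cut ψ u v b)ᶜ).Countable := by
  refine (countable_singleton b).mono ?_
  rintro z ⟨⟨hK, -⟩, hz⟩
  exact H.cut_inter (notMem_compl_iff.1 hz) hK

/-- Every component of the complement of the cut contains a point of some ray, and the angle of that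
ray lies in one of the two arcs. -/
theorem mem_sector_or (h : IsRayPair ψ u v b) {z : ℂ} (hz : z ∉ cut ψ u v b) :
    z ∈ sector ψ u v b ∨ z ∈ sector ψ v u b := by
  have hb := H.landing_mem h.left
  obtain ⟨r, s, hr, hs⟩ :=
    H.exists_ray_mem_component (H.isClosed_cut h).isOpen_compl H.countable_inter_cut hz
  have hs' := connectedComponentIn_subset _ _ hs
  rw [mem_compl_iff, H.ray_mem_cut_iff hb hr] at hs'
  push Not at hs'
  have hzs : z ∈ connectedComponentIn (cut ψ u v b)ᶜ (ψ (r * s)) := by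
    rw [← connectedComponentIn_eq hs]
    exact mem_connectedComponentIn hz
  rcases mem_arc_or_mem_arc h.ne hs'.1 hs'.2 with h1 | h1
  · left
    rw [sector, connectedComponentIn_eq (H.ray_mem_sector h h1 hr)]
    exact hzs
  · right
    rw [sector, connectedComponentIn_eq (H.ray_mem_sector h.swap h1 hr), cut_comm]
    exact hzs

theorem disjoint_sector (h : IsRayPair ψ u v b) :
    Disjoint (sector ψ u v b) (sector ψ v u b) := by
  rw [disjoint_left]
  intro z hz hz'
  apply H.not_isPreconnected_compl_cut h
  have h1 : sector ψ u v b = sector ψ v u b := by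
    rw [sector, connectedComponentIn_eq hz, sector, connectedComponentIn_eq hz', cut_comm]
  have h2 : (cut ψ u v b)ᶜ = sector ψ u v b := by
    apply Subset.antisymm
    · intro y hy
      rcases H.mem_sector_or h hy with h3 | h3
      · exact h3
      · rwa [h1]
    · exact sector_subset
  rw [h2]
  exact isPreconnected_sector

theorem ray_mem_sector_iff (h : IsRayPair ψ u v b) {s : Circle} {r : ℝ} (hr : 1 < r) :
    ψ (r * s) ∈ sector ψ u v b ↔ s ∈ arc u v := by
  refine ⟨fun hs => ?_, fun hs => H.ray_mem_sector h hs hr⟩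
  have h1 := sector_subset hs
  rw [mem_compl_iff, H.ray_mem_cut_iff (H.landing_mem h.left) hr] at h1
  push Not at h1
  refine (mem_arc_or_mem_arc h.ne h1.1 h1.2).resolve_right fun h2 => ?_
  exact (H.disjoint_sector h).le_bot ⟨hs, H.ray_mem_sector h.swap h2 hr⟩

theorem closure_sector_subset (h : IsRayPair ψ u v b) :
    closure (sector ψ u v b) ⊆ (sector ψ v u b)ᶜ :=
  closure_minimal (H.disjoint_sector h).subset_compl_right (H.isOpen_sector h.swap).isClosed_compl

omit H in
theorem _root_.landing_not_mem_sector : b ∉ sector ψ u v b :=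
  fun h => sector_subset h (Or.inl (Or.inl rfl))

/-- Sectors are open, so a landing point inside a sector forces the end of its ray into it. Applied
to both sectors this decides on which side the point lies. -/
theorem landing_mem_sector_iff (h : IsRayPair ψ u v b) {s : Circle} {b' : ℂ}
    (hs : RayLands ψ s b') (hne : b' ≠ b) : b' ∈ sector ψ u v b ↔ s ∈ arc u v := by
  have key : ∀ {u v : Circle}, IsRayPair ψ u v b → b' ∈ sector ψ u v b → s ∈ arc u v := by
    intro u v h hb'
    have h1 := hs.eventually ((H.isOpen_sector h).mem_nhds hb')
    obtain ⟨r, hr, hr1⟩ := (h1.and self_mem_nhdsWithin).exists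
    exact (H.ray_mem_sector_iff h hr1).1 hr
  refine ⟨key h, fun harc => ?_⟩
  have hb'c : b' ∉ cut ψ u v b := fun h' => hne (H.cut_inter h' (H.landing_mem hs))
  exact (H.mem_sector_or h hb'c).resolve_right fun h' => not_mem_arc_swap harc (key h.swap h')

theorem isRayPair_neg (h : IsRayPair ψ u v b) : IsRayPair ψ (-u) (-v) (-b) :=
  ⟨fun e => h.ne (neg_injective e), H.rayLands_neg h.left, H.rayLands_neg h.right⟩

theorem neg_mem_cut {z : ℂ} (hz : z ∈ cut ψ u v b) : -z ∈ cut ψ (-u) (-v) (-b) := by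
  rcases hz with (rfl | ⟨r, hr, rfl⟩) | (rfl | ⟨r, hr, rfl⟩)
  · exact Or.inl (Or.inl rfl)
  · exact Or.inl (Or.inr ⟨r, hr, H.neg_ray hr u⟩)
  · exact Or.inl (Or.inl rfl)
  · exact Or.inr (Or.inr ⟨r, hr, H.neg_ray hr v⟩)

theorem neg_mem_sector (h : IsRayPair ψ u v b) {z : ℂ} (hz : z ∈ sector ψ u v b) :
    -z ∈ sector ψ (-u) (-v) (-b) := by
  have h1 : IsPreconnected ((fun z : ℂ => -z) '' sector ψ u v b) :=
    isPreconnected_sector.image _ continuous_neg.continuousOn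
  have h2 : (fun z : ℂ => -z) '' sector ψ u v b ⊆ (cut ψ (-u) (-v) (-b))ᶜ := by
    rintro _ ⟨y, hy, rfl⟩ hc
    have := H.neg_mem_cut hc
    simp only [neg_neg] at this
    exact sector_subset hy this
  have h3 := H.ray_mem_sector (H.isRayPair_neg h) (neg_mem_arc_neg (mid_mem_arc h.ne))
    (r := 2) (by norm_num)
  rw [sector, connectedComponentIn_eq h3]
  refine h1.subset_connectedComponentIn ?_ h2 ⟨z, hz, rfl⟩
  refine ⟨_, H.ray_mem_sector h (mid_mem_arc h.ne) (r := 2) (by norm_num), ?_⟩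
  exact H.neg_ray (by norm_num) _

/-- The part of a sector below an equipotential is connected. -/
theorem isPreconnected_sector_inter_levelDisk (h : IsRayPair ψ u v b) {ρ : ℝ} (hρ : 1 < ρ) :
    IsPreconnected (sector ψ u v b ∩ levelDisk c ψ ρ) := by
  set M := sector ψ u v b ∩ levelDisk c ψ ρ
  have hM : IsOpen M := (H.isOpen_sector h).inter (H.isOpen_levelDisk hρ)
  have hK : ((polyFilledJulia c ∩ closure M) \ M).Countable := by
    refine (countable_singleton b).mono ?_
    rintro z ⟨⟨hzK, hzc⟩, hzM⟩
    have h1 : z ∉ sector ψ v u b :=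
      H.closure_sector_subset h (closure_mono inter_subset_left hzc)
    have h2 : z ∉ sector ψ u v b := fun h' => hzM ⟨h', Or.inl hzK⟩
    by_contra hzb
    have h3 : z ∉ cut ψ u v b := fun h' => hzb (H.cut_inter h' hzK)
    exact (H.mem_sector_or h h3).elim h2 h1
  obtain ⟨r₀, hr₀⟩ := exists_between hρ
  have hRp := H.isPreconnected_rays (I := Ioo 1 ρ) isPreconnected_Ioo (fun r hr => hr.1) u v
  have hRM : {z | ∃ r ∈ Ioo 1 ρ, ∃ s ∈ arc u v, z = ψ (r * s)} ⊆ M := by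
    rintro _ ⟨r, hr, s, hs, rfl⟩
    refine ⟨H.ray_mem_sector h hs hr.1, ?_⟩
    have h1 : ‖(r : ℂ) * s‖ = r := norm_real_mul_circle (by linarith [hr.1]) s
    rw [H.apply_mem_levelDisk_iff (by rw [h1]; exact hr.1), h1]
    exact hr.2
  -- Each component contains a point of a ray, and all ray points of `M` form one connected set, the
  -- image of a product of an interval and an arc.
  have hall : ∀ z ∈ M, connectedComponentIn M z =
      connectedComponentIn M (ψ (r₀ * (u * Circle.exp (ang u v / 2) : Circle))) := by
    intro z hz
    obtain ⟨r, s, hr, hs⟩ := H.exists_ray_mem_component hM hK hz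
    have hsM := connectedComponentIn_subset _ _ hs
    have hsa := (H.ray_mem_sector_iff h hr).1 hsM.1
    have h1 : ‖(r : ℂ) * s‖ = r := norm_real_mul_circle (by linarith) s
    have hrρ := (H.apply_mem_levelDisk_iff (by rwa [h1])).1 hsM.2
    rw [h1] at hrρ
    rw [connectedComponentIn_eq hs]
    refine connectedComponentIn_eq ?_
    exact hRp.subset_connectedComponentIn ⟨r, ⟨hr, hrρ⟩, s, hsa, rfl⟩ hRM
      ⟨r₀, hr₀, _, mid_mem_arc h.ne, rfl⟩
  have hMe : M = connectedComponentIn M (ψ (r₀ * (u * Circle.exp (ang u v / 2) : Circle))) := by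
    refine Subset.antisymm (fun z hz => ?_) (connectedComponentIn_subset _ _)
    rw [← hall z hz]
    exact mem_connectedComponentIn hz
  rw [hMe]
  exact isPreconnected_connectedComponentIn

end IsBottcherInverse

/-! ### The action of the polynomial on sectors -/

theorem mem_arc_of_ang_lt {u v w s : Circle} (hs : s ∈ arc u w) (h : ang u v < ang u s) :
    s ∈ arc v w := by
  have h1 := hs.2
  have h2 := ang_nonneg v s
  have h3 := ang_nonneg u v
  have h4 := ang_lt v s
  have h5 := ang_lt u w
  have h6 := ang_nonneg v w
  refine ⟨?_, ?_⟩
  · rw [ang_pos_iff]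
    rintro rfl
    exact lt_irrefl _ h
  · rcases ang_add u v s with h7 | h7 <;> rcases ang_add u v w with h8 | h8 <;>
      linarith [ang_lt v w]

theorem neg_mem_arc_swap {u v t : Circle} (h : ang u v < Real.pi) (ht : t ∈ arc u v) :
    -t ∈ arc v u := by
  have hp := Real.pi_pos
  obtain ⟨n1, n2, n3⟩ := ne_of_mem_arc ht
  have h1 := ht.1
  have h2 := ht.2
  have h3 := ang_add_of_mem_arc ht
  have h4 := ang_nonneg t v
  have hu : -t ≠ u := by
    rintro rfl
    rw [ang_neg_left_self] at h2
    linarith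
  have hv : -t ≠ v := by
    rintro rfl
    rw [ang_neg_right_self] at h3
    linarith
  refine (mem_arc_or_mem_arc n3 hu hv).resolve_left fun h5 => ?_
  have h6 := h5.2
  have h7 := h5.1
  have h8 := ang_add u t (-t)
  rw [ang_neg_right_self] at h8
  rcases h8 with h8 | h8 <;> linarith

theorem RayLands.neg_ne {c : ℂ} {ψ : ℂ → ℂ} (H : IsBottcherInverse c ψ) {u v : Circle} {b : ℂ}
    (hu : RayLands ψ u b) (hv : RayLands ψ v b) (hb : b ≠ 0) : -u ≠ v := by
  rintro rfl
  exact hb (self_eq_neg.1 (hv.eq (H.rayLands_neg hu)))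

namespace IsBottcherInverse

variable {c : ℂ} {ψ : ℂ → ℂ} (H : IsBottcherInverse c ψ)
include H

variable {u v : Circle} {b : ℂ}

theorem sector_subset_sector (h : IsRayPair ψ u v b) {u' v' : Circle} {b' : ℂ}
    (h' : IsRayPair ψ u' v' b') (hdisj : Disjoint (cut ψ u v b) (sector ψ u' v' b')) {s : Circle}
    (hs : s ∈ arc u v) (hs' : s ∈ arc u' v') : sector ψ u' v' b' ⊆ sector ψ u v b := by
  have h1 : (1 : ℝ) < 2 := by norm_num
  have h2 : sector ψ u v b = connectedComponentIn (cut ψ u v b)ᶜ (ψ ((2 : ℝ) * s)) :=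
    connectedComponentIn_eq (H.ray_mem_sector h hs h1)
  rw [h2]
  exact isPreconnected_sector.subset_connectedComponentIn (H.ray_mem_sector h' hs' h1)
    hdisj.subset_compl_left

theorem cut_subset_sector (h : IsRayPair ψ u v b) {u' v' : Circle} {b' : ℂ}
    (h' : IsRayPair ψ u' v' b') (hb : b ≠ b') (hu : u ∈ arc u' v') (hv : v ∈ arc u' v') :
    cut ψ u v b ⊆ sector ψ u' v' b' := by
  have hbs := (H.landing_mem_sector_iff h' h.left hb).2 hu
  rintro z ((rfl | ⟨r, hr, rfl⟩) | (rfl | ⟨r, hr, rfl⟩))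
  · exact hbs
  · exact H.ray_mem_sector h' hu hr
  · exact hbs
  · exact H.ray_mem_sector h' hv hr

theorem isRayPair_sq (h : IsRayPair ψ u v b) (hb : b ≠ 0) :
    IsRayPair ψ (u ^ 2) (v ^ 2) (qmap c b) := by
  refine ⟨fun e => ?_, H.rayLands_sq h.left, H.rayLands_sq h.right⟩
  rcases Circle.eq_or_eq_neg_of_sq_eq e with e | e
  · exact h.ne e
  · exact h.right.neg_ne H h.left hb e.symm

theorem ang_ne_pi_of_isRayPair (h : IsRayPair ψ u v b) (hb : b ≠ 0) : ang u v ≠ Real.pi :=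
  ang_ne_pi (H.isRayPair_sq h hb).ne

theorem ang_lt_pi_or_swap (h : IsRayPair ψ u v b) (hb : b ≠ 0) :
    ang u v < Real.pi ∨ ang v u < Real.pi := by
  have h1 := H.ang_ne_pi_of_isRayPair h hb
  have h2 := ang_add_ang_swap h.ne
  rcases h1.lt_or_gt with h3 | h3
  · exact Or.inl h3
  · right; linarith

theorem cut_subset_sector_neg (h : IsRayPair ψ u v b) (hb : b ≠ 0) (hlt : ang u v < Real.pi) :
    cut ψ u v b ⊆ sector ψ (-v) (-u) (-b) := by
  obtain ⟨h1, h2⟩ := mem_arc_neg_of_lt_pi hlt h.ne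
  exact H.cut_subset_sector h (H.isRayPair_neg h).swap (fun e => hb (self_eq_neg.1 e)) h1 h2

theorem cut_neg_subset_sector (h : IsRayPair ψ u v b) (hb : b ≠ 0) (hlt : ang u v < Real.pi) :
    cut ψ (-u) (-v) (-b) ⊆ sector ψ v u b := by
  have := H.cut_subset_sector_neg (H.isRayPair_neg h) (neg_ne_zero.2 hb) (by rwa [ang_neg_neg])
  simpa using this

theorem sector_neg_subset (h : IsRayPair ψ u v b) (hb : b ≠ 0) (hlt : ang u v < Real.pi) :
    sector ψ (-u) (-v) (-b) ⊆ sector ψ v u b := by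
  have hd := (H.disjoint_sector (H.isRayPair_neg h).swap).mono_left
    (H.cut_subset_sector_neg h hb hlt)
  refine H.sector_subset_sector h.swap (H.isRayPair_neg h) ?_
    (neg_mem_arc_swap hlt (mid_mem_arc h.ne)) (neg_mem_arc_neg (mid_mem_arc h.ne))
  rw [cut_comm]
  exact hd

/-- A sector spanned by less than a half-turn is disjoint from its negative, whereas `0` is its own
negative. -/
theorem zero_not_mem_sector (h : IsRayPair ψ u v b) (hb : b ≠ 0) (hlt : ang u v < Real.pi) :
    (0 : ℂ) ∉ sector ψ u v b := by
  intro h0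
  have h1 := H.neg_mem_sector h h0
  rw [neg_zero] at h1
  exact (H.disjoint_sector h).le_bot ⟨h0, H.sector_neg_subset h hb hlt h1⟩

theorem mem_cut_or_of_qmap_mem {z : ℂ} (hz : qmap c z ∈ cut ψ (u ^ 2) (v ^ 2) (qmap c b)) :
    z ∈ cut ψ u v b ∨ -z ∈ cut ψ u v b := by
  have key : ∀ {u : Circle}, qmap c z ∈ landedRay ψ (u ^ 2) (qmap c b) →
      z ∈ landedRay ψ u b ∨ -z ∈ landedRay ψ u b := by
    rintro u (h | ⟨r, hr, h⟩)
    · rcases qmap_eq_iff.1 h with h1 | h1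
      · exact Or.inl (Or.inl h1)
      · exact Or.inr (Or.inl (by rw [h1, neg_neg]))
    · have hr1 : 1 < Real.sqrt r := Real.lt_sqrt_of_sq_lt (by simpa using hr)
      have h2 := H.qmap_ray hr1 u
      rw [Real.sq_sqrt (by linarith), ← h] at h2
      rcases qmap_eq_iff.1 h2.symm with h1 | h1
      · exact Or.inl (Or.inr ⟨_, hr1, h1⟩)
      · exact Or.inr (Or.inr ⟨_, hr1, by rw [h1, neg_neg]⟩)
  rcases hz with hz | hz
  · exact (key hz).imp Or.inl Or.inl
  · exact (key hz).imp Or.inr Or.inr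

theorem qmap_mem_landedRay {z : ℂ} (hz : z ∈ landedRay ψ u b) :
    qmap c z ∈ landedRay ψ (u ^ 2) (qmap c b) := by
  rcases hz with rfl | ⟨r, hr, rfl⟩
  · exact Or.inl rfl
  · exact Or.inr ⟨r ^ 2, one_lt_pow₀ hr two_ne_zero, H.qmap_ray hr u⟩

theorem qmap_mem_cut {z : ℂ} (hz : z ∈ cut ψ u v b) :
    qmap c z ∈ cut ψ (u ^ 2) (v ^ 2) (qmap c b) :=
  hz.imp H.qmap_mem_landedRay H.qmap_mem_landedRay

/-- The preimage of the image cut is the cut together with its negative. A connected set avoiding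
both is mapped to one side, which a single ray point in it identifies. -/
theorem qmap_mem_sector_of_isPreconnected (h : IsRayPair ψ u v b) (hb : b ≠ 0) {S : Set ℂ}
    (hS : IsPreconnected S) (h1 : ∀ z ∈ S, z ∉ cut ψ u v b) (h2 : ∀ z ∈ S, -z ∉ cut ψ u v b)
    {r : ℝ} {s : Circle} (hr : 1 < r) (hrs : ψ (r * s) ∈ S) (hs : s ^ 2 ∈ arc (u ^ 2) (v ^ 2))
    {z : ℂ} (hz : z ∈ S) : qmap c z ∈ sector ψ (u ^ 2) (v ^ 2) (qmap c b) := by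
  have h3 := hS.image (qmap c) (continuous_qmap c).continuousOn
  have hr2 : 1 < r ^ 2 := one_lt_pow₀ hr two_ne_zero
  rw [sector, connectedComponentIn_eq (H.ray_mem_sector (H.isRayPair_sq h hb) hs hr2)]
  refine h3.subset_connectedComponentIn ⟨_, hrs, H.qmap_ray hr s⟩ ?_ ⟨z, hz, rfl⟩
  rintro _ ⟨y, hy, rfl⟩ hc
  exact (H.mem_cut_or_of_qmap_mem hc).elim (h1 y hy) (h2 y hy)

theorem qmap_mem_sector_of_lt_pi (h : IsRayPair ψ u v b) (hb : b ≠ 0) (hlt : ang u v < Real.pi)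
    {z : ℂ} (hz : z ∈ sector ψ u v b) : qmap c z ∈ sector ψ (u ^ 2) (v ^ 2) (qmap c b) := by
  refine H.qmap_mem_sector_of_isPreconnected h hb isPreconnected_sector
    (fun z hz => sector_subset hz) ?_ (show (1 : ℝ) < 2 by norm_num)
    (H.ray_mem_sector h (mid_mem_arc h.ne) (by norm_num))
    (sq_mem_arc_of_lt_pi hlt (mid_mem_arc h.ne)) hz
  intro y hy hc
  have h1 := H.neg_mem_cut hc
  rw [neg_neg] at h1
  exact (H.disjoint_sector h).le_bot ⟨hy, H.cut_neg_subset_sector h hb hlt h1⟩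

/-- The region between a cut and its negative need not be known to be connected: it suffices that
each of its components contains a ray point. -/
theorem qmap_mem_sector_swap (h : IsRayPair ψ u v b) (hb : b ≠ 0) (hlt : ang u v < Real.pi)
    {z : ℂ} (hz : z ∈ sector ψ v u b) (hz' : z ∈ sector ψ (-v) (-u) (-b)) :
    qmap c z ∈ sector ψ (v ^ 2) (u ^ 2) (qmap c b) := by
  have hn := H.isRayPair_neg h
  set M := sector ψ v u b ∩ sector ψ (-v) (-u) (-b)
  have hM : IsOpen M := (H.isOpen_sector h.swap).inter (H.isOpen_sector hn.swap)
  have hK : ((polyFilledJulia c ∩ closure M) \ M).Countable := by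
    refine ((countable_singleton (-b)).insert b).mono ?_
    rintro y ⟨⟨hyK, hyc⟩, hyM⟩
    have h1 : y ∉ sector ψ u v b :=
      H.closure_sector_subset h.swap (closure_mono inter_subset_left hyc)
    have h2 : y ∉ sector ψ (-u) (-v) (-b) :=
      H.closure_sector_subset hn.swap (closure_mono inter_subset_right hyc)
    by_contra hcon
    rw [mem_insert_iff, mem_singleton_iff] at hcon
    push Not at hcon
    refine hyM ⟨(H.mem_sector_or h fun hc => hcon.1 (H.cut_inter hc hyK)).resolve_left h1,
      (H.mem_sector_or hn fun hc => hcon.2 (H.cut_inter hc hyK)).resolve_left h2⟩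
  have hzM : z ∈ M := ⟨hz, hz'⟩
  obtain ⟨r, s, hr, hrs⟩ := H.exists_ray_mem_component hM hK hzM
  have hsub := connectedComponentIn_subset M z
  have hsM := hsub hrs
  refine H.qmap_mem_sector_of_isPreconnected h.swap hb isPreconnected_connectedComponentIn
    (fun y hy => sector_subset (hsub hy).1) ?_ hr hrs ?_ (mem_connectedComponentIn hzM)
  · intro y hy hc
    have h1 := H.neg_mem_cut hc
    rw [neg_neg] at h1
    exact sector_subset (hsub hy).2 h1
  · exact sq_mem_arc_swap_of_lt_pi hlt ((H.ray_mem_sector_iff h.swap hr).1 hsM.1)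
      ((H.ray_mem_sector_iff hn.swap hr).1 hsM.2)

theorem mem_sector_or_neg_of_qmap_mem (h : IsRayPair ψ u v b) (hb : b ≠ 0)
    (hlt : ang u v < Real.pi) {z : ℂ} (hz : qmap c z ∈ sector ψ (u ^ 2) (v ^ 2) (qmap c b)) :
    z ∈ sector ψ u v b ∨ -z ∈ sector ψ u v b := by
  by_contra hcon
  push Not at hcon
  have hn := H.isRayPair_neg h
  have h1 : z ∉ cut ψ u v b := fun hc => sector_subset hz (H.qmap_mem_cut hc)
  have h2 : z ∉ cut ψ (-u) (-v) (-b) := by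
    intro hc
    have := H.neg_mem_cut hc
    simp only [neg_neg] at this
    have h5 := H.qmap_mem_cut this
    rw [qmap_neg] at h5
    exact sector_subset hz h5
  have h3 := (H.mem_sector_or h h1).resolve_left hcon.1
  have h4 := (H.mem_sector_or hn h2).resolve_left fun h' => hcon.2 (by
    have := H.neg_mem_sector hn h'
    simpa using this)
  exact (H.disjoint_sector (H.isRayPair_sq h hb)).le_bot ⟨hz, H.qmap_mem_sector_swap h hb hlt h3 h4⟩

/-- The preimage of the sector also has a symmetric part near `-b`. The cut at `b` lies in an open
sector at `-b`, which separates its points from that part. -/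
theorem eventually_mem_sector_iff_qmap (h : IsRayPair ψ u v b) (hb : b ≠ 0) {t : ℂ}
    (ht : t ∈ cut ψ u v b) :
    ∀ᶠ z in 𝓝 t, (z ∈ sector ψ u v b ↔ qmap c z ∈ sector ψ (u ^ 2) (v ^ 2) (qmap c b)) := by
  rcases H.ang_lt_pi_or_swap h hb with hlt | hlt
  · have hn := H.isRayPair_neg h
    filter_upwards [(H.isOpen_sector hn.swap).mem_nhds (H.cut_subset_sector_neg h hb hlt ht)]
      with z hz
    refine ⟨H.qmap_mem_sector_of_lt_pi h hb hlt, fun hq => ?_⟩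
    refine (H.mem_sector_or_neg_of_qmap_mem h hb hlt hq).resolve_right fun h' => ?_
    have := H.neg_mem_sector h h'
    rw [neg_neg] at this
    exact (H.disjoint_sector hn).le_bot ⟨this, hz⟩
  · have h' := h.swap
    have hn := H.isRayPair_neg h'
    rw [cut_comm] at ht
    filter_upwards [(H.isOpen_sector hn.swap).mem_nhds (H.cut_subset_sector_neg h' hb hlt ht)]
      with z hz
    refine ⟨fun hzs => H.qmap_mem_sector_swap h' hb hlt hzs hz, fun hq => ?_⟩
    have h1 : z ∉ cut ψ u v b := fun hc => sector_subset hq (H.qmap_mem_cut hc)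
    refine (H.mem_sector_or h h1).resolve_right fun h2 => ?_
    exact (H.disjoint_sector (H.isRayPair_sq h hb)).le_bot
      ⟨hq, H.qmap_mem_sector_of_lt_pi h' hb hlt h2⟩

theorem isRayPair_pow (h : IsRayPair ψ u v b) (m : ℕ) (hb : ∀ k < m, (qmap c)^[k] b ≠ 0) :
    IsRayPair ψ (u ^ 2 ^ m) (v ^ 2 ^ m) ((qmap c)^[m] b) := by
  induction m with
  | zero => simpa using h
  | succ m ih =>
    have h1 := H.isRayPair_sq (ih fun k hk => hb k (hk.trans (Nat.lt_succ_self m)))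
      (hb m (Nat.lt_succ_self m))
    rwa [← pow_mul, ← pow_mul, ← pow_succ, ← Function.iterate_succ_apply' (qmap c)] at h1

theorem iterate_mem_cut {z : ℂ} (hz : z ∈ cut ψ u v b) (m : ℕ) :
    (qmap c)^[m] z ∈ cut ψ (u ^ 2 ^ m) (v ^ 2 ^ m) ((qmap c)^[m] b) := by
  induction m with
  | zero => simpa using hz
  | succ m ih =>
    have h1 := H.qmap_mem_cut ih
    rwa [← pow_mul, ← pow_mul, ← pow_succ, ← Function.iterate_succ_apply' (qmap c),
      ← Function.iterate_succ_apply' (qmap c)] at h1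

/-- Near a pair of rays landing together, an iterate of the polynomial respects the sides of the
pair. -/
theorem eventually_mem_sector_iff (h : IsRayPair ψ u v b) (m : ℕ)
    (hb : ∀ k < m, (qmap c)^[k] b ≠ 0) {t : ℂ} (ht : t ∈ cut ψ u v b) :
    ∀ᶠ z in 𝓝 t, (z ∈ sector ψ u v b ↔
      (qmap c)^[m] z ∈ sector ψ (u ^ 2 ^ m) (v ^ 2 ^ m) ((qmap c)^[m] b)) := by
  induction m with
  | zero => simp
  | succ m ih =>
    have hb' : ∀ k < m, (qmap c)^[k] b ≠ 0 := fun k hk => hb k (hk.trans (Nat.lt_succ_self m))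
    have h1 := H.eventually_mem_sector_iff_qmap (H.isRayPair_pow h m hb')
      (hb m (Nat.lt_succ_self m)) (H.iterate_mem_cut ht m)
    have h2 := ((continuous_qmap c).iterate m).continuousAt.eventually h1
    filter_upwards [ih hb', h2] with z hz1 hz2
    rw [hz1, hz2, ← pow_mul, ← pow_mul, ← pow_succ, ← Function.iterate_succ_apply' (qmap c),
      ← Function.iterate_succ_apply' (qmap c)]

/-- Squaring preserves the cyclic order of the angles of the rays landing at a noncritical
point. -/
theorem sq_mem_arc {w : Circle} (hu : RayLands ψ u b) (hv : RayLands ψ v b) (hw : RayLands ψ w b)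
    (hb : b ≠ 0) (harc : v ∈ arc u w) : v ^ 2 ∈ arc (u ^ 2) (w ^ 2) := by
  obtain ⟨n1, n2, n3⟩ := ne_of_mem_arc harc
  refine sq_mem_arc_of_cyclic harc ?_
  have hb' : -b ≠ b := fun e => hb (neg_eq_self.1 e)
  -- The ray of angle `-u` lands at `-b`, so the arc containing `-u` spans the sector containing
  -- `-b`. The ray `-x` also lands at `-b`, hence `-x` is in this arc, which is therefore longer
  -- than `π`.
  have key : ∀ {x y : Circle}, x ≠ y → RayLands ψ x b → RayLands ψ y b →
      -u ∈ arc x y → Real.pi < ang x y := by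
    intro x y hxy hx hy hmem
    have hp : IsRayPair ψ x y b := ⟨hxy, hx, hy⟩
    have h1 := (H.landing_mem_sector_iff hp (H.rayLands_neg hu) hb').2 hmem
    have h2 := (H.landing_mem_sector_iff hp (H.rayLands_neg hx) hb').1 h1
    simpa using h2.2
  rcases mem_arc_or_mem_arc n3 (Circle.neg_ne_self u) (hu.neg_ne H hw hb) with h | h
  · rcases lt_trichotomy (ang u (-u)) (ang u v) with h1 | h1 | h1
    · left
      simpa using h1
    · exact absurd (ang_inj h1) (hu.neg_ne H hv hb)
    · right; left
      exact key n2 hv hw (mem_arc_of_ang_lt h h1)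
  · right; right
    exact key n3.symm hw hu h

end IsBottcherInverse

/-! ### Dividing cycles of a quadratic polynomial -/

theorem IsPreconnected.subset_of_locally {X : Type*} [TopologicalSpace X] {W L : Set X}
    (hW : IsPreconnected W) (hne : (W ∩ L).Nonempty)
    (h1 : ∀ z ∈ W, z ∈ L → ∀ᶠ y in 𝓝 z, y ∈ W → y ∈ L)
    (h2 : ∀ z ∈ W, z ∉ L → ∀ᶠ y in 𝓝 z, y ∈ W → y ∉ L) : W ⊆ L := by
  by_contra hcon
  obtain ⟨w, hw, hwL⟩ := not_subset.1 hcon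
  obtain ⟨z, hz, hz1, hz2⟩ := hW {z | ∀ᶠ y in 𝓝 z, y ∈ W → y ∈ L}
    {z | ∀ᶠ y in 𝓝 z, y ∈ W → y ∉ L} isOpen_setOfPred_eventually_nhds isOpen_setOfPred_eventually_nhds
    (fun z hz => by
      by_cases h : z ∈ L
      · exact Or.inl (h1 z hz h)
      · exact Or.inr (h2 z hz h))
    (hne.imp fun z hz => ⟨hz.1, h1 z hz.1 hz.2⟩) ⟨w, hw, h2 w hw hwL⟩
  exact Eventually.self_of_nhds hz2 hz (Eventually.self_of_nhds hz1 hz)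

/-- A cycle with at least two rays landing at each of its points, the rays landing at `a` having
period `p`. -/
structure IsDividingCycle (c : ℂ) (ψ : ℂ → ℂ) (a : ℂ) (p : ℕ) : Prop where
  bottcher : IsBottcherInverse c ψ
  pos : 0 < p
  dividing : ∀ k : ℕ, ∃ u v, IsRayPair ψ u v ((qmap c)^[k] a)
  period : ∀ u, RayLands ψ u a → u ^ 2 ^ p = u
  minimal : ∀ m, 0 < m → (∀ u, RayLands ψ u a → u ^ 2 ^ m = u) → p ≤ m
  ne : ∀ k : ℕ, qmap c 0 ≠ (qmap c)^[k] a
  zero_mem : (0 : ℂ) ∈ polyFilledJulia c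

theorem IsBottcherInverse.rayLands_pow {c : ℂ} {ψ : ℂ → ℂ} (H : IsBottcherInverse c ψ)
    {u : Circle} {b : ℂ} (h : RayLands ψ u b) (m : ℕ) :
    RayLands ψ (u ^ 2 ^ m) ((qmap c)^[m] b) := by
  induction m with
  | zero => simpa using h
  | succ m ih =>
    have h1 := H.rayLands_sq ih
    rwa [← pow_mul, ← pow_succ, ← Function.iterate_succ_apply' (qmap c)] at h1

theorem finite_pow_two_pow_eq {p : ℕ} (hp : 0 < p) : {u : Circle | u ^ 2 ^ p = u}.Finite := by
  have h1 : {z : ℂ | z ^ 2 ^ p = z}.Finite := by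
    have hne : (Polynomial.X ^ 2 ^ p - Polynomial.X : Polynomial ℂ) ≠ 0 := by
      have : 1 < 2 ^ p := Nat.one_lt_two_pow hp.ne'
      exact FiniteField.X_pow_card_sub_X_ne_zero ℂ this
    refine (Polynomial.finite_setOfPred_isRoot hne).subset fun z hz => ?_
    have hz' : z ^ 2 ^ p = z := hz
    simp [Polynomial.IsRoot, hz']
  refine (h1.preimage Circle.coe_injective.injOn).subset fun u hu => ?_
  have hu' : u ^ 2 ^ p = u := hu
  exact (Circle.coe_pow u _).symm.trans (congrArg _ hu')

namespace IsDividingCycle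

variable {c : ℂ} {ψ : ℂ → ℂ} {a : ℂ} {p : ℕ} (D : IsDividingCycle c ψ a p)
include D

theorem iterate_add_period (k : ℕ) : (qmap c)^[k + p] a = (qmap c)^[k] a := by
  obtain ⟨u, v, h⟩ := D.dividing 0
  have h1 : RayLands ψ u a := h.left
  have h2 := D.bottcher.rayLands_pow h1 p
  rw [D.period u h1] at h2
  rw [Function.iterate_add_apply, ← h1.eq h2]

theorem iterate_add_mul_period (k n : ℕ) : (qmap c)^[k + n * p] a = (qmap c)^[k] a := by
  induction n with
  | zero => simp
  | succ n ih => rw [Nat.succ_mul, ← add_assoc, D.iterate_add_period, ih]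

theorem iterate_ne_zero (k : ℕ) : (qmap c)^[k] a ≠ 0 := by
  intro h
  apply D.ne (k + 1)
  rw [Function.iterate_succ_apply', h]

theorem eq_of_sq_eq {k : ℕ} {u v : Circle} (hu : RayLands ψ u ((qmap c)^[k] a))
    (hv : RayLands ψ v ((qmap c)^[k] a)) (h : u ^ 2 = v ^ 2) : u = v := by
  rcases Circle.eq_or_eq_neg_of_sq_eq h with h | h
  · exact h
  · exact absurd h.symm (hv.neg_ne D.bottcher hu (D.iterate_ne_zero k))

theorem rayLands_pow {k : ℕ} {u : Circle} (hu : RayLands ψ u ((qmap c)^[k] a)) (m : ℕ) :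
    RayLands ψ (u ^ 2 ^ m) ((qmap c)^[k + m] a) := by
  have := D.bottcher.rayLands_pow hu m
  rwa [← Function.iterate_add_apply, add_comm] at this

theorem eq_of_pow_eq {k : ℕ} {u v : Circle} (hu : RayLands ψ u ((qmap c)^[k] a))
    (hv : RayLands ψ v ((qmap c)^[k] a)) (m : ℕ) (h : u ^ 2 ^ m = v ^ 2 ^ m) : u = v := by
  induction m with
  | zero => simpa using h
  | succ m ih =>
    apply ih
    rw [pow_succ, pow_mul, pow_mul] at h
    exact D.eq_of_sq_eq (D.rayLands_pow hu m) (D.rayLands_pow hv m) h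

/-- Rays at another point of the cycle are pushed forward to rays at `a`, where the period is known.
Squaring is injective on the rays landing at a point of the cycle, so the identity can be pulled
back. -/
theorem pow_period_eq {k : ℕ} {u : Circle} (hu : RayLands ψ u ((qmap c)^[k] a)) :
    u ^ 2 ^ p = u := by
  have hk : k + (k * p - k) = 0 + k * p := by
    have : k ≤ k * p := Nat.le_mul_of_pos_right k D.pos
    omega
  have h1 := D.rayLands_pow hu (k * p - k)
  rw [hk, D.iterate_add_mul_period] at h1
  have h2 := D.period _ h1
  have h3 := D.rayLands_pow hu p
  rw [D.iterate_add_period] at h3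
  refine D.eq_of_pow_eq h3 hu (k * p - k) ?_
  rw [← pow_mul, mul_comm, pow_mul, h2]

theorem pow_mul_period_eq {k : ℕ} {u : Circle} (hu : RayLands ψ u ((qmap c)^[k] a)) (n : ℕ) :
    u ^ 2 ^ (n * p) = u := by
  induction n with
  | zero => simp
  | succ n ih => rw [Nat.succ_mul, pow_add, pow_mul, ih, D.pow_period_eq hu]

theorem exists_sq_eq {k : ℕ} {u : Circle} (hu : RayLands ψ u ((qmap c)^[k + 1] a)) :
    ∃ v, RayLands ψ v ((qmap c)^[k] a) ∧ v ^ 2 = u := by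
  have hp := D.pos
  refine ⟨u ^ 2 ^ (p - 1), ?_, ?_⟩
  · have h1 := D.rayLands_pow hu (p - 1)
    rwa [show k + 1 + (p - 1) = k + p by omega, D.iterate_add_period] at h1
  · rw [← pow_mul, ← pow_succ, show p - 1 + 1 = p by omega, D.pow_period_eq hu]

theorem pow_mem_arc {k : ℕ} {u v w : Circle} (hu : RayLands ψ u ((qmap c)^[k] a))
    (hv : RayLands ψ v ((qmap c)^[k] a)) (hw : RayLands ψ w ((qmap c)^[k] a))
    (h : v ∈ arc u w) (m : ℕ) : v ^ 2 ^ m ∈ arc (u ^ 2 ^ m) (w ^ 2 ^ m) := by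
  induction m with
  | zero => simpa using h
  | succ m ih =>
    have := D.bottcher.sq_mem_arc (D.rayLands_pow hu m) (D.rayLands_pow hv m)
      (D.rayLands_pow hw m) (D.iterate_ne_zero _) ih
    rwa [← pow_mul, ← pow_mul, ← pow_mul, ← pow_succ] at this

/-- If an iterate of angle doubling fixes one of the rays landing at a point of the cycle, then it
fixes all of them. -/
theorem pow_eq_of_pow_eq {k m : ℕ} {x : Circle} (hx : RayLands ψ x ((qmap c)^[k] a))
    (hxm : x ^ 2 ^ m = x) {w : Circle} (hw : RayLands ψ w ((qmap c)^[k] a)) : w ^ 2 ^ m = w := by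
  by_contra hne
  have hA : (qmap c)^[k + m] a = (qmap c)^[k] a := by
    have := D.rayLands_pow hx m
    rw [hxm] at this
    exact this.eq hx
  have hland : ∀ {u}, RayLands ψ u ((qmap c)^[k] a) → RayLands ψ (u ^ 2 ^ m) ((qmap c)^[k] a) := by
    intro u hu
    rw [← hA]
    exact D.rayLands_pow hu m
  let g : Circle → Circle := fun u => u ^ 2 ^ m
  have hg : ∀ n, g^[n] w = w ^ 2 ^ (n * m) := by
    intro n
    induction n with
    | zero => simp
    | succ n ih =>
      rw [Function.iterate_succ_apply', ih]
      change (w ^ 2 ^ (n * m)) ^ 2 ^ m = _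
      rw [← pow_mul, ← pow_add, Nat.succ_mul]
  have hgl : ∀ n, RayLands ψ (g^[n] w) ((qmap c)^[k] a) := by
    intro n
    induction n with
    | zero => exact hw
    | succ n ih =>
      rw [Function.iterate_succ_apply']
      exact hland ih
  have hper : g^[p] w = w := by
    rw [hg, mul_comm, D.pow_mul_period_eq hw]
  have hwx : w ≠ x := by
    rintro rfl
    exact hne hxm
  have hgx : g w ≠ x := fun e => hwx (D.eq_of_pow_eq hw hx m (e.trans hxm.symm))
  have hstep : ∀ {u v}, RayLands ψ u ((qmap c)^[k] a) → RayLands ψ v ((qmap c)^[k] a) →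
      u ∈ arc x v → g u ∈ arc x (g v) := by
    intro u v hu hv h
    have := D.pow_mem_arc hx hu hv h m
    rwa [hxm] at this
  have hp := D.pos
  -- The map `g` preserves the cyclic order and fixes `x`, so it is monotone in the angle measured
  -- from `x`. Its orbit through `w` has period `p`, which excludes strict monotonicity.
  rcases lt_trichotomy (ang x w) (ang x (g w)) with h | h | h
  · have h0 : ∀ n, g^[n] w ∈ arc x (g^[n + 1] w) := by
      intro n
      induction n with
      | zero => exact ⟨ang_pos hwx.symm, h⟩
      | succ n ih =>
        have := hstep (hgl n) (hgl (n + 1)) ih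
        rwa [← Function.iterate_succ_apply' g, ← Function.iterate_succ_apply' g] at this
    have hmono : StrictMono fun n => ang x (g^[n] w) := strictMono_nat_of_lt_succ fun n => (h0 n).2
    have h1 := hmono hp
    simp only [hper, Function.iterate_zero, id] at h1
    exact lt_irrefl _ h1
  · exact hne (ang_inj h).symm
  · have h0 : ∀ n, g^[n + 1] w ∈ arc x (g^[n] w) := by
      intro n
      induction n with
      | zero => exact ⟨ang_pos hgx.symm, h⟩
      | succ n ih =>
        have := hstep (hgl (n + 1)) (hgl n) ih
        rwa [← Function.iterate_succ_apply' g, ← Function.iterate_succ_apply' g] at this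
    have hanti : StrictAnti fun n => ang x (g^[n] w) :=
      strictAnti_nat_of_succ_lt fun n => (h0 n).2
    have h1 := hanti hp
    simp only [hper, Function.iterate_zero, id] at h1
    exact lt_irrefl _ h1

theorem finite_rayPairs :
    {q : Circle × Circle | ∃ k : ℕ, IsRayPair ψ q.1 q.2 ((qmap c)^[k] a)}.Finite := by
  have h1 := finite_pow_two_pow_eq D.pos
  refine (h1.prod h1).subset ?_
  rintro ⟨u, v⟩ ⟨k, h⟩
  exact ⟨D.pow_period_eq h.left, D.pow_period_eq h.right⟩

/-- The rays bounding the sector with the smallest angle bound a sector containing the critical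
value and no rays of the cycle. -/
theorem exists_critical_pair : ∃ (x y : Circle) (k : ℕ), IsRayPair ψ x y ((qmap c)^[k] a) ∧
    ang y x < Real.pi ∧ (∀ s (j : ℕ), RayLands ψ s ((qmap c)^[j] a) → s ∉ arc (x ^ 2) (y ^ 2)) ∧
    qmap c 0 ∈ sector ψ (x ^ 2) (y ^ 2) (qmap c ((qmap c)^[k] a)) := by
  have H := D.bottcher
  obtain ⟨u, v, huv⟩ := D.dividing 0
  obtain ⟨⟨X, Y⟩, ⟨k₁, hXY⟩, hmin⟩ := Set.exists_min_image _ (fun q : Circle × Circle => ang q.1 q.2)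
    D.finite_rayPairs ⟨(u, v), 0, huv⟩
  replace hmin : ∀ {s t : Circle} (j : ℕ), IsRayPair ψ s t ((qmap c)^[j] a) →
      ang X Y ≤ ang s t := fun j h => hmin ⟨_, _⟩ ⟨j, h⟩
  simp only at hXY
  obtain ⟨k, hk⟩ : ∃ k, (qmap c)^[k₁] a = (qmap c)^[k + 1] a := by
    refine ⟨k₁ + p - 1, ?_⟩
    have := D.pos
    rw [show k₁ + p - 1 + 1 = k₁ + p by omega, D.iterate_add_period]
  rw [hk] at hXY
  obtain ⟨x, hx, rfl⟩ := D.exists_sq_eq hXY.left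
  obtain ⟨y, hy, rfl⟩ := D.exists_sq_eq hXY.right
  have hxy : IsRayPair ψ x y ((qmap c)^[k] a) := ⟨fun e => hXY.ne (by rw [e]), hx, hy⟩
  have hnz := D.iterate_ne_zero k
  have hlt : ang y x < Real.pi := by
    refine (H.ang_lt_pi_or_swap hxy hnz).resolve_left fun h => ?_
    -- If the arc from `x` to `y` were shorter than `π`, it would be half of the arc between the
    -- squares, contradicting minimality.
    have h1 := ang_sq_of_lt h
    have h2 := hmin k hxy
    have h3 := ang_pos hxy.ne
    linarith
  rw [Function.iterate_succ_apply'] at hXY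
  refine ⟨x, y, k, hxy, hlt, ?_, ?_⟩
  · intro s j hs hsa
    obtain ⟨s', hs', hne⟩ : ∃ s', RayLands ψ s' ((qmap c)^[j] a) ∧ s' ≠ s := by
      obtain ⟨u', v', h'⟩ := D.dividing j
      by_cases h : u' = s
      · exact ⟨v', h'.right, fun e => h'.ne (h.trans e.symm)⟩
      · exact ⟨u', h'.left, h⟩
    by_cases hj : (qmap c)^[j] a = qmap c ((qmap c)^[k] a)
    · have hp : IsRayPair ψ (x ^ 2) s ((qmap c)^[j] a) :=
        ⟨(ne_of_mem_arc hsa).1.symm, hj ▸ hXY.left, hs⟩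
      have := hmin j hp
      linarith [hsa.2]
    -- The landing point lies inside the sector, so all rays landing there do. Two of them would
    -- bound an arc strictly inside the minimal one.
    · have hA := (H.landing_mem_sector_iff hXY hs hj).2 hsa
      have hsa' := (H.landing_mem_sector_iff hXY hs' hj).1 hA
      have h1 := hmin j ⟨hne.symm, hs, hs'⟩
      have h2 := hmin j ⟨hne, hs', hs⟩
      have h3 := hsa.1
      have h4 := hsa'.1
      have h5 := hsa.2
      have h6 := hsa'.2
      have h7 := ang_add (x ^ 2) s s'
      have h8 := ang_add (x ^ 2) s' s
      have h9 := ang_lt s s'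
      have h10 := ang_lt s' s
      have h11 := ang_lt (x ^ 2) (y ^ 2)
      rcases h7 with h7 | h7 <;> rcases h8 with h8 | h8 <;> linarith [ang_add_ang_swap hne]
  · have h0K : qmap c 0 ∈ polyFilledJulia c := qmap_mem_iff.2 D.zero_mem
    have hcut : qmap c 0 ∉ cut ψ (x ^ 2) (y ^ 2) (qmap c ((qmap c)^[k] a)) := by
      intro h
      apply D.ne (k + 1)
      rw [Function.iterate_succ_apply']
      exact H.cut_inter h h0K
    refine (H.mem_sector_or hXY hcut).resolve_right fun h => ?_
    -- If the critical value were in the other sector, `0` would lie in the short sector between `y`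
    -- and `x` or in its negative.
    have h1 := H.zero_not_mem_sector hxy.swap hnz hlt
    rcases H.mem_sector_or_neg_of_qmap_mem hxy.swap hnz hlt h with h2 | h2
    · exact h1 h2
    · rw [neg_zero] at h2
      exact h1 h2

end IsDividingCycle

/-- A pair of rays landing at the point `a` of a dividing cycle whose images bound the sector of
the critical value. -/
structure IsCriticalPair (c : ℂ) (ψ : ℂ → ℂ) (a : ℂ) (x y : Circle) : Prop where
  pair : IsRayPair ψ x y a
  lt : ang y x < Real.pi
  not_mem_arc : ∀ s (j : ℕ), RayLands ψ s ((qmap c)^[j] a) → s ∉ arc (x ^ 2) (y ^ 2)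
  value_mem : qmap c 0 ∈ sector ψ (x ^ 2) (y ^ 2) (qmap c a)

namespace IsDividingCycle

variable {c : ℂ} {ψ : ℂ → ℂ} {a : ℂ} {p : ℕ} (D : IsDividingCycle c ψ a p)
include D

/-- The set `q Ω` avoids the rays of the cycle and contains the critical value, so it lies in the
critical value sector, and `q a` lies in its closure. A point of the cycle there other than the
vertex would send rays into the forbidden arc. So the vertex is `q a`, and periodicity makes `a` the
vertex one step earlier. -/
theorem exists_isCriticalPair {Ω : Set ℂ} (hΩ : IsPreconnected Ω) (h0 : (0 : ℂ) ∈ Ω)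
    (ha : a ∈ closure Ω)
    (hR : ∀ z ∈ Ω, ∀ (k : ℕ) s, RayLands ψ s ((qmap c)^[k] a) →
      qmap c z ∉ landedRay ψ s ((qmap c)^[k] a)) :
    ∃ x y, IsCriticalPair c ψ a x y ∧
      ∀ z ∈ closure Ω, qmap c z ∉ sector ψ (y ^ 2) (x ^ 2) (qmap c a) := by
  have H := D.bottcher
  obtain ⟨x, y, k, hxy, hlt, hno, hval⟩ := D.exists_critical_pair
  have hsq := H.isRayPair_sq hxy (D.iterate_ne_zero k)
  have hk : qmap c ((qmap c)^[k] a) = (qmap c)^[k + 1] a :=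
    (Function.iterate_succ_apply' (qmap c) k a).symm
  have hsub : ∀ z ∈ Ω, qmap c z ∈ sector ψ (x ^ 2) (y ^ 2) (qmap c ((qmap c)^[k] a)) := by
    have h1 := hΩ.image (qmap c) (continuous_qmap c).continuousOn
    intro z hz
    rw [sector, connectedComponentIn_eq hval]
    refine h1.subset_connectedComponentIn ⟨0, h0, rfl⟩ ?_ ⟨z, hz, rfl⟩
    rintro _ ⟨w, hw, rfl⟩ (hc | hc)
    · rw [hk] at hc hsq
      exact hR w hw (k + 1) _ hsq.left hc
    · rw [hk] at hc hsq
      exact hR w hw (k + 1) _ hsq.right hc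
  have hcl : ∀ z ∈ closure Ω,
      qmap c z ∉ sector ψ (y ^ 2) (x ^ 2) (qmap c ((qmap c)^[k] a)) := by
    intro z hz
    have h1 : qmap c z ∈ closure (sector ψ (x ^ 2) (y ^ 2) (qmap c ((qmap c)^[k] a))) :=
      map_mem_closure (continuous_qmap c) hz hsub
    exact H.closure_sector_subset hsq h1
  have hA1 : (qmap c)^[1] a = (qmap c)^[k + 1] a := by
    by_contra hne
    obtain ⟨u, v, huv⟩ := D.dividing 1
    have h1 : u ∈ arc (x ^ 2) (y ^ 2) := by
      rw [← H.landing_mem_sector_iff hsq huv.left (by rwa [hk])]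
      refine (H.mem_sector_or hsq fun hc => hne ?_).resolve_right ?_
      · rw [← hk]
        exact H.cut_inter hc (H.landing_mem huv.left)
      · exact hcl a ha
    exact hno u 1 huv.left h1
  have hAk : (qmap c)^[k] a = a := by
    have hp := D.pos
    have h1 := congrArg ((qmap c)^[p - 1]) hA1
    rw [← Function.iterate_add_apply, ← Function.iterate_add_apply,
      show p - 1 + 1 = 0 + p by omega, show p - 1 + (k + 1) = k + p by omega,
      D.iterate_add_period, D.iterate_add_period] at h1
    exact h1.symm
  rw [hAk] at hxy hval hcl
  exact ⟨x, y, ⟨hxy, hlt, hno, hval⟩, hcl⟩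

end IsDividingCycle

namespace IsDividingCycle

variable {c : ℂ} {ψ : ℂ → ℂ} {a : ℂ} {p : ℕ} (D : IsDividingCycle c ψ a p)
include D

theorem ne_zero : a ≠ 0 := D.iterate_ne_zero 0

theorem iterate_period : (qmap c)^[p] a = a := by
  have := D.iterate_add_period 0
  rwa [zero_add] at this

variable {x y : Circle} (hxy : IsCriticalPair c ψ a x y)
include hxy

theorem isRayPair_sq : IsRayPair ψ (x ^ 2) (y ^ 2) (qmap c a) :=
  D.bottcher.isRayPair_sq hxy.pair D.ne_zero

/-- The point `A` of the cycle is outside the closed sector of the critical value, unless it is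
its vertex. -/
theorem iterate_mem_sector {j : ℕ} (hj : (qmap c)^[j] a ≠ qmap c a) :
    (qmap c)^[j] a ∈ sector ψ (y ^ 2) (x ^ 2) (qmap c a) := by
  have H := D.bottcher
  have hsq := D.isRayPair_sq hxy
  obtain ⟨u, v, huv⟩ := D.dividing j
  refine (H.mem_sector_or hsq fun hc => hj (H.cut_inter hc (H.landing_mem huv.left))).resolve_left
    fun h => ?_
  exact hxy.not_mem_arc u j huv.left ((H.landing_mem_sector_iff hsq huv.left hj).1 h)

theorem mem_arc_of_rayLands {j : ℕ} {s : Circle} (hs : RayLands ψ s ((qmap c)^[j] a))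
    (hj : (qmap c)^[j] a ≠ qmap c a) : s ∈ arc (y ^ 2) (x ^ 2) :=
  (D.bottcher.landing_mem_sector_iff (D.isRayPair_sq hxy).swap hs hj).1
    (D.iterate_mem_sector hxy hj)

/-- If an iterate `f ^ m`, `0 < m < p`, maps the vertex of the critical value sector to itself,
then the image of this sector is disjoint from it. -/
theorem sector_pow_subset {m : ℕ} (hm : 0 < m) (hmp : m < p)
    (hA : (qmap c)^[m + 1] a = qmap c a) :
    sector ψ (x ^ 2 ^ (m + 1)) (y ^ 2 ^ (m + 1)) ((qmap c)^[m + 1] a) ⊆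
      sector ψ (y ^ 2) (x ^ 2) (qmap c a) := by
  have H := D.bottcher
  have hsq := D.isRayPair_sq hxy
  have hp := D.pos
  have hss := H.isRayPair_pow hxy.pair (m + 1) fun k _ => D.iterate_ne_zero k
  have hA1 : (qmap c)^[1 + m] a = (qmap c)^[1] a := by rw [add_comm]; exact hA
  have hx1 : RayLands ψ (x ^ 2) ((qmap c)^[1] a) := hsq.left
  have hy1 : RayLands ψ (y ^ 2) ((qmap c)^[1] a) := hsq.right
  have hxs : (x ^ 2) ^ 2 ^ m = x ^ 2 ^ (m + 1) := by rw [← pow_mul, ← pow_succ']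
  have hys : (y ^ 2) ^ 2 ^ m = y ^ 2 ^ (m + 1) := by rw [← pow_mul, ← pow_succ']
  rw [hA] at hss ⊢
  have hAn : ∀ n : ℕ, (qmap c)^[1 + n * m] a = (qmap c)^[1] a := by
    intro n
    induction n with
    | zero => simp
    | succ n ih =>
      rw [Nat.succ_mul, show 1 + (n * m + m) = n * m + (1 + m) by ring,
        Function.iterate_add_apply, hA1, ← Function.iterate_add_apply, add_comm, ih]
  -- The pair `x ^ 2`, `y ^ 2` is adjacent among the rays at `q a`, and the image pair must be
  -- adjacent too. The exponent `(p - 1) * m` inverts the action of `m` doublings, whose `p`-th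
  -- power is the identity on these rays.
  have hfree : ∀ w, RayLands ψ w ((qmap c)^[1] a) → w ∉ arc (x ^ 2 ^ (m + 1)) (y ^ 2 ^ (m + 1)) := by
    intro w hw hwa
    have hw0 : RayLands ψ (w ^ 2 ^ ((p - 1) * m)) ((qmap c)^[1] a) := by
      have := D.rayLands_pow hw ((p - 1) * m)
      rwa [hAn] at this
    have hw1 : (w ^ 2 ^ ((p - 1) * m)) ^ 2 ^ m = w := by
      have : (p - 1) * m + m = m * p := by
        obtain ⟨q, rfl⟩ : ∃ q, p = q + 1 := ⟨p - 1, by omega⟩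
        simp; ring
      rw [← pow_mul, ← pow_add, this, D.pow_mul_period_eq hw]
    obtain ⟨n1, n2, n3⟩ := ne_of_mem_arc hwa
    have h1 : w ^ 2 ^ ((p - 1) * m) ≠ x ^ 2 := by
      intro e
      rw [e, hxs] at hw1
      exact n1 hw1.symm
    have h2 : w ^ 2 ^ ((p - 1) * m) ≠ y ^ 2 := by
      intro e
      rw [e, hys] at hw1
      exact n2 hw1.symm
    have h3 := (mem_arc_or_mem_arc hsq.ne h1 h2).resolve_left (hxy.not_mem_arc _ 1 hw0)
    have h4 := D.pow_mem_arc hy1 hw0 hx1 h3 m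
    rw [hw1, hxs, hys] at h4
    exact not_mem_arc_swap hwa h4
  have hsx : x ^ 2 ^ (m + 1) ≠ x ^ 2 := by
    intro e
    rw [← hxs] at e
    -- If `m` doublings fixed `x ^ 2`, they would fix all rays at `q a`, hence all rays at `a`,
    -- contrary to the minimality of `p`.
    refine absurd (D.minimal m hm fun u hu => ?_) (not_le.2 hmp)
    have hu' : RayLands ψ u ((qmap c)^[0] a) := hu
    have hu1 : RayLands ψ (u ^ 2) ((qmap c)^[1] a) := by
      have := D.rayLands_pow hu' 1
      simpa using this
    have h1 := D.pow_eq_of_pow_eq hx1 e hu1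
    have hAm : (qmap c)^[0 + m] a = (qmap c)^[0] a := by
      have h2 := congrArg ((qmap c)^[p - 1]) hA1
      rw [← Function.iterate_add_apply, ← Function.iterate_add_apply,
        show p - 1 + (1 + m) = (0 + m) + p by omega, show p - 1 + 1 = 0 + p by omega,
        D.iterate_add_period, D.iterate_add_period] at h2
      exact h2
    have h3 := D.rayLands_pow hu' m
    rw [hAm] at h3
    refine D.eq_of_sq_eq h3 hu' ?_
    rw [← pow_mul, mul_comm, pow_mul, h1]
  have hx_not := hfree _ hx1
  have hy_not := hfree _ hy1
  have hs_not : x ^ 2 ^ (m + 1) ∉ arc (x ^ 2) (y ^ 2) := by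
    refine hxy.not_mem_arc _ 1 ?_
    exact hss.left
  have hmid := mid_mem_arc hss.ne
  set q := x ^ 2 ^ (m + 1) * Circle.exp (ang (x ^ 2 ^ (m + 1)) (y ^ 2 ^ (m + 1)) / 2) with hq
  refine H.sector_subset_sector hsq.swap hss ?_ (s := q) ?_ hmid
  · rw [disjoint_left]
    rintro z ((rfl | ⟨r, hr, rfl⟩) | (rfl | ⟨r, hr, rfl⟩))
    · exact landing_not_mem_sector
    · rw [H.ray_mem_sector_iff hss hr]
      exact hy_not
    · exact landing_not_mem_sector
    · rw [H.ray_mem_sector_iff hss hr]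
      exact hx_not
  · have hqx : q ≠ x ^ 2 := fun e => hx_not (e ▸ hmid)
    have hqy : q ≠ y ^ 2 := fun e => hy_not (e ▸ hmid)
    refine (mem_arc_or_mem_arc hsq.ne hqx hqy).resolve_left fun hqa => ?_
    obtain ⟨n1, -, -⟩ := ne_of_mem_arc hmid
    rcases mem_arc_or_mem_arc hqx.symm hsx n1.symm with h | h
    · exact hs_not (arc_subset_of_mem hqa h)
    · exact hx_not (arc_subset_of_mem hmid (mem_arc_rotate h))

/-- If the `(m + 1)`-st iterate does not take `a` to `q a`, it takes the cut into the open
complementary sector, and the premise fails nearby. Otherwise it carries the inner side of the cut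
into that sector by `sector_pow_subset`. -/
theorem eventually_not_mem_sector {m : ℕ} (hm : 0 < m) (hmp : m < p) {t : ℂ}
    (ht : t ∈ cut ψ x y a) :
    ∀ᶠ z in 𝓝 t, qmap c ((qmap c)^[m] z) ∉ sector ψ (y ^ 2) (x ^ 2) (qmap c a) →
      z ∉ sector ψ x y a := by
  have H := D.bottcher
  have hsq := D.isRayPair_sq hxy
  have hnz : ∀ k < m + 1, (qmap c)^[k] a ≠ 0 := fun k _ => D.iterate_ne_zero k
  have hcont : Continuous fun z => qmap c ((qmap c)^[m] z) :=
    (continuous_qmap c).comp ((continuous_qmap c).iterate m)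
  by_cases hB : qmap c ((qmap c)^[m] t) ∈ sector ψ (y ^ 2) (x ^ 2) (qmap c a)
  · filter_upwards [hcont.continuousAt.eventually ((H.isOpen_sector hsq.swap).mem_nhds hB)]
      with z hz hz'
    exact absurd hz hz'
  · have hss := H.isRayPair_pow hxy.pair (m + 1) hnz
    have hA : (qmap c)^[m + 1] a = qmap c a := by
      by_contra hne
      have h1 := D.mem_arc_of_rayLands hxy hss.left hne
      have h2 := D.mem_arc_of_rayLands hxy hss.right hne
      have h3 := H.cut_subset_sector hss hsq.swap hne h1 h2 (H.iterate_mem_cut ht (m + 1))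
      rw [Function.iterate_succ_apply'] at h3
      exact hB h3
    filter_upwards [H.eventually_mem_sector_iff hxy.pair (m + 1) hnz ht] with z hz hz' hzs
    have h1 := D.sector_pow_subset hxy hm hmp hA (hz.1 hzs)
    rw [Function.iterate_succ_apply'] at h1
    exact hz' h1

theorem eventually_not_mem_sector_swap {t : ℂ} (ht : t ∈ cut ψ x y a) :
    ∀ᶠ z in 𝓝 t, qmap c ((qmap c)^[p] z) ∉ sector ψ (y ^ 2) (x ^ 2) (qmap c a) →
      z ∉ sector ψ y x a := by
  have H := D.bottcher
  rw [cut_comm] at ht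
  have hx : RayLands ψ x ((qmap c)^[0] a) := hxy.pair.left
  have hy : RayLands ψ y ((qmap c)^[0] a) := hxy.pair.right
  filter_upwards [H.eventually_mem_sector_iff hxy.pair.swap (p + 1)
    (fun k _ => D.iterate_ne_zero k) ht] with z hz hz' hzs
  have h1 := hz.1 hzs
  rw [Function.iterate_succ_apply', Function.iterate_succ_apply', D.iterate_period, pow_succ,
    pow_mul, pow_mul, D.pow_period_eq hx, D.pow_period_eq hy] at h1
  exact hz' h1

/-- A connected set the image of which under `f ^ m`, `0 < m < p`, is disjoint from the lateral
sectors either is contained in the closed lateral sector at `a` or is disjoint from it. -/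
theorem not_mem_sector_of_isPreconnected {m : ℕ} (hm : 0 < m) (hmp : m < p) {Y : Set ℂ}
    (hY : IsPreconnected Y)
    (hYm : ∀ z ∈ Y, qmap c ((qmap c)^[m] z) ∉ sector ψ (y ^ 2) (x ^ 2) (qmap c a))
    (hne : ∃ z ∈ Y, z ∉ sector ψ x y a) {z : ℂ} (hz : z ∈ Y) : z ∉ sector ψ x y a := by
  have H := D.bottcher
  refine (hY.subset_of_locally (L := (sector ψ x y a)ᶜ) ?_ ?_ ?_ : Y ⊆ _) hz
  · obtain ⟨z, hz, hz'⟩ := hne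
    exact ⟨z, hz, hz'⟩
  · intro t htY ht
    by_cases hc : t ∈ cut ψ x y a
    · filter_upwards [D.eventually_not_mem_sector hxy hm hmp hc] with w hw hwY
      exact hw (hYm w hwY)
    · have h1 := (H.mem_sector_or hxy.pair hc).resolve_left ht
      filter_upwards [(H.isOpen_sector hxy.pair.swap).mem_nhds h1] with w hw _ hw'
      exact (H.disjoint_sector hxy.pair).le_bot ⟨hw', hw⟩
  · intro t htY ht
    filter_upwards [(H.isOpen_sector hxy.pair).mem_nhds (notMem_compl_iff.1 ht)] with w hw _ hw'
    exact hw' hw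

theorem qmap_mem_sector_iff {z : ℂ} : qmap c z ∈ sector ψ (y ^ 2) (x ^ 2) (qmap c a) ↔
    z ∈ sector ψ y x a ∨ -z ∈ sector ψ y x a := by
  have H := D.bottcher
  refine ⟨H.mem_sector_or_neg_of_qmap_mem hxy.pair.swap D.ne_zero hxy.lt, ?_⟩
  rintro (h | h)
  · exact H.qmap_mem_sector_of_lt_pi hxy.pair.swap D.ne_zero hxy.lt h
  · have h1 := H.qmap_mem_sector_of_lt_pi hxy.pair.swap D.ne_zero hxy.lt h
    rwa [qmap_neg] at h1

theorem mem_sector_of_not_mem {z : ℂ} (hz : z ∉ sector ψ x y a) : -z ∈ sector ψ x y a := by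
  have H := D.bottcher
  by_cases hc : z ∈ cut ψ y x a
  · have h1 := H.neg_mem_cut hc
    exact H.cut_neg_subset_sector hxy.pair.swap D.ne_zero hxy.lt h1
  · have h1 := (H.mem_sector_or hxy.pair.swap hc).resolve_right hz
    exact H.sector_neg_subset hxy.pair.swap D.ne_zero hxy.lt (H.neg_mem_sector hxy.pair.swap h1)

variable {W : Set ℂ} (hW : IsPreconnected W) (haW : a ∈ W)
  (hWp : ∀ z ∈ W, qmap c ((qmap c)^[p] z) ∉ sector ψ (y ^ 2) (x ^ 2) (qmap c a))
include hW haW hWp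

/-- The inequality holds at `a`, and `W` cannot lose it across the cut: `q^p` fixes `a` and the rays
`x`, `y` and preserves their sides, so a point just beyond the cut would be sent beyond it again.
The cut at `-a` is treated by symmetry. -/
theorem qmap_not_mem_sector_of_isPreconnected {z : ℂ} (hz : z ∈ W) :
    qmap c z ∉ sector ψ (y ^ 2) (x ^ 2) (qmap c a) := by
  have H := D.bottcher
  have hsq := D.isRayPair_sq hxy
  have hp := D.pos
  have hnegp : ∀ w, (qmap c)^[p] (-w) = (qmap c)^[p] w := by
    intro w
    obtain ⟨q, rfl⟩ : ∃ q, p = q + 1 := ⟨p - 1, by omega⟩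
    rw [Function.iterate_succ_apply, Function.iterate_succ_apply, qmap_neg]
  have key : ∀ t ∈ cut ψ x y a, ∀ᶠ w in 𝓝 t,
      qmap c ((qmap c)^[p] w) ∉ sector ψ (y ^ 2) (x ^ 2) (qmap c a) →
      qmap c w ∉ sector ψ (y ^ 2) (x ^ 2) (qmap c a) := by
    intro t ht
    have ht' : t ∈ sector ψ (-x) (-y) (-a) := by
      rw [cut_comm] at ht
      exact H.cut_subset_sector_neg hxy.pair.swap D.ne_zero hxy.lt ht
    have hn := H.isRayPair_neg hxy.pair
    filter_upwards [D.eventually_not_mem_sector_swap hxy ht, (H.isOpen_sector hn).mem_nhds ht']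
      with w hw1 hw2 hw3
    rw [D.qmap_mem_sector_iff hxy]
    push Not
    refine ⟨hw1 hw3, fun h => ?_⟩
    have h1 := H.neg_mem_sector hxy.pair.swap h
    rw [neg_neg] at h1
    exact (H.disjoint_sector hn).le_bot ⟨hw2, h1⟩
  refine (hW.subset_of_locally
    (L := {z | qmap c z ∉ sector ψ (y ^ 2) (x ^ 2) (qmap c a)}) ?_ ?_ ?_ : W ⊆ _) hz
  · exact ⟨a, haW, landing_not_mem_sector⟩
  · intro t htW ht
    by_cases hc : qmap c t ∈ cut ψ (x ^ 2) (y ^ 2) (qmap c a)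
    · rcases H.mem_cut_or_of_qmap_mem hc with hc | hc
      · filter_upwards [key t hc] with w hw hwW
        exact hw (hWp w hwW)
      · have h1 := continuous_neg.continuousAt.eventually (key (-t) hc)
        filter_upwards [h1] with w hw hwW
        rw [hnegp, qmap_neg] at hw
        exact hw (hWp w hwW)
    · have h1 := (H.mem_sector_or hsq hc).resolve_right ht
      filter_upwards [(continuous_qmap c).continuousAt.eventually
        ((H.isOpen_sector hsq).mem_nhds h1)] with w hw _ hw'
      exact (H.disjoint_sector hsq).le_bot ⟨hw, hw'⟩
  · intro t htW ht
    have ht' : qmap c t ∈ sector ψ (y ^ 2) (x ^ 2) (qmap c a) := not_not.1 ht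
    filter_upwards [(continuous_qmap c).continuousAt.eventually
        ((H.isOpen_sector hsq.swap).mem_nhds ht')] with w hw _ hw'
    exact hw' hw

/-- The intermediate images of `W` are contained in the closed lateral sectors. -/
theorem iterate_image_lateral {j : ℕ} (hj : 0 < j) (hjp : j < p) :
    (∀ z ∈ W, (qmap c)^[j] z ∉ sector ψ x y a) ∨
      ∀ z ∈ W, -(qmap c)^[j] z ∉ sector ψ x y a := by
  have H := D.bottcher
  have hsq := D.isRayPair_sq hxy
  have hm : 0 < p - j := by omega
  have hmp : p - j < p := by omega
  have hY := hW.image ((qmap c)^[j]) ((continuous_qmap c).iterate j).continuousOn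
  have hYm : ∀ z ∈ (qmap c)^[j] '' W,
      qmap c ((qmap c)^[p - j] z) ∉ sector ψ (y ^ 2) (x ^ 2) (qmap c a) := by
    rintro _ ⟨z, hz, rfl⟩
    rw [← Function.iterate_add_apply, show p - j + j = p by omega]
    exact hWp z hz
  -- The base point of the image of `W` is on the cycle, hence in one of the two closed lateral
  -- sectors; connectedness keeps the whole image in the same one.
  have hstart : (qmap c)^[j] a ∉ sector ψ x y a ∨ -(qmap c)^[j] a ∉ sector ψ x y a := by
    by_cases hA : (qmap c)^[j + 1] a = qmap c a
    · rw [Function.iterate_succ_apply'] at hA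
      rcases qmap_eq_iff.1 hA with h | h
      · left
        rw [h]
        exact landing_not_mem_sector
      · right
        rw [h, neg_neg]
        exact landing_not_mem_sector
    · have h1 := D.iterate_mem_sector hxy hA
      rw [Function.iterate_succ_apply'] at h1
      rcases (D.qmap_mem_sector_iff hxy).1 h1 with h | h
      · exact Or.inl fun h' => (H.disjoint_sector hxy.pair).le_bot ⟨h', h⟩
      · exact Or.inr fun h' => (H.disjoint_sector hxy.pair).le_bot ⟨h', h⟩
  rcases hstart with h | h
  · left
    intro z hz
    exact D.not_mem_sector_of_isPreconnected hxy hm hmp hY hYm ⟨_, ⟨a, haW, rfl⟩, h⟩ ⟨z, hz, rfl⟩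
  · right
    intro z hz
    refine D.not_mem_sector_of_isPreconnected hxy hm hmp
      (Y := (fun w => -w) '' ((qmap c)^[j] '' W)) (hY.image _ continuous_neg.continuousOn) ?_
      ⟨_, ⟨_, ⟨a, haW, rfl⟩, rfl⟩, h⟩ ⟨_, ⟨z, hz, rfl⟩, rfl⟩
    rintro _ ⟨w, hw, rfl⟩
    obtain ⟨q, hq⟩ : ∃ q, p - j = q + 1 := ⟨p - j - 1, by omega⟩
    have := hYm w hw
    rw [hq, Function.iterate_succ_apply] at this ⊢
    rwa [qmap_neg]

/-- A closed lateral sector never contains both `z` and `-z`, so `q` is injective on the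
intermediate images of `W`. Only the first step from `W` can identify two points. -/
theorem qmap_eq_of_iterate_eq {d e : ℂ} (hd : d ∈ W) (he : e ∈ W)
    (hde : (qmap c)^[p] d = (qmap c)^[p] e) : qmap c d = qmap c e := by
  have hp := D.pos
  have key : ∀ n, n < p → (qmap c)^[p - n] d = (qmap c)^[p - n] e := by
    intro n
    induction n with
    | zero => exact fun _ => hde
    | succ n ih =>
      intro hn
      have h1 := ih (by omega)
      rw [show p - n = (p - (n + 1)) + 1 by omega, Function.iterate_succ_apply',
        Function.iterate_succ_apply'] at h1
      rcases qmap_eq_iff.1 h1 with h2 | h2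
      · exact h2
      · exfalso
        rcases D.iterate_image_lateral hxy hW haW hWp (j := p - (n + 1)) (by omega) (by omega)
          with h | h
        · have h3 := D.mem_sector_of_not_mem hxy (h e he)
          rw [← h2] at h3
          exact h d hd h3
        · have h3 := D.mem_sector_of_not_mem hxy (h e he)
          have h4 := h d hd
          rw [h2] at h4
          exact h4 h3
  have := key (p - 1) (by omega)
  rwa [show p - (p - 1) = 1 by omega] at this

end IsDividingCycle

/-! ### Invariant continua and the filled Julia set of the renormalization -/

theorem IsCompact.connectedComponentIn {M : Set ℂ} (hM : IsCompact M) (z : ℂ) :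
    IsCompact (connectedComponentIn M z) := by
  refine hM.of_isClosed_subset (isClosed_of_closure_subset fun y hy => ?_)
    (connectedComponentIn_subset M z)
  refine closure_connectedComponentIn_inter_subset M z ⟨hy, ?_⟩
  exact closure_minimal (connectedComponentIn_subset M z) hM.isClosed hy

/-- The nested components of the preimages of `M` attached to a fixed point `a` decrease to an
invariant continuum, provided that the orbit of `0` stays in the first of them and that the map is
totally ramified there at `0`. -/
theorem exists_invariant_continuum {T : ℂ → ℂ} (hc : Continuous T) (ho : IsOpenMap T)
    (hproper : ∀ S, IsCompact S → IsCompact (T ⁻¹' S)) {M : Set ℂ} (hM : IsCompact M) {a : ℂ}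
    (ha : T a = a) (hsub : connectedComponentIn (T ⁻¹' M) a ⊆ M)
    (h0 : ∀ i, T^[i] 0 ∈ connectedComponentIn (T ⁻¹' M) a)
    (hcrit : ∀ d ∈ connectedComponentIn (T ⁻¹' M) a, T d = T 0 → d = 0) :
    ∃ C, IsCompact C ∧ IsPreconnected C ∧ C ⊆ connectedComponentIn (T ⁻¹' M) a ∧
      0 ∈ C ∧ MapsTo T C C := by
  set W := connectedComponentIn (T ⁻¹' M) a with hW
  have haM : a ∈ T ⁻¹' M := connectedComponentIn_nonempty_iff.1 ⟨_, h0 0⟩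
  let S : ℕ → Set ℂ := fun n => (fun C => connectedComponentIn (T ⁻¹' C) a)^[n] W
  have hS0 : S 0 = W := rfl
  have hS1 : ∀ n, S (n + 1) = connectedComponentIn (T ⁻¹' (S n)) a := fun n =>
    Function.iterate_succ_apply' _ n W
  have step : ∀ n, IsCompact (S n) ∧ IsPreconnected (S n) ∧ a ∈ S n ∧ S n ⊆ W ∧
      S (n + 1) ⊆ S n ∧ ∀ i, T^[i] 0 ∈ S n := by
    intro n
    induction n with
    | zero =>
      refine ⟨(hproper M hM).connectedComponentIn a, isPreconnected_connectedComponentIn,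
        mem_connectedComponentIn haM, Subset.rfl, ?_, h0⟩
      rw [hS1, hS0]
      exact connectedComponentIn_mono a (preimage_mono hsub)
    | succ n ih =>
      obtain ⟨hcomp, hconn, han, hnW, hanti, horb⟩ := ih
      have hpre := hproper _ hcomp
      have haT : a ∈ T ⁻¹' (S n) := by rw [mem_preimage, ha]; exact han
      -- Each component of the preimage meeting `W` is mapped onto `S n`, so it contains a point
      -- over `T 0`, which can only be `0`. Hence all these components coincide, and the orbit of
      -- `0` stays in the one at `a`.
      have zero_mem : ∀ z ∈ W, T z ∈ S n → 0 ∈ connectedComponentIn (T ⁻¹' (S n)) z := by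
        intro z hz hTz
        have him := image_connectedComponentIn_preimage hc ho hconn hpre hTz
        obtain ⟨d, hd, hd'⟩ := him.symm ▸ horb 1
        have hdW : d ∈ W := by
          have h1 : connectedComponentIn (T ⁻¹' (S n)) z ⊆ W := by
            rw [hW, connectedComponentIn_eq hz]
            exact connectedComponentIn_mono z (preimage_mono (hnW.trans hsub))
          exact h1 hd
        rw [hcrit d hdW hd'] at hd
        exact hd
      have h0a := zero_mem a (hnW han) haT
      refine ⟨?_, ?_, ?_, ?_, ?_, ?_⟩
      · rw [hS1]; exact hpre.connectedComponentIn a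
      · rw [hS1]; exact isPreconnected_connectedComponentIn
      · rw [hS1]; exact mem_connectedComponentIn haT
      · exact hanti.trans hnW
      · rw [hS1 (n + 1)]
        conv_rhs => rw [hS1 n]
        exact connectedComponentIn_mono a (preimage_mono hanti)
      · intro i
        have h1 : T (T^[i] 0) ∈ S n := by
          rw [← Function.iterate_succ_apply' T]; exact horb (i + 1)
        have h2 := zero_mem _ (h0 i) h1
        rw [hS1, connectedComponentIn_eq h0a, ← connectedComponentIn_eq h2]
        exact mem_connectedComponentIn h1
  have hanti : Antitone S := antitone_nat_of_succ_le fun n => (step n).2.2.2.2.1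
  refine ⟨⋂ n, S n, ?_, isPreconnected_iInter_antitone hanti (fun n => (step n).1)
    fun n => (step n).2.1, fun z hz => (step 0).2.2.2.1 (mem_iInter.1 hz 0), ?_, ?_⟩
  · exact (step 0).1.of_isClosed_subset (isClosed_iInter fun n => (step n).1.isClosed)
      (iInter_subset _ 0)
  · exact mem_iInter.2 fun n => (step n).2.2.2.2.2 0
  · intro z hz
    refine mem_iInter.2 fun n => ?_
    have := mem_iInter.1 hz (n + 1)
    rw [hS1] at this
    exact connectedComponentIn_subset (T ⁻¹' (S n)) a this

theorem isOpenMap_qmap (c : ℂ) : IsOpenMap (qmap c) := by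
  have h : AnalyticOnNhd ℂ (qmap c) univ := fun z _ => by
    unfold qmap
    fun_prop
  rcases h.is_constant_or_isOpen isPreconnected_univ with ⟨w, hw⟩ | h
  · exfalso
    have h0 := hw 0 (mem_univ _)
    have h1 := hw 1 (mem_univ _)
    rw [← h0] at h1
    simp [qmap] at h1
  · exact fun s hs => h s (subset_univ _) hs

theorem isCompact_preimage_qmap {c : ℂ} {S : Set ℂ} (hS : IsCompact S) :
    IsCompact (qmap c ⁻¹' S) := by
  refine Metric.isCompact_of_isClosed_isBounded (hS.isClosed.preimage (continuous_qmap c)) ?_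
  obtain ⟨R, hR⟩ := hS.isBounded.subset_closedBall 0
  refine (Metric.isBounded_closedBall (x := (0 : ℂ)) (r := R + ‖c‖ + 1)).subset fun z hz => ?_
  have h1 := hR hz
  rw [mem_closedBall_zero_iff] at h1 ⊢
  have h2 : ‖z ^ 2‖ ≤ ‖qmap c z‖ + ‖c‖ := by
    have := norm_sub_le (qmap c z) c
    simpa [qmap] using this
  rw [norm_pow] at h2
  nlinarith [sq_nonneg (‖z‖ - 1), norm_nonneg z]

theorem isCompact_preimage_iterate_qmap {c : ℂ} (n : ℕ) {S : Set ℂ} (hS : IsCompact S) :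
    IsCompact ((qmap c)^[n] ⁻¹' S) := by
  induction n with
  | zero => simpa using hS
  | succ n ih =>
    rw [Function.iterate_succ, preimage_comp]
    exact isCompact_preimage_qmap ih

theorem isOpenMap_iterate_qmap (c : ℂ) (n : ℕ) : IsOpenMap (qmap c)^[n] := by
  induction n with
  | zero => exact IsOpenMap.id
  | succ n ih =>
    rw [Function.iterate_succ]
    exact ih.comp (isOpenMap_qmap c)

theorem mem_polyFilledJulia_of_isBounded {c z : ℂ} {S : Set ℂ} (hS : Bornology.IsBounded S) {p : ℕ}
    (hp : 0 < p) (h : ∀ k, (qmap c)^[p * k] z ∈ S) : z ∈ polyFilledJulia c := by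
  intro ht
  obtain ⟨R, hR⟩ := hS.subset_closedBall 0
  have h1 : Tendsto (fun k : ℕ => p * k) atTop atTop := tendsto_id.const_mul_atTop' hp
  obtain ⟨k, hk⟩ := ((ht.comp h1).eventually_gt_atTop R).exists
  have h2 := hR (h k)
  rw [mem_closedBall_zero_iff] at h2
  exact absurd hk (not_lt.2 h2)

namespace IsDividingCycle

variable {c : ℂ} {ψ : ℂ → ℂ} {a : ℂ} {p : ℕ} (D : IsDividingCycle c ψ a p)
include D

/-- Period one is excluded, as only one angle is fixed by doubling. For `p > 1` the fixed point is
both in a closed lateral sector, as its own first image, and outside the open ones. It is then on a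
bounding cut, so it is `a` or `-a`; in the latter case `a` is periodic and mapped to a fixed point.
-/
theorem eq_of_iterate_eq_fixed {x y : Circle} (hxy : IsCriticalPair c ψ a x y) {W : Set ℂ}
    (hW : IsPreconnected W) (haW : a ∈ W)
    (hWp : ∀ z ∈ W, qmap c ((qmap c)^[p] z) ∉ sector ψ (y ^ 2) (x ^ 2) (qmap c a))
    {β : ℂ} (hβ : qmap c β = β) (hβW : β ∈ W) (hK : β ∈ polyFilledJulia c) : β = a := by
  have H := D.bottcher
  have hit : ∀ n, (qmap c)^[n] β = β := fun n => Function.iterate_fixed hβ n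
  have hp1 : 1 < p := by
    rcases Nat.lt_or_ge 1 p with h | h
    · exact h
    · exfalso
      have hp : p = 1 := le_antisymm h D.pos
      have key : ∀ u, RayLands ψ u a → u = 1 := by
        intro u hu
        have := D.period u hu
        rw [hp, pow_one, sq] at this
        exact mul_eq_left.1 this
      exact hxy.pair.ne ((key x hxy.pair.left).trans (key y hxy.pair.right).symm)
  have hcut : β ∈ cut ψ x y a ∨ -β ∈ cut ψ x y a := by
    have h1 := D.qmap_not_mem_sector_of_isPreconnected hxy hW haW hWp hβW
    rw [D.qmap_mem_sector_iff hxy] at h1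
    push Not at h1
    rcases D.iterate_image_lateral hxy hW haW hWp (j := 1) one_pos hp1 with h | h
    · left
      by_contra hc
      have h2 := h β hβW
      rw [hit] at h2
      exact (H.mem_sector_or hxy.pair hc).elim h2 h1.1
    · right
      by_contra hc
      have h2 := h β hβW
      rw [hit] at h2
      exact (H.mem_sector_or hxy.pair hc).elim h2 h1.2
  rcases hcut with h | h
  · exact H.cut_inter h hK
  · have h1 := H.cut_inter h (neg_mem_polyFilledJulia.2 hK)
    have h2 : qmap c a = β := by rw [← h1, qmap_neg, hβ]
    have h3 := D.iterate_period
    obtain ⟨q, rfl⟩ : ∃ q, p = q + 1 := ⟨p - 1, by omega⟩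
    rw [Function.iterate_succ_apply, h2, hit] at h3
    exact h3

/-- The filled Julia set of the renormalization: a continuum containing the critical point,
invariant under `f ^ p`, and containing no point of the backward orbit of a fixed point other than
`a`. -/
theorem exists_renormalization_continuum {Ω W₀ : Set ℂ} (hΩ : IsPreconnected Ω)
    (h0 : (0 : ℂ) ∈ Ω) (ha : a ∈ closure Ω)
    (hR : ∀ z ∈ Ω, ∀ (k : ℕ) s, RayLands ψ s ((qmap c)^[k] a) →
      qmap c z ∉ landedRay ψ s ((qmap c)^[k] a))
    (hb : Bornology.IsBounded Ω) (hW₀ : IsPreconnected W₀) (haW₀ : a ∈ W₀)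
    (hW₀Ω : ∀ z ∈ W₀, (qmap c)^[p] z ∈ closure Ω)
    (horb : ∀ k, (qmap c)^[p * k] 0 ∈ W₀) :
    ∃ x y, IsCriticalPair c ψ a x y ∧
      (∀ k, qmap c ((qmap c)^[p * k] 0) ∉ sector ψ (y ^ 2) (x ^ 2) (qmap c a)) ∧
      ∃ C, IsCompact C ∧ IsPreconnected C ∧ C ⊆ polyFilledJulia c ∧ 0 ∈ C ∧
        MapsTo (qmap c)^[p] C C ∧
        ∀ β, qmap c β = β → β ≠ a → ∀ z ∈ C, ∀ i, (qmap c)^[i] z ≠ β := by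
  have H := D.bottcher
  have hp := D.pos
  obtain ⟨x, y, hxy, hval⟩ := D.exists_isCriticalPair hΩ h0 ha hR
  refine ⟨x, y, hxy, fun k => D.qmap_not_mem_sector_of_isPreconnected hxy hW₀ haW₀
    (fun z hz => hval _ (hW₀Ω z hz)) (horb k), ?_⟩
  obtain ⟨R₁, hR₁⟩ := hb.closure.subset_closedBall 0
  -- Beyond `‖c‖ + 3` the map at least doubles the modulus, so preimages of this ball stay in it.
  -- The compact set `M` contains `closure Ω` and is defined by the critical pair alone.
  set R := max R₁ (‖c‖ + 3) with hRdef
  set M := {z | qmap c z ∉ sector ψ (y ^ 2) (x ^ 2) (qmap c a)} ∩ Metric.closedBall 0 R with hMdef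
  have hMcl : IsClosed {z | qmap c z ∉ sector ψ (y ^ 2) (x ^ 2) (qmap c a)} :=
    (H.isOpen_sector (D.isRayPair_sq hxy).swap).isClosed_compl.preimage (continuous_qmap c)
  have hM : IsCompact M := (isCompact_closedBall (0 : ℂ) R).inter_left hMcl
  have hΩM : closure Ω ⊆ M := fun z hz => ⟨hval z hz,
    Metric.closedBall_subset_closedBall (le_max_left _ _) (hR₁ hz)⟩
  have hball : ∀ n z, (qmap c)^[n] z ∈ Metric.closedBall (0 : ℂ) R →
      z ∈ Metric.closedBall (0 : ℂ) R := by
    intro n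
    induction n with
    | zero => exact fun z hz => hz
    | succ n ih =>
      intro z hz
      have h1 := ih _ hz
      rw [mem_closedBall_zero_iff] at h1 ⊢
      by_contra! h2
      have h3 := two_mul_norm_le_norm_qmap (c := c) (z := z)
        ((le_max_right _ _).trans h2.le)
      have h4 : ‖c‖ + 3 ≤ R := le_max_right _ _
      have h5 := norm_nonneg c
      linarith
  have hcont := (continuous_qmap c).iterate p
  set W := connectedComponentIn ((qmap c)^[p] ⁻¹' M) a with hW
  have hW₀W : W₀ ⊆ W := hW₀.subset_connectedComponentIn haW₀ fun z hz => hΩM (hW₀Ω z hz)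
  have haW : a ∈ W := hW₀W haW₀
  have hWc : IsPreconnected W := isPreconnected_connectedComponentIn
  have hWp : ∀ z ∈ W, (qmap c)^[p] z ∈ M := fun z hz => connectedComponentIn_subset ((qmap c)^[p] ⁻¹' M) a hz
  have hWM : W ⊆ M := fun z hz =>
    ⟨D.qmap_not_mem_sector_of_isPreconnected hxy hWc haW (fun z hz => (hWp z hz).1) hz,
      hball p z (hWp z hz).2⟩
  obtain ⟨C, hCc, hCp, hCW, h0C, hCm⟩ := exists_invariant_continuum hcont
    (isOpenMap_iterate_qmap c p) (fun S => isCompact_preimage_iterate_qmap p) hM D.iterate_period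
    hWM (fun i => by rw [← Function.iterate_mul]; exact hW₀W (horb i)) (fun d hd hd' => by
      have h1 := D.qmap_eq_of_iterate_eq hxy hWc haW (fun z hz => (hWp z hz).1) hd
        (hW₀W (by simpa using horb 0)) hd'
      rcases qmap_eq_iff.1 h1 with h | h <;> simpa using h)
  have hitC : ∀ k, ∀ z ∈ C, (qmap c)^[p * k] z ∈ C := by
    intro k z hz
    rw [Function.iterate_mul]
    exact hCm.iterate k hz
  have hCK : C ⊆ polyFilledJulia c := fun z hz =>
    mem_polyFilledJulia_of_isBounded hCc.isBounded hp fun k => hitC k z hz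
  refine ⟨C, hCc, hCp, hCK, h0C, hCm, fun β hβ hβa z hz i hi => hβa ?_⟩
  have hβC : β ∈ C := by
    have h1 := hitC i z hz
    -- An orbit hitting `β` at time `i` is still at `β` at time `p * i`, when it is in `C`.
    have h2 : p * i = (p * i - i) + i := by
      have : i ≤ p * i := Nat.le_mul_of_pos_left i hp
      omega
    rw [h2, Function.iterate_add_apply, hi, Function.iterate_fixed hβ] at h1
    exact h1
  exact D.eq_of_iterate_eq_fixed hxy hWc haW (fun z hz => (hWp z hz).1) hβ (hCW hβC) (hCK hβC)

end IsDividingCycle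

/-! ### Uniqueness of the Böttcher function -/

theorem eq_one_of_norm_pow_two_pow_sub_one_lt {x : ℂ} (h : ∀ k : ℕ, ‖x ^ 2 ^ k - 1‖ < 1 / 2) :
    x = 1 := by
  by_contra hx
  have h0 : 0 < ‖x - 1‖ := norm_pos_iff.2 (sub_ne_zero.2 hx)
  have key : ∀ k : ℕ, (3 / 2 : ℝ) ^ k * ‖x - 1‖ ≤ ‖x ^ 2 ^ k - 1‖ := by
    intro k
    induction k with
    | zero => simp
    | succ k ih =>
      set y := x ^ 2 ^ k with hy
      -- Squaring expands near `1`: while `y` is within `1 / 2` of `1`, the factor `y + 1` has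
      -- modulus at least `3 / 2`.
      have h1 : x ^ 2 ^ (k + 1) - 1 = (y - 1) * (y + 1) := by
        rw [pow_succ, pow_mul]; ring
      have h2 : (3 / 2 : ℝ) ≤ ‖y + 1‖ := by
        have h3 := norm_sub_le (y + 1) (y - 1)
        have h4 : ‖y + 1 - (y - 1)‖ = 2 := by
          rw [show y + 1 - (y - 1) = 2 by ring]; simp
        have := h k
        linarith
      rw [h1, norm_mul, pow_succ]
      have := norm_nonneg (y - 1)
      nlinarith
  obtain ⟨k, hk⟩ := (((tendsto_pow_atTop_atTop_of_one_lt (by norm_num : (1 : ℝ) < 3 / 2)).atTop_mul_const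
    h0).eventually_gt_atTop (1 / 2)).exists
  linarith [key k, h k]

/-- The Böttcher function is unique. -/
theorem IsBottcherInverse.eqOn {c : ℂ} {ψ₁ ψ₂ : ℂ → ℂ} (H₁ : IsBottcherInverse c ψ₁)
    (H₂ : IsBottcherInverse c ψ₂) : EqOn ψ₁ ψ₂ {w | 1 < ‖w‖} := by
  have hex : ∀ w : ℂ, ∃ w' : ℂ, 1 < ‖w‖ → 1 < ‖w'‖ ∧ ψ₂ w' = ψ₁ w := by
    intro w
    by_cases hw : 1 < ‖w‖
    · obtain ⟨w', h1, h2⟩ := H₂.exists_of_not_mem (H₁.not_mem hw)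
      exact ⟨w', fun _ => ⟨h1, h2⟩⟩
    · exact ⟨0, fun h => absurd h hw⟩
  -- This is `ψ₂⁻¹ ∘ ψ₁`. It commutes with squaring and is asymptotic to the identity, so the
  -- iterated squares of `φ w / w` stay close to `1`.
  choose φ hφ using hex
  have hbig : ∀ R : ℝ, ∀ᶠ w : ℂ in cocompact ℂ, R < ‖w‖ := fun R =>
    (tendsto_norm_cocompact_atTop (E := ℂ)).eventually_gt_atTop R
  have hsq : ∀ w : ℂ, 1 < ‖w‖ → φ (w ^ 2) = φ w ^ 2 := by
    intro w hw
    have hw2 : 1 < ‖w ^ 2‖ := by rw [norm_pow]; exact one_lt_pow₀ hw two_ne_zero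
    have h1 : 1 < ‖φ w ^ 2‖ := by rw [norm_pow]; exact one_lt_pow₀ (hφ w hw).1 two_ne_zero
    refine H₂.inj (hφ _ hw2).1 h1 ?_
    rw [(hφ _ hw2).2, H₁.conj w hw, H₂.conj _ (hφ w hw).1, (hφ w hw).2]
  have hφt : Tendsto φ (cocompact ℂ) (cocompact ℂ) := by
    rw [← Metric.cobounded_eq_cocompact, ← comap_norm_atTop, tendsto_comap_iff, tendsto_atTop,
      comap_norm_atTop, Metric.cobounded_eq_cocompact]
    intro b
    set ρ := max b 2
    have hρ : 1 < ρ := lt_of_lt_of_le one_lt_two (le_max_right _ _)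
    have h1 := H₁.tendsto_cobounded
    have h2 : ∀ᶠ w in cocompact ℂ, ψ₁ w ∉ levelDisk c ψ₂ ρ := by
      have h3 := Bornology.isBounded_def.1 (H₂.isBounded_levelDisk hρ)
      rw [Metric.cobounded_eq_cocompact] at h3
      exact h1 h3
    filter_upwards [h2, hbig 1] with w hw hw1
    rw [← (hφ w hw1).2, H₂.apply_mem_levelDisk_iff (hφ w hw1).1] at hw
    exact (le_max_left _ _).trans (not_lt.1 hw)
  have hg : Tendsto (fun w => φ w / w) (cocompact ℂ) (𝓝 1) := by
    have h1 := H₁.asymptotic.div (H₂.asymptotic.comp hφt) one_ne_zero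
    rw [div_one] at h1
    refine h1.congr' ?_
    filter_upwards [hbig 1, H₁.asymptotic.eventually_ne one_ne_zero] with w hw hne
    have hw0 : w ≠ 0 := norm_pos_iff.1 (one_pos.trans hw)
    have hφ0 : φ w ≠ 0 := norm_pos_iff.1 (one_pos.trans (hφ w hw).1)
    have hψ : ψ₁ w ≠ 0 := fun h => hne (by simp [h])
    simp only [Function.comp, Pi.div_apply, (hφ w hw).2]
    field_simp
  obtain ⟨R, hR1, hR⟩ : ∃ R : ℝ, 1 ≤ R ∧ ∀ w : ℂ, R < ‖w‖ → ‖φ w / w - 1‖ < 1 / 2 := by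
    have h1 := hg.eventually (Metric.ball_mem_nhds (1 : ℂ) (by norm_num : (0 : ℝ) < 1 / 2))
    rw [← Metric.cobounded_eq_cocompact, ← comap_norm_atTop, eventually_comap] at h1
    obtain ⟨R, hR⟩ := eventually_atTop.1 h1
    refine ⟨max R 1, le_max_right _ _, fun w hw => ?_⟩
    have := hR ‖w‖ ((le_max_left _ _).trans hw.le) w rfl
    rwa [dist_eq_norm] at this
  have hfix : ∀ w : ℂ, R < ‖w‖ → ψ₁ w = ψ₂ w := by
    intro w hw
    have hw1 : 1 < ‖w‖ := hR1.trans_lt hw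
    have hw0 : w ≠ 0 := norm_pos_iff.1 (one_pos.trans hw1)
    have hnorm : ∀ k : ℕ, ‖w‖ ≤ ‖w ^ 2 ^ k‖ := fun k => by
      rw [norm_pow]; exact le_self_pow₀ hw1.le (by positivity)
    have hpow : ∀ k : ℕ, φ (w ^ 2 ^ k) = φ w ^ 2 ^ k := by
      intro k
      induction k with
      | zero => simp
      | succ k ih =>
        rw [pow_succ, pow_mul, hsq _ (hw1.trans_le (hnorm k)), ih, ← pow_mul]
    have h1 : φ w / w = 1 := by
      refine eq_one_of_norm_pow_two_pow_sub_one_lt fun k => ?_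
      rw [div_pow, ← hpow]
      exact hR _ (hw.trans_le (hnorm k))
    rw [← (hφ w hw1).2, (div_eq_one_iff_eq hw0).1 h1]
  have hopen : IsOpen {w : ℂ | 1 < ‖w‖} := isOpen_lt continuous_const continuous_norm
  have hR0 : R < ‖((R + 1 : ℝ) : ℂ)‖ := by
    rw [Complex.norm_real, Real.norm_of_nonneg (by linarith)]
    linarith
  refine AnalyticOnNhd.eqOn_of_preconnected_of_eventuallyEq
    (H₁.holomorphic.analyticOnNhd hopen) (H₂.holomorphic.analyticOnNhd hopen)
    (isPreconnected_norm_gt 1) (z₀ := ((R + 1 : ℝ) : ℂ)) (hR1.trans_lt hR0) ?_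
  filter_upwards [(isOpen_lt continuous_const continuous_norm).mem_nhds hR0] with w hw
  exact hfix w hw

/-! ### Iterated preimages under a quadratic-like map -/

namespace QuadraticLike

variable (F : QuadraticLike)

theorem mem_preim_zero {S : Set ℂ} {z : ℂ} : z ∈ F.preim 0 S ↔ z ∈ S := by simp [preim]

theorem mem_preim_succ {S : Set ℂ} {z : ℂ} {n : ℕ} :
    z ∈ F.preim (n + 1) S ↔ z ∈ F.U' ∧ F.toFun z ∈ F.preim n S := by
  constructor
  · rintro ⟨h1, h2⟩
    exact ⟨h1 0 n.succ_pos, fun k hk => h1 (k + 1) (by omega), h2⟩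
  · rintro ⟨h0, h1, h2⟩
    refine ⟨fun k hk => ?_, h2⟩
    cases k with
    | zero => exact h0
    | succ k => exact h1 k (by omega)

theorem mem_preim_one {S : Set ℂ} {z : ℂ} : z ∈ F.preim 1 S ↔ z ∈ F.U' ∧ F.toFun z ∈ S := by
  rw [F.mem_preim_succ, F.mem_preim_zero]

theorem mem_preim_add {S : Set ℂ} {z : ℂ} {m n : ℕ} :
    z ∈ F.preim (m + n) S ↔ z ∈ F.preim m (F.preim n S) := by
  induction m generalizing z with
  | zero => rw [zero_add, mem_preim_zero]
  | succ m ih => rw [Nat.succ_add, mem_preim_succ, mem_preim_succ, ih]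

theorem preim_mono {S T : Set ℂ} (h : S ⊆ T) (n : ℕ) : F.preim n S ⊆ F.preim n T :=
  fun _ hz => ⟨hz.1, h hz.2⟩

theorem preim_subset_of_preim_one_subset {S : Set ℂ} (h : F.preim 1 S ⊆ S) (n : ℕ) :
    F.preim n S ⊆ S := by
  induction n with
  | zero => exact fun z hz => F.mem_preim_zero.1 hz
  | succ n ih => exact fun z hz => h ((F.preim_mono ih 1) (F.mem_preim_add.1 (add_comm n 1 ▸ hz)))

theorem iterate_mem_of_mem_preim {S : Set ℂ} {n k : ℕ} {z : ℂ}
    (hz : z ∈ F.preim n S) (hk : k ≤ n) : F.toFun^[k] z ∈ F.preim (n - k) S := by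
  have h1 : z ∈ F.preim (k + (n - k)) S := by rwa [Nat.add_sub_of_le hk]
  exact (F.mem_preim_add.1 h1).2

theorem toFun_mem_filledJulia_iff {z : ℂ} (hz : z ∈ F.U') :
    F.toFun z ∈ F.filledJulia ↔ z ∈ F.filledJulia := by
  constructor
  · intro h n
    cases n with
    | zero => exact hz
    | succ n => exact h n
  · exact fun h n => h (n + 1)

theorem iterate_mem_filledJulia {z : ℂ} (hz : z ∈ F.filledJulia) (n : ℕ) :
    F.toFun^[n] z ∈ F.filledJulia := by
  intro k
  rw [← Function.iterate_add_apply]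
  exact hz (k + n)

theorem mem_preim_of_mem_filledJulia {z : ℂ} (hz : z ∈ F.filledJulia) {n : ℕ} {S : Set ℂ}
    (h : F.toFun^[n] z ∈ S) : z ∈ F.preim n S := ⟨fun k _ => hz k, h⟩

end QuadraticLike

/-! ### Transfer of rays and equipotentials through the conjugacy -/

namespace PolyConjugacy

variable {F : QuadraticLike} (φ : PolyConjugacy F)

theorem apply_mem_iff {z : ℂ} (hz : z ∈ φ.h.source) :
    φ.h z ∈ polyFilledJulia φ.c ↔ z ∈ F.filledJulia := by
  rw [← φ.image_filledJulia]
  constructor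
  · rintro ⟨y, hy, hyz⟩
    rwa [φ.h.injOn (φ.filledJulia_subset hy) hz hyz] at hy
  · exact fun h => ⟨z, h, rfl⟩

theorem polyFilledJulia_subset : polyFilledJulia φ.c ⊆ φ.h.target := by
  rw [← φ.image_filledJulia]
  rintro _ ⟨z, hz, rfl⟩
  exact φ.h.map_source (φ.filledJulia_subset hz)

theorem apply_toFun {z : ℂ} (hz : z ∈ F.filledJulia) :
    φ.h (F.toFun z) = qmap φ.c (φ.h z) :=
  φ.conj z (φ.filledJulia_subset hz) (hz 0)
    (φ.filledJulia_subset (F.iterate_mem_filledJulia hz 1))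

theorem apply_iterate {z : ℂ} (hz : z ∈ F.filledJulia) (n : ℕ) :
    φ.h (F.toFun^[n] z) = (qmap φ.c)^[n] (φ.h z) := by
  induction n with
  | zero => rfl
  | succ n ih =>
    rw [Function.iterate_succ_apply', Function.iterate_succ_apply', ← ih,
      φ.apply_toFun (F.iterate_mem_filledJulia hz n)]

/-- The point of `K(f)` corresponding to `-h 0` has the same image under `f` as `0`, and `0` is
alone in its fibre. -/
theorem apply_zero (h0 : (0 : ℂ) ∈ F.filledJulia) : φ.h 0 = 0 := by
  have h1 : -φ.h 0 ∈ polyFilledJulia φ.c :=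
    neg_mem_polyFilledJulia.2 ((φ.apply_mem_iff (φ.filledJulia_subset h0)).2 h0)
  rw [← φ.image_filledJulia] at h1
  obtain ⟨z, hz, hz'⟩ := h1
  have h2 : F.toFun z = F.toFun 0 := by
    refine φ.h.injOn (show F.toFun z ∈ _ from
      φ.filledJulia_subset (F.iterate_mem_filledJulia hz 1))
      (show F.toFun 0 ∈ _ from φ.filledJulia_subset (F.iterate_mem_filledJulia h0 1)) ?_
    rw [φ.apply_toFun hz, φ.apply_toFun h0, hz', qmap_neg]
  rw [F.fiber_critical_value z (hz 0) h2] at hz'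
  exact self_eq_neg.1 hz'

theorem GoodLevel.exists_isBottcherInverse {φ : PolyConjugacy F} {ρ : ℝ} (h : φ.GoodLevel ρ) :
    ∃ ψ, IsBottcherInverse φ.c ψ := by
  have h0 : 0 ≤ ρ := (one_pos.trans h.1).le
  have hn : ‖(ρ : ℂ)‖ = ρ := by rw [Complex.norm_real, Real.norm_of_nonneg h0]
  obtain ⟨z, -, ⟨-, -, ψ, hψ, -⟩, -⟩ := h.2 ρ (by rw [hn]; exact h.1) hn.le
  exact ⟨ψ, hψ⟩

section

variable {ψ : ℂ → ℂ} (H : IsBottcherInverse φ.c ψ)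
include H

theorem hasCoord_iff {w z : ℂ} :
    φ.HasCoord w z ↔ z ∈ φ.h.source ∧ 1 < ‖w‖ ∧ ψ w = φ.h z := by
  constructor
  · rintro ⟨h1, h2, ψ', hψ', h3⟩
    exact ⟨h1, h2, (H.eqOn hψ' h2).trans h3⟩
  · rintro ⟨h1, h2, h3⟩
    exact ⟨h1, h2, ψ, H, h3⟩

theorem mem_ray_iff {u : Circle} {z : ℂ} :
    z ∈ φ.ray u ↔ z ∈ φ.h.source ∧ ∃ r : ℝ, 1 < r ∧ φ.h z = ψ (r * u) := by
  constructor
  · rintro ⟨r, hr, hz⟩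
    obtain ⟨h1, h2, h3⟩ := (φ.hasCoord_iff H).1 hz
    exact ⟨h1, r, hr, h3.symm⟩
  · rintro ⟨h1, r, hr, h2⟩
    refine ⟨r, hr, (φ.hasCoord_iff H).2 ⟨h1, ?_, h2.symm⟩⟩
    rwa [norm_real_mul_circle (by linarith)]

theorem mem_disk_iff {ρ : ℝ} {z : ℂ} :
    z ∈ φ.disk ρ ↔ z ∈ φ.h.source ∧ φ.h z ∈ levelDisk φ.c ψ ρ := by
  constructor
  · rintro (hz | ⟨w, hw, hz⟩)
    · have h1 := φ.filledJulia_subset hz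
      exact ⟨h1, Or.inl ((φ.apply_mem_iff h1).2 hz)⟩
    · obtain ⟨h1, h2, h3⟩ := (φ.hasCoord_iff H).1 hz
      exact ⟨h1, Or.inr ⟨w, ⟨h2, hw⟩, h3⟩⟩
  · rintro ⟨h1, h2 | ⟨w, ⟨hw1, hw⟩, hz⟩⟩
    · exact Or.inl ((φ.apply_mem_iff h1).1 h2)
    · exact Or.inr ⟨w, hw, (φ.hasCoord_iff H).2 ⟨h1, hw1, hz⟩⟩

theorem lands_iff {u : Circle} {b : ℂ} (hb : b ∈ φ.h.source) :
    φ.Lands u b ↔ RayLands ψ u (φ.h b) := by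
  constructor
  · intro h
    refine tendsto_nhds.2 fun N hN hbN => ?_
    have h1 := h _ (inter_mem (φ.h.open_source.mem_nhds hb)
      ((φ.h.continuousAt hb).preimage_mem_nhds (hN.mem_nhds hbN)))
    filter_upwards [h1] with r hr
    obtain ⟨z, hz, hc⟩ := hr
    rw [mem_preimage, ((φ.hasCoord_iff H).1 hc).2.2]
    exact hz.2
  · intro h N hN
    have h1 : φ.h.target ∩ φ.h.symm ⁻¹' N ∈ 𝓝 (φ.h b) := by
      refine inter_mem (φ.h.open_target.mem_nhds (φ.h.map_source hb))
        ((φ.h.continuousAt_symm (φ.h.map_source hb)).preimage_mem_nhds ?_)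
      rwa [φ.h.left_inv hb]
    filter_upwards [h h1, self_mem_nhdsWithin] with r hr hr1
    refine ⟨_, hr.2, (φ.hasCoord_iff H).2 ⟨φ.h.map_target hr.1, ?_, (φ.h.right_inv hr.1).symm⟩⟩
    rw [norm_real_mul_circle (one_pos.trans hr1).le]
    exact hr1

theorem mem_rays_iff {A : Set ℂ} (hA : A ⊆ φ.h.source)
    (hdiv : ∀ b ∈ A, φ.IsDividing b) {z : ℂ} (hz : z ∈ φ.h.source) :
    z ∈ φ.rays A ↔ ∃ b ∈ A, ∃ u, RayLands ψ u (φ.h b) ∧ φ.h z ∈ landedRay ψ u (φ.h b) := by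
  constructor
  · rintro (hzA | ⟨b, hb, u, hu, hzu⟩)
    · obtain ⟨u, -, -, hu, -⟩ := hdiv z hzA
      exact ⟨z, hzA, u, (φ.lands_iff H hz).1 hu, Or.inl rfl⟩
    · exact ⟨b, hb, u, (φ.lands_iff H (hA hb)).1 hu, Or.inr ((φ.mem_ray_iff H).1 hzu).2⟩
  · rintro ⟨b, hb, u, hu, h | h⟩
    · rw [φ.h.injOn hz (hA hb) h]
      exact Or.inl hb
    · exact Or.inr ⟨b, hb, u, (φ.lands_iff H (hA hb)).2 hu, (φ.mem_ray_iff H).2 ⟨hz, h⟩⟩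

theorem isDividing_iff {b : ℂ} (hb : b ∈ φ.h.source) :
    φ.IsDividing b ↔ ∃ u v, IsRayPair ψ u v (φ.h b) := by
  constructor
  · rintro ⟨u, v, hne, hu, hv⟩
    exact ⟨u, v, hne, (φ.lands_iff H hb).1 hu, (φ.lands_iff H hb).1 hv⟩
  · rintro ⟨u, v, hne, hu, hv⟩
    exact ⟨u, v, hne, (φ.lands_iff H hb).2 hu, (φ.lands_iff H hb).2 hv⟩

end

/-- The compact domain bounded by the equipotential of level `ρ`. -/
def closedDisk (ψ : ℂ → ℂ) (ρ : ℝ) : Set ℂ :=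
  {z | z ∈ φ.h.source ∧ φ.h z ∈ closedLevelDisk φ.c ψ ρ}

section

variable {ψ : ℂ → ℂ} (H : IsBottcherInverse φ.c ψ) {ρ : ℝ} (hρ : φ.GoodLevel ρ)
include H hρ

theorem level_spec {w : ℂ} (hw : 1 < ‖w‖) (hwρ : ‖w‖ ≤ ρ) :
    ∃ z ∈ F.U', z ∈ φ.h.source ∧ φ.h z = ψ w ∧ F.toFun z ∈ φ.h.source ∧
      φ.h (F.toFun z) = ψ (w ^ 2) := by
  obtain ⟨z, hz, h1, h2⟩ := hρ.2 w hw hwρ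
  rw [φ.hasCoord_iff H] at h1 h2
  exact ⟨z, hz, h1.1, h1.2.2.symm, h2.1, h2.2.2.symm⟩

theorem closedLevelDisk_subset : closedLevelDisk φ.c ψ ρ ⊆ φ.h.target := by
  rintro _ (h | ⟨w, ⟨hw, hwρ⟩, rfl⟩)
  · exact φ.polyFilledJulia_subset h
  · obtain ⟨z, -, hz, h, -⟩ := φ.level_spec H hρ hw hwρ
    rw [← h]
    exact φ.h.map_source hz

theorem isCompact_closedDisk : IsCompact (φ.closedDisk ψ ρ) := by
  have h1 : φ.closedDisk ψ ρ = φ.h.symm '' closedLevelDisk φ.c ψ ρ := by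
    ext z
    constructor
    · rintro ⟨h1, h2⟩
      exact ⟨_, h2, φ.h.left_inv h1⟩
    · rintro ⟨w, hw, rfl⟩
      have h2 := φ.closedLevelDisk_subset H hρ hw
      refine ⟨φ.h.map_target h2, ?_⟩
      rwa [φ.h.right_inv h2]
  rw [h1]
  exact (H.isCompact_closedLevelDisk hρ.1).image_of_continuousOn
    (φ.h.continuousOn_symm.mono (φ.closedLevelDisk_subset H hρ))

theorem closedDisk_spec {z : ℂ} (hz : z ∈ φ.closedDisk ψ ρ) :
    z ∈ F.U' ∧ F.toFun z ∈ φ.h.source ∧ φ.h (F.toFun z) = qmap φ.c (φ.h z) := by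
  obtain ⟨hs, h | ⟨w, ⟨hw, hwρ⟩, hz⟩⟩ := hz
  · have h1 := (φ.apply_mem_iff hs).1 h
    exact ⟨h1 0, φ.filledJulia_subset (F.iterate_mem_filledJulia h1 1), φ.apply_toFun h1⟩
  · obtain ⟨y, hyU, hys, hy, h2, h3⟩ := φ.level_spec H hρ hw hwρ
    obtain rfl : y = z := φ.h.injOn hys hs (hy.trans hz)
    exact ⟨hyU, h2, by rw [h3, hy, H.qmap_apply hw]⟩

omit hρ in
theorem disk_subset_closedDisk : φ.disk ρ ⊆ φ.closedDisk ψ ρ := by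
  intro z hz
  obtain ⟨h1, h2⟩ := (φ.mem_disk_iff H).1 hz
  refine ⟨h1, h2.imp_right ?_⟩
  rintro ⟨w, hw, h⟩
  exact ⟨w, ⟨hw.1, hw.2.le⟩, h⟩

/-- Outside `K(f)`, the two square roots of the external coordinate of `f z` are realized by points
below the equipotential, and these two points exhaust the fibre of the degree-two map. -/
theorem preim_one_closedDisk_subset : F.preim 1 (φ.closedDisk ψ ρ) ⊆ φ.closedDisk ψ ρ := by
  intro z hz
  obtain ⟨hzU, hs, h⟩ := F.mem_preim_one.1 hz
  by_cases hK : F.toFun z ∈ F.filledJulia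
  · have h1 := (F.toFun_mem_filledJulia_iff hzU).1 hK
    have h2 := φ.filledJulia_subset h1
    exact ⟨h2, Or.inl ((φ.apply_mem_iff h2).2 h1)⟩
  obtain ⟨w, ⟨hw, hwρ⟩, hwz⟩ := h.resolve_left (mt (φ.apply_mem_iff hs).1 hK)
  obtain ⟨v, hv⟩ : ∃ v : ℂ, w = v ^ 2 := by
    obtain ⟨v, hv⟩ := IsAlgClosed.exists_pow_nat_eq w two_pos
    exact ⟨v, hv.symm⟩
  have hvw : ‖w‖ = ‖v‖ ^ 2 := by rw [hv, norm_pow]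
  have hv1 : 1 < ‖v‖ := by
    by_contra! h
    have := pow_le_one₀ (norm_nonneg v) h (n := 2)
    linarith
  have hvρ : ‖v‖ ≤ ρ := by nlinarith
  obtain ⟨z₁, hU₁, hs₁, h₁, hfs₁, hf₁⟩ := φ.level_spec H hρ hv1 hvρ
  have hn : ‖-v‖ = ‖v‖ := norm_neg v
  obtain ⟨z₂, hU₂, hs₂, h₂, hfs₂, hf₂⟩ := φ.level_spec H hρ (w := -v) (hn ▸ hv1) (hn ▸ hvρ)
  rw [neg_sq, ← hv, hwz] at hf₂
  rw [← hv, hwz] at hf₁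
  have e₁ := φ.h.injOn hfs₁ hs hf₁
  have e₂ := φ.h.injOn hfs₂ hs hf₂
  have hv0 : v ≠ 0 := norm_pos_iff.1 (one_pos.trans hv1)
  have hne : z₁ ≠ z₂ := by
    rintro rfl
    have h5 := H.inj hv1 (hn ▸ hv1) (h₁.symm.trans h₂)
    exact hv0 (self_eq_neg.1 h5)
  have hcrit : F.toFun z ≠ F.toFun 0 := fun e =>
    hne ((F.fiber_critical_value _ hU₁ (e₁.trans e)).trans
      (F.fiber_critical_value _ hU₂ (e₂.trans e)).symm)
  have hcard := F.fiber _ (F.mapsTo hzU) hcrit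
  have hfin : {y | y ∈ F.U' ∧ F.toFun y = F.toFun z}.Finite :=
    finite_of_ncard_ne_zero (by rw [hcard]; exact two_ne_zero)
  have heq : ({z₁, z₂} : Set ℂ) = {y | y ∈ F.U' ∧ F.toFun y = F.toFun z} := by
    refine eq_of_subset_of_ncard_le ?_ ?_ hfin
    · rintro y (rfl | rfl)
      · exact ⟨hU₁, e₁⟩
      · exact ⟨hU₂, e₂⟩
    · rw [hcard, ncard_pair hne]
  have hz' : z ∈ ({z₁, z₂} : Set ℂ) := by rw [heq]; exact ⟨hzU, rfl⟩
  rcases hz' with rfl | rfl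
  · exact ⟨hs₁, Or.inr ⟨v, ⟨hv1, hvρ⟩, h₁.symm⟩⟩
  · exact ⟨hs₂, Or.inr ⟨-v, ⟨hn ▸ hv1, hn ▸ hvρ⟩, h₂.symm⟩⟩

theorem preim_one_disk_subset : F.preim 1 (φ.disk ρ) ⊆ φ.disk ρ := by
  intro z hz
  have h1 := φ.preim_one_closedDisk_subset H hρ
    (F.preim_mono (φ.disk_subset_closedDisk H) 1 hz)
  have h2 := ((φ.mem_disk_iff H).1 (F.mem_preim_one.1 hz).2).2
  rw [(φ.closedDisk_spec H hρ h1).2.2] at h2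
  rw [φ.mem_disk_iff H]
  refine ⟨h1.1, h1.2.imp_right ?_⟩
  rintro ⟨w, ⟨hw, -⟩, hwz⟩
  have hw2 : 1 < ‖w ^ 2‖ := by rw [norm_pow]; exact one_lt_pow₀ hw two_ne_zero
  rw [← hwz, H.qmap_apply hw, H.apply_mem_levelDisk_iff hw2, norm_pow] at h2
  exact ⟨w, ⟨hw, by nlinarith⟩, hwz⟩

theorem apply_iterate_of_mem_preim {n : ℕ} {z : ℂ} (hz : z ∈ F.preim n (φ.closedDisk ψ ρ)) {k : ℕ}
    (hk : k ≤ n) : F.toFun^[k] z ∈ φ.closedDisk ψ ρ ∧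
      φ.h (F.toFun^[k] z) = (qmap φ.c)^[k] (φ.h z) := by
  have hsub := φ.preim_one_closedDisk_subset H hρ
  have hmem : ∀ k ≤ n, F.toFun^[k] z ∈ φ.closedDisk ψ ρ := fun k hk =>
    F.preim_subset_of_preim_one_subset hsub _ (F.iterate_mem_of_mem_preim hz hk)
  refine ⟨hmem k hk, ?_⟩
  induction k with
  | zero => rfl
  | succ k ih =>
    rw [Function.iterate_succ_apply', Function.iterate_succ_apply', ← ih (by omega)]
    exact (φ.closedDisk_spec H hρ (hmem k (by omega))).2.2

end

end PolyConjugacy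

/-! ### Renormalization in the plane of the polynomial -/

namespace PolyConjugacy

variable {F : QuadraticLike} (φ : PolyConjugacy F)

/-- The data given by a dividing cycle, in the dynamical plane of the polynomial. -/
theorem isDividingCycle {ψ : ℂ → ℂ} (H : IsBottcherInverse φ.c ψ) {a : ℂ} (haK : a ∈ F.filledJulia)
    (hdiv : ∀ k : ℕ, φ.IsDividing (F.toFun^[k] a)) (hp : 0 < φ.rayPeriod a)
    (h0 : (0 : ℂ) ∈ F.filledJulia) (hne : ∀ k : ℕ, F.toFun 0 ≠ F.toFun^[k] a) :
    IsDividingCycle φ.c ψ (φ.h a) (φ.rayPeriod a) := by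
  have haS := φ.filledJulia_subset haK
  have hit := F.iterate_mem_filledJulia haK
  refine ⟨H, hp, fun k => ?_, fun u hu => ?_, fun m hm hu => ?_, fun k => ?_, ?_⟩
  · rw [← φ.apply_iterate haK]
    exact (φ.isDividing_iff H (φ.filledJulia_subset (hit k))).1 (hdiv k)
  · have h1 := Nat.sInf_mem (Nat.nonempty_of_pos_sInf hp)
    exact h1.2 u ((φ.lands_iff H haS).2 hu)
  · exact Nat.sInf_le ⟨hm, fun u h => hu u ((φ.lands_iff H haS).1 h)⟩
  · rw [← φ.apply_iterate haK, ← φ.apply_zero h0, ← φ.apply_toFun h0]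
    intro h
    exact hne k (φ.h.injOn (show F.toFun 0 ∈ φ.h.source from
      φ.filledJulia_subset (F.iterate_mem_filledJulia h0 1)) (φ.filledJulia_subset (hit k)) h)
  · rw [← φ.apply_zero h0]
    exact (φ.apply_mem_iff (φ.filledJulia_subset h0)).2 h0

theorem exists_renormalization {ψ : ℂ → ℂ} (H : IsBottcherInverse φ.c ψ)
    (hren : φ.IsDHRenormalizable) :
    ∃ a ∈ F.filledJulia, (0 : ℂ) ∈ F.filledJulia ∧
      IsDividingCycle φ.c ψ (φ.h a) (φ.rayPeriod a) ∧
      ∃ x y, IsCriticalPair φ.c ψ (φ.h a) x y ∧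
        (∀ k, qmap φ.c ((qmap φ.c)^[φ.rayPeriod a * k] 0) ∉
          sector ψ (y ^ 2) (x ^ 2) (qmap φ.c (φ.h a))) ∧
        ∃ C, IsCompact C ∧ IsPreconnected C ∧ C ⊆ polyFilledJulia φ.c ∧ 0 ∈ C ∧
          MapsTo (qmap φ.c)^[φ.rayPeriod a] C C ∧
          ∀ β, qmap φ.c β = β → β ≠ φ.h a → ∀ z ∈ C, ∀ i, (qmap φ.c)^[i] z ≠ β := by
  obtain ⟨ρ, a, hρ, haK, -, -, hdiv, hafr, hp, h0D, horb⟩ := hren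
  set p := φ.rayPeriod a with hpdef
  set A := {b | ∃ k : ℕ, b = F.toFun^[k] a} with hA
  set Ω := φ.renormRange ρ a with hΩ
  have haS := φ.filledJulia_subset haK
  have hit := F.iterate_mem_filledJulia haK
  have hAS : A ⊆ φ.h.source := by
    rintro _ ⟨k, rfl⟩
    exact φ.filledJulia_subset (hit k)
  have hAdiv : ∀ b ∈ A, φ.IsDividing b := by
    rintro _ ⟨k, rfl⟩
    exact hdiv k
  have haΩ : a ∈ closure Ω := frontier_subset_closure hafr
  have hΩsub : Ω ⊆ φ.disk ρ \ F.preim 1 (φ.rays A) := connectedComponentIn_subset _ _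
  have hΩdisk : Ω ⊆ φ.closedDisk ψ ρ := fun z hz => φ.disk_subset_closedDisk H (hΩsub hz).1
  have h0Ω : (0 : ℂ) ∈ Ω := by
    have h1 : Ω.Nonempty := closure_nonempty_iff.1 ⟨a, haΩ⟩
    exact mem_connectedComponentIn (connectedComponentIn_nonempty_iff.1 h1)
  have hcl : closure Ω ⊆ φ.closedDisk ψ ρ :=
    closure_minimal hΩdisk (φ.isCompact_closedDisk H hρ).isClosed
  have hDsub : φ.renormDomain ρ a ⊆ F.preim p (closure Ω) := connectedComponentIn_subset _ _
  have hDdisk : ∀ z ∈ φ.renormDomain ρ a, z ∈ F.preim p (φ.closedDisk ψ ρ) := fun z hz =>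
    F.preim_mono hcl p (hDsub hz)
  have h0K : (0 : ℂ) ∈ F.filledJulia := by
    intro n
    -- Between two consecutive multiples of `p` the orbit stays in `U'`, because the iterates up to
    -- time `p` are defined on the renormalization domain.
    have h1 := (hDsub (horb (n / p))).1 (n % p) (Nat.mod_lt _ hp)
    rwa [← Function.iterate_add_apply, Nat.mod_add_div] at h1
  have hne : ∀ k : ℕ, F.toFun 0 ≠ F.toFun^[k] a := by
    intro k hk
    refine (hΩsub h0Ω).2 (F.mem_preim_one.2 ⟨F.zero_mem, ?_⟩)
    exact Or.inl ⟨k, hk⟩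
  have D := φ.isDividingCycle H haK hdiv hp h0K hne
  have hcont : ContinuousOn φ.h (φ.closedDisk ψ ρ) := φ.h.continuousOn.mono fun z hz => hz.1
  have hh0 := φ.apply_zero h0K
  refine ⟨a, haK, h0K, D, ?_⟩
  refine D.exists_renormalization_continuum (Ω := φ.h '' Ω) (W₀ := φ.h '' φ.renormDomain ρ a)
    ?_ ?_ ?_ ?_ ?_ ?_ ?_ ?_ ?_
  · exact isPreconnected_connectedComponentIn.image _ (hcont.mono hΩdisk)
  · exact ⟨0, h0Ω, hh0⟩
  · exact mem_closure_image (φ.h.continuousAt haS) haΩ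
  · rintro _ ⟨z, hz, rfl⟩ k s hs hmem
    obtain ⟨hzU, hzS, hz'⟩ := φ.closedDisk_spec H hρ (hΩdisk hz)
    rw [← φ.apply_iterate haK] at hs hmem
    rw [← hz'] at hmem
    exact (hΩsub hz).2 (F.mem_preim_one.2 ⟨hzU,
      (φ.mem_rays_iff H hAS hAdiv hzS).2 ⟨_, ⟨k, rfl⟩, s, hs, hmem⟩⟩)
  · refine (H.isBounded_levelDisk hρ.1).subset ?_
    rintro _ ⟨z, hz, rfl⟩
    exact ((φ.mem_disk_iff H).1 (hΩsub hz).1).2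
  · refine isPreconnected_connectedComponentIn.image _ (hcont.mono fun z hz => ?_)
    exact (φ.apply_iterate_of_mem_preim H hρ (hDdisk z hz) (Nat.zero_le _)).1
  · refine ⟨a, ?_, rfl⟩
    exact mem_connectedComponentIn (connectedComponentIn_nonempty_iff.1 ⟨0, h0D⟩)
  · rintro _ ⟨z, hz, rfl⟩
    rw [← (φ.apply_iterate_of_mem_preim H hρ (hDdisk z hz) le_rfl).2]
    exact (hcont.mono hcl).image_closure ⟨_, (hDsub hz).2, rfl⟩
  · intro k
    exact ⟨_, horb k, by rw [φ.apply_iterate h0K, hh0]⟩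

end PolyConjugacy

/-! ### Components of preimages and pull-backs -/

namespace QuadraticLike

variable (F : QuadraticLike)

theorem continuousOn_toFun : ContinuousOn F.toFun F.U' := F.holomorphic.continuousOn

theorem U'_subset_U : F.U' ⊆ F.U := subset_closure.trans F.closure_U'_subset

theorem isOpen_preim {S : Set ℂ} (hS : IsOpen S) (n : ℕ) : IsOpen (F.preim n S) := by
  induction n with
  | zero => simpa [preim] using hS
  | succ n ih =>
    have : F.preim (n + 1) S = F.U' ∩ F.toFun ⁻¹' F.preim n S := by
      ext z
      exact F.mem_preim_succ
    rw [this]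
    exact F.continuousOn_toFun.isOpen_inter_preimage F.isOpen_U' ih

theorem preim_subset_U {S : Set ℂ} (hS : S ⊆ F.U) (n : ℕ) : F.preim n S ⊆ F.U := by
  intro z hz
  cases n with
  | zero => exact hS (F.mem_preim_zero.1 hz)
  | succ n => exact F.U'_subset_U (F.mem_preim_succ.1 hz).1

theorem isCompact_preim {S : Set ℂ} (hS : IsCompact S) (hSU : S ⊆ F.U) (n : ℕ) :
    IsCompact (F.preim n S) := by
  induction n with
  | zero => simpa [preim] using hS
  | succ n ih =>
    have : F.preim (n + 1) S = F.U' ∩ F.toFun ⁻¹' F.preim n S := by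
      ext z
      exact F.mem_preim_succ
    rw [this]
    exact F.proper _ (F.preim_subset_U hSU n) ih

theorem continuousOn_iterate (n : ℕ) (S : Set ℂ) : ContinuousOn F.toFun^[n] (F.preim n S) := by
  induction n with
  | zero => exact continuousOn_id
  | succ n ih =>
    rw [Function.iterate_succ]
    exact ih.comp (F.continuousOn_toFun.mono fun z hz => (F.mem_preim_succ.1 hz).1)
      fun z hz => (F.mem_preim_succ.1 hz).2

theorem isOpen_image {O : Set ℂ} (hO : IsOpen O) (hOU : O ⊆ F.U') : IsOpen (F.toFun '' O) := by
  have hconn : IsPreconnected F.U' :=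
    F.simplyConnected_U'.isPathConnected.isConnected.isPreconnected
  rcases (F.holomorphic.analyticOnNhd F.isOpen_U').is_constant_or_isOpen hconn with ⟨w, hw⟩ | h
  · exfalso
    have h1 : F.U' = {0} := by
      refine eq_singleton_iff_unique_mem.2 ⟨F.zero_mem, fun z hz => ?_⟩
      exact F.fiber_critical_value z hz ((hw z hz).trans (hw 0 F.zero_mem).symm)
    exact not_isOpen_singleton (0 : ℂ) (h1 ▸ F.isOpen_U')
  · exact h O hOU hO

theorem isOpen_image_iterate {O S : Set ℂ} (hO : IsOpen O) {n : ℕ} (hOS : O ⊆ F.preim n S) :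
    IsOpen (F.toFun^[n] '' O) := by
  induction n generalizing O with
  | zero => simpa using hO
  | succ n ih =>
    rw [Function.iterate_succ, image_comp]
    refine ih (F.isOpen_image hO fun z hz => (F.mem_preim_succ.1 (hOS hz)).1) ?_
    rintro _ ⟨z, hz, rfl⟩
    exact (F.mem_preim_succ.1 (hOS hz)).2

/-- Taking components of preimages is compatible with iteration. -/
theorem connectedComponentIn_preim (G : Set ℂ) (n : ℕ) (z : ℂ) :
    connectedComponentIn (F.preim n (connectedComponentIn G (F.toFun^[n] z))) z =
      connectedComponentIn (F.preim n G) z := by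
  by_cases hz : z ∈ F.preim n G
  · refine Subset.antisymm
      (connectedComponentIn_mono z (F.preim_mono (connectedComponentIn_subset _ _) n)) ?_
    have hsub := connectedComponentIn_subset (F.preim n G) z
    refine isPreconnected_connectedComponentIn.subset_connectedComponentIn
      (mem_connectedComponentIn hz) fun y hy => ⟨(hsub hy).1, ?_⟩
    have h1 := isPreconnected_connectedComponentIn.image F.toFun^[n]
      ((F.continuousOn_iterate n G).mono hsub)
    refine h1.subset_connectedComponentIn ⟨z, mem_connectedComponentIn hz, rfl⟩ ?_ ⟨y, hy, rfl⟩
    rintro _ ⟨w, hw, rfl⟩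
    exact (hsub hw).2
  · rw [connectedComponentIn_eq_empty hz, connectedComponentIn_eq_empty]
    exact fun h => hz (F.preim_mono (connectedComponentIn_subset _ _) n h)

/-- The image of the component is open, and by properness it is closed in the connected set `W`. -/
theorem image_connectedComponentIn_preim_one {W : Set ℂ} (hW : IsOpen W) (hWc : IsPreconnected W)
    (hWU : W ⊆ F.U) {z : ℂ} (hz : z ∈ F.preim 1 W) :
    F.toFun '' connectedComponentIn (F.preim 1 W) z = W := by
  set O := connectedComponentIn (F.preim 1 W) z with hO
  have hsub : O ⊆ F.preim 1 W := connectedComponentIn_subset _ _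
  have hOo : IsOpen O := (F.isOpen_preim hW 1).connectedComponentIn
  have hOU : O ⊆ F.U' := fun y hy => (F.mem_preim_one.1 (hsub hy)).1
  refine Subset.antisymm ?_ ?_
  · rintro _ ⟨y, hy, rfl⟩
    exact (F.mem_preim_one.1 (hsub hy)).2
  refine hWc.subset_of_closure_inter_subset (F.isOpen_image hOo hOU)
    ⟨F.toFun z, (F.mem_preim_one.1 hz).2, z, mem_connectedComponentIn hz, rfl⟩ ?_
  rintro y ⟨hy, hyW⟩
  obtain ⟨B, hBc, hB, hBW'⟩ := exists_compact_subset hW hyW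
  set S := closure O ∩ (F.U' ∩ F.toFun ⁻¹' B) with hS
  have hSc : IsCompact S := (F.proper B (hBW'.trans hWU) hBc).inter_left isClosed_closure
  have hSO : S ⊆ O := fun x hx => closure_connectedComponentIn_inter_subset _ _
    ⟨hx.1, F.mem_preim_one.2 ⟨hx.2.1, hBW' hx.2.2⟩⟩
  have hScl : IsClosed (F.toFun '' S) :=
    (hSc.image_of_continuousOn (F.continuousOn_toFun.mono fun x hx => hx.2.1)).isClosed
  have h1 : F.toFun '' O ∩ interior B ⊆ F.toFun '' S := by
    rintro _ ⟨⟨x, hx, rfl⟩, hxB⟩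
    exact ⟨x, ⟨subset_closure hx, hOU hx, show F.toFun x ∈ B from interior_subset hxB⟩, rfl⟩
  refine image_mono hSO (closure_minimal h1 hScl ?_)
  rw [inter_comm]
  exact isOpen_interior.inter_closure ⟨hB, hy⟩

theorem image_connectedComponentIn_preim {W : Set ℂ} (hW : IsOpen W) (hWc : IsPreconnected W)
    (hWU : W ⊆ F.U) (n : ℕ) {z : ℂ} (hz : z ∈ F.preim n W) :
    F.toFun^[n] '' connectedComponentIn (F.preim n W) z = W := by
  induction n generalizing z with
  | zero =>
    have h0 : F.preim 0 W = W := ext fun _ => F.mem_preim_zero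
    rw [h0] at hz ⊢
    rw [Function.iterate_zero, image_id]
    exact Subset.antisymm (connectedComponentIn_subset _ _)
      (hWc.subset_connectedComponentIn hz Subset.rfl)
  | succ n ih =>
    obtain ⟨hzU, hz'⟩ := F.mem_preim_succ.1 hz
    have h1 : F.preim (n + 1) W = F.preim 1 (F.preim n W) := by
      ext y
      rw [add_comm, F.mem_preim_add]
    rw [Function.iterate_succ, image_comp, h1, ← F.connectedComponentIn_preim (F.preim n W) 1 z,
      Function.iterate_one, F.image_connectedComponentIn_preim_one ((F.isOpen_preim hW n).connectedComponentIn)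
        isPreconnected_connectedComponentIn
        ((connectedComponentIn_subset _ _).trans (F.preim_subset_U hWU n))
        (F.mem_preim_one.2 ⟨hzU, mem_connectedComponentIn hz'⟩)]
    exact ih hz'

theorem finite_preim_singleton (n : ℕ) (w : ℂ) : (F.preim n {w}).Finite := by
  have h1 : ∀ w, (F.preim 1 {w}).Finite := by
    intro w
    have heq : F.preim 1 {w} = {z | z ∈ F.U' ∧ F.toFun z = w} := by
      ext z
      exact F.mem_preim_one
    rw [heq]
    by_cases hw : w ∈ F.U
    · by_cases h0 : w = F.toFun 0
      · refine (finite_singleton (0 : ℂ)).subset ?_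
        rintro z ⟨hz, hz'⟩
        exact F.fiber_critical_value z hz (hz'.trans h0)
      · exact finite_of_ncard_ne_zero (by rw [F.fiber w hw h0]; exact two_ne_zero)
    · refine finite_empty.subset ?_
      rintro z ⟨hz, rfl⟩
      exact hw (F.mapsTo hz)
  induction n with
  | zero => simp [preim]
  | succ n ih =>
    refine (ih.biUnion fun y _ => h1 y).subset fun z hz => ?_
    obtain ⟨h2, h3⟩ := F.mem_preim_succ.1 hz
    exact mem_biUnion h3 (F.mem_preim_one.2 ⟨h2, rfl⟩)

theorem pullBack_subset_preim {W : Set ℂ} (hW : IsCompact W) (hWU : W ⊆ F.U) (l : ℕ) (z : ℂ) :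
    F.pullBack W l z ⊆ F.preim l W :=
  closure_minimal ((connectedComponentIn_subset _ _).trans (F.preim_mono interior_subset l))
    (F.isCompact_preim hW hWU l).isClosed

/-- Taking the closure adds no interior points: `f^l` is open, so it maps interior points of the
pull-back into `int W`, and a component is relatively closed in the preimage. -/
theorem interior_pullBack {W : Set ℂ} (hW : IsCompact W) (hWU : W ⊆ F.U) (l : ℕ) (z : ℂ) :
    interior (F.pullBack W l z) = connectedComponentIn (F.preim l (interior W)) z := by
  refine Subset.antisymm (fun x hx => ?_) (interior_maximal subset_closure
    (F.isOpen_preim isOpen_interior l).connectedComponentIn)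
  have hsub := F.pullBack_subset_preim hW hWU l z
  refine closure_connectedComponentIn_inter_subset _ _
    ⟨interior_subset hx, (hsub (interior_subset hx)).1, ?_⟩
  have h1 : IsOpen (F.toFun^[l] '' interior (F.pullBack W l z)) :=
    F.isOpen_image_iterate isOpen_interior (interior_subset.trans hsub)
  refine interior_maximal ?_ h1 ⟨x, hx, rfl⟩
  rintro _ ⟨y, hy, rfl⟩
  exact (hsub (interior_subset hy)).2

end QuadraticLike

/-! ### Interiors of the puzzle pieces -/

namespace IsBottcherInverse

variable {c : ℂ} {ψ : ℂ → ℂ} (H : IsBottcherInverse c ψ)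
include H

theorem interior_closedLevelDisk_subset (ρ : ℝ) :
    interior (closedLevelDisk c ψ ρ) ⊆ levelDisk c ψ ρ := by
  intro z hz
  obtain h | ⟨w, ⟨hw, hwρ⟩, rfl⟩ := interior_subset hz
  · exact Or.inl h
  refine Or.inr ⟨w, ⟨hw, lt_of_le_of_ne hwρ fun hρ => ?_⟩, rfl⟩
  have hcont : ContinuousAt (fun t : ℝ => ψ (t * w)) 1 := by
    have h1 : ContinuousAt ψ (((1 : ℝ) : ℂ) * w) := by
      simpa using H.continuousAt hw
    exact ContinuousAt.comp (f := fun t : ℝ => (t : ℂ) * w) h1 (by fun_prop)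
  have h1 : ∀ᶠ t : ℝ in 𝓝[>] 1, ψ (t * w) ∈ closedLevelDisk c ψ ρ := by
    have h2 : closedLevelDisk c ψ ρ ∈ 𝓝 (ψ (((1 : ℝ) : ℂ) * w)) := by
      simpa using mem_interior_iff_mem_nhds.1 hz
    exact (hcont.tendsto.mono_left nhdsWithin_le_nhds).eventually h2
  obtain ⟨t, ht, ht1⟩ := (h1.and self_mem_nhdsWithin).exists
  have ht1' : 1 < t := ht1
  have hn : ‖(t : ℂ) * w‖ = t * ‖w‖ := by
    rw [norm_mul, Complex.norm_real, Real.norm_of_nonneg (by linarith)]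
  rw [H.apply_mem_closedLevelDisk_iff (by rw [hn]; nlinarith), hn] at ht
  nlinarith

theorem cut_subset_closure_sector {u v : Circle} {b : ℂ} (h : IsRayPair ψ u v b) :
    cut ψ u v b ⊆ closure (sector ψ u v b) := by
  have hpos : 0 < ang u v := ang_pos h.ne
  have key : ∀ r : ℝ, 1 < r → ∀ θ ∈ Icc 0 (ang u v),
      ψ (r * (u * Circle.exp θ : Circle)) ∈ closure (sector ψ u v b) := by
    intro r hr θ hθ
    have hcont : Continuous fun θ : ℝ => ψ (r * (u * Circle.exp θ : Circle)) := by
      refine continuous_iff_continuousAt.2 fun θ => ?_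
      refine ContinuousAt.comp (f := fun θ : ℝ => (r : ℂ) * (u * Circle.exp θ : Circle))
        (H.continuousAt ?_) ?_
      · rwa [norm_real_mul_circle (by linarith)]
      · fun_prop
    rw [← closure_Ioo hpos.ne] at hθ
    refine closure_mono ?_ (image_closure_subset_closure_image hcont ⟨θ, hθ, rfl⟩)
    rintro _ ⟨θ', hθ', rfl⟩
    refine H.ray_mem_sector h ?_ hr
    rw [arc_eq_image]
    exact ⟨θ', hθ', rfl⟩
  have hu : ∀ r : ℝ, 1 < r → ψ (r * u) ∈ closure (sector ψ u v b) := fun r hr => by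
    simpa using key r hr 0 ⟨le_rfl, hpos.le⟩
  have hv : ∀ r : ℝ, 1 < r → ψ (r * v) ∈ closure (sector ψ u v b) := fun r hr => by
    have := key r hr (ang u v) ⟨hpos.le, le_rfl⟩
    rwa [mul_exp_ang] at this
  have hb : b ∈ closure (sector ψ u v b) := by
    refine isClosed_closure.mem_of_tendsto h.left ?_
    filter_upwards [self_mem_nhdsWithin] with r hr
    exact hu r hr
  rintro z ((rfl | ⟨r, hr, rfl⟩) | (rfl | ⟨r, hr, rfl⟩))
  · exact hb
  · exact hu r hr
  · exact hb
  · exact hv r hr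

end IsBottcherInverse

namespace YoccozPuzzle

variable {F : QuadraticLike} {φ : PolyConjugacy F} (Y : YoccozPuzzle φ)

/-- The complement, in the domain bounded by the equipotential, of the rays landing at `α`. -/
def base : Set ℂ := φ.disk Y.ρ \ φ.rays {Y.α}

theorem alpha_mem_filledJulia : Y.α ∈ F.filledJulia := fun n => by
  rw [Function.iterate_fixed Y.fixed]
  exact Y.α_mem

theorem alpha_mem_source : Y.α ∈ φ.h.source := φ.filledJulia_subset Y.alpha_mem_filledJulia

theorem qmap_apply_alpha : qmap φ.c (φ.h Y.α) = φ.h Y.α := by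
  rw [← φ.apply_toFun Y.alpha_mem_filledJulia, Y.fixed]

variable {ψ : ℂ → ℂ} (H : IsBottcherInverse φ.c ψ)
include H

theorem mem_base_iff {z : ℂ} : z ∈ Y.base ↔ z ∈ φ.disk Y.ρ ∧
    ∀ u, RayLands ψ u (φ.h Y.α) → φ.h z ∉ landedRay ψ u (φ.h Y.α) := by
  refine and_congr_right fun hz => ?_
  rw [φ.mem_rays_iff H (by rw [singleton_subset_iff]; exact Y.alpha_mem_source)
    (by rintro _ rfl; exact Y.dividing) ((φ.mem_disk_iff H).1 hz).1]
  simp only [mem_singleton_iff, exists_eq_left, not_exists, not_and]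

theorem base_subset_closedDisk : Y.base ⊆ φ.closedDisk ψ Y.ρ :=
  fun _ hz => φ.disk_subset_closedDisk H hz.1

theorem mem_base_of_mem_filledJulia {z : ℂ} (hz : z ∈ F.filledJulia) (hα : z ≠ Y.α) :
    z ∈ Y.base := by
  refine (Y.mem_base_iff H).2 ⟨Or.inl hz, fun u hu h => hα ?_⟩
  have hs := φ.filledJulia_subset hz
  exact φ.h.injOn hs Y.alpha_mem_source (H.landedRay_inter h ((φ.apply_mem_iff hs).2 hz))

theorem exists_isRayPair : ∃ u v, IsRayPair ψ u v (φ.h Y.α) :=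
  (φ.isDividing_iff H Y.alpha_mem_source).1 Y.dividing

theorem preim_one_base_subset : F.preim 1 Y.base ⊆ Y.base := by
  intro z hz
  have h1 := φ.preim_one_disk_subset H Y.goodLevel (F.preim_mono sdiff_subset 1 hz)
  have h2 := ((Y.mem_base_iff H).1 (F.mem_preim_one.1 hz).2).2
  refine (Y.mem_base_iff H).2 ⟨h1, fun u hu h => h2 (u ^ 2) ?_ ?_⟩
  · have := H.rayLands_sq hu
    rwa [Y.qmap_apply_alpha] at this
  · have := H.qmap_mem_landedRay h
    rw [Y.qmap_apply_alpha] at this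
    rwa [(φ.closedDisk_spec H Y.goodLevel (φ.disk_subset_closedDisk H h1)).2.2]

theorem preim_base_subset (n : ℕ) : F.preim n Y.base ⊆ Y.base :=
  F.preim_subset_of_preim_one_subset (Y.preim_one_base_subset H) n

theorem closure_component_subset (z : ℂ) :
    closure (connectedComponentIn Y.base z) ⊆ φ.closedDisk ψ Y.ρ :=
  closure_minimal ((connectedComponentIn_subset _ _).trans (Y.base_subset_closedDisk H))
    (φ.isCompact_closedDisk H Y.goodLevel).isClosed

theorem closedDisk_subset_U : φ.closedDisk ψ Y.ρ ⊆ F.U := fun _ hz =>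
  F.U'_subset_U (φ.closedDisk_spec H Y.goodLevel hz).1

theorem isCompact_closure_component (z : ℂ) : IsCompact (closure (connectedComponentIn Y.base z)) :=
  (φ.isCompact_closedDisk H Y.goodLevel).of_isClosed_subset isClosed_closure
    (Y.closure_component_subset H z)

variable (hp : 0 < φ.rayPeriod Y.α)
include hp

theorem isOpen_base : IsOpen Y.base := by
  have hfin : {u | RayLands ψ u (φ.h Y.α)}.Finite := by
    refine (finite_pow_two_pow_eq hp).subset fun u hu => ?_
    exact (Nat.sInf_mem (Nat.nonempty_of_pos_sInf hp)).2 u ((φ.lands_iff H Y.alpha_mem_source).2 hu)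
  have hcl : IsClosed (⋃ u ∈ {u | RayLands ψ u (φ.h Y.α)}, landedRay ψ u (φ.h Y.α)) :=
    hfin.isClosed_biUnion fun u hu => H.isClosed_landedRay hu
  have heq : Y.base = φ.h.source ∩ φ.h ⁻¹' (levelDisk φ.c ψ Y.ρ ∩
      (⋃ u ∈ {u | RayLands ψ u (φ.h Y.α)}, landedRay ψ u (φ.h Y.α))ᶜ) := by
    ext z
    rw [Y.mem_base_iff H, φ.mem_disk_iff H]
    simp only [mem_inter_iff, mem_preimage, mem_compl_iff, mem_iUnion, mem_ofPred_eq, not_exists]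
    tauto
  rw [heq]
  exact φ.h.isOpen_inter_preimage ((H.isOpen_levelDisk Y.goodLevel.1).inter hcl.isOpen_compl)

/-- A component lies on one side of every pair of rays at `α`. Near a point of such a ray there are
points of both sides, so this point is not interior to the closure; points of the equipotential are
excluded as well. -/
theorem interior_closure_component (z : ℂ) :
    interior (closure (connectedComponentIn Y.base z)) = connectedComponentIn Y.base z := by
  set O := connectedComponentIn Y.base z with hO
  have hbo := Y.isOpen_base H hp
  have hOo : IsOpen O := hbo.connectedComponentIn
  have hOb : O ⊆ Y.base := connectedComponentIn_subset _ _
  have hcl := Y.closure_component_subset H z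
  refine Subset.antisymm (fun x hx => ?_) (interior_maximal subset_closure hOo)
  refine closure_connectedComponentIn_inter_subset _ _ ⟨interior_subset hx, ?_⟩
  set N := interior (closure O) with hN
  have hNs : N ⊆ φ.h.source := fun y hy => (hcl (interior_subset hy)).1
  have hNo : IsOpen (φ.h '' N) := φ.h.isOpen_image_of_subset_source isOpen_interior hNs
  have hxD : x ∈ φ.disk Y.ρ := by
    refine (φ.mem_disk_iff H).2 ⟨hNs hx, H.interior_closedLevelDisk_subset Y.ρ ?_⟩
    refine interior_maximal ?_ hNo ⟨x, hx, rfl⟩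
    rintro _ ⟨y, hy, rfl⟩
    exact (hcl (interior_subset hy)).2
  refine (Y.mem_base_iff H).2 ⟨hxD, fun u hu hxu => ?_⟩
  obtain ⟨v, huv⟩ : ∃ v, IsRayPair ψ u v (φ.h Y.α) := by
    obtain ⟨s, t, hst⟩ := Y.exists_isRayPair H
    by_cases h : u = s
    · exact ⟨t, h ▸ hst.ne, hu, hst.right⟩
    · exact ⟨s, h, hu, hst.left⟩
  have key : ∀ s t, IsRayPair ψ s t (φ.h Y.α) → φ.h x ∈ cut ψ s t (φ.h Y.α) →
      ¬ φ.h '' O ⊆ sector ψ s t (φ.h Y.α) := by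
    intro s t hst hxc hsub
    have h1 : φ.h '' N ⊆ (sector ψ t s (φ.h Y.α))ᶜ := by
      rintro _ ⟨y, hy, rfl⟩
      refine H.closure_sector_subset hst (closure_mono hsub ?_)
      exact mem_closure_image (φ.h.continuousAt (hNs hy)) (interior_subset hy)
    rw [cut_comm] at hxc
    obtain ⟨w, hw, hw'⟩ := mem_closure_iff.1 (H.cut_subset_closure_sector hst.swap hxc) _ hNo
      ⟨x, hx, rfl⟩
    exact h1 hw hw'
  have hOc : φ.h '' O ⊆ sector ψ u v (φ.h Y.α) ∪ sector ψ v u (φ.h Y.α) := by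
    rintro _ ⟨y, hy, rfl⟩
    have h1 := ((Y.mem_base_iff H).1 (hOb hy)).2
    exact H.mem_sector_or huv fun hc => hc.elim (h1 u huv.left) (h1 v huv.right)
  have hOconn : IsPreconnected (φ.h '' O) := isPreconnected_connectedComponentIn.image _
    (φ.h.continuousOn.mono (subset_closure.trans fun y hy => (hcl hy).1))
  rcases hOconn.subset_or_subset (H.isOpen_sector huv) (H.isOpen_sector huv.swap)
    (H.disjoint_sector huv) hOc with h | h
  · exact key u v huv (Or.inl hxu) h
  · exact key v u huv.swap (Or.inr hxu) h

end YoccozPuzzle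

/-! ### Pieces of the principal nest -/

namespace YoccozPuzzle

variable {F : QuadraticLike} {φ : PolyConjugacy F} {Y : YoccozPuzzle φ}

theorem IsNestPiece.exists_zPiece {n : ℕ} {V : Set ℂ} (hV : Y.IsNestPiece n V) :
    ∃ Z t, Y.IsZPiece Z ∧ 0 ∈ F.preim (t * φ.rayPeriod Y.α) (interior Z) := by
  induction hV with
  | zero Z t hZ ht _ => exact ⟨Z, t, hZ, ht⟩
  | succ _ _ _ _ _ ih => exact ih

theorem IsNestPiece.rayPeriod_pos {n : ℕ} {V : Set ℂ} (hV : Y.IsNestPiece n V) :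
    0 < φ.rayPeriod Y.α := by
  obtain ⟨Z, t, hZ, ht⟩ := hV.exists_zPiece
  -- A period equal to the default value `0` would make the entry time `0`, putting `0` itself in a
  -- noncritical piece.
  refine Nat.pos_of_ne_zero fun h => hZ.2.1 ?_
  rw [h, mul_zero, F.mem_preim_zero] at ht
  exact interior_subset ht

/-- The interior of a pull-back of a piece the interior of which is a component of a preimage of
the base. -/
theorem interior_pullBack_eq {N l : ℕ} {W : Set ℂ} {w z : ℂ} (hW : IsCompact W) (hWU : W ⊆ F.U)
    (hint : interior W = connectedComponentIn (F.preim N Y.base) w)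
    (hz : z ∈ F.preim l (interior W)) :
    interior (F.pullBack W l z) = connectedComponentIn (F.preim (l + N) Y.base) z := by
  have h1 : F.preim (l + N) Y.base = F.preim l (F.preim N Y.base) := ext fun _ => F.mem_preim_add
  have h2 := hz.2
  rw [hint] at h2
  rw [F.interior_pullBack hW hWU, hint, connectedComponentIn_eq h2, h1]
  exact F.connectedComponentIn_preim _ l z

variable {ψ : ℂ → ℂ} (H : IsBottcherInverse φ.c ψ)
include H

theorem IsPiece.one_spec (hp : 0 < φ.rayPeriod Y.α) {Z : Set ℂ} (hZ : Y.IsPiece 1 Z) :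
    IsCompact Z ∧ Z ⊆ F.U ∧ ∃ z, interior Z = connectedComponentIn (F.preim 1 Y.base) z := by
  obtain ⟨Q, ⟨q, hq, rfl⟩, z, hz, rfl⟩ := hZ
  change z ∈ F.preim 1 (interior (closure (connectedComponentIn Y.base q))) at hz
  have hQ := Y.isCompact_closure_component H q
  have hQU := (Y.closure_component_subset H q).trans (Y.closedDisk_subset_U H)
  have hsub := F.pullBack_subset_preim hQ hQU 1 z
  refine ⟨(F.isCompact_preim hQ hQU 1).of_isClosed_subset isClosed_closure hsub,
    hsub.trans (F.preim_subset_U hQU 1), z, ?_⟩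
  change interior (F.pullBack (closure (connectedComponentIn Y.base q)) 1 z) = _
  rw [F.interior_pullBack hQ hQU, Y.interior_closure_component H hp]
  rw [Y.interior_closure_component H hp] at hz
  rw [connectedComponentIn_eq hz.2]
  exact F.connectedComponentIn_preim Y.base 1 z

theorem IsNestPiece.spec {n : ℕ} {V : Set ℂ} (hV : Y.IsNestPiece n V) :
    IsCompact V ∧ V ⊆ F.U ∧ 0 ∈ interior V ∧
      ∃ N, interior V = connectedComponentIn (F.preim N Y.base) 0 := by
  have hp := hV.rayPeriod_pos
  have key : ∀ {N l : ℕ} {W : Set ℂ} {w : ℂ}, IsCompact W → W ⊆ F.U →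
      interior W = connectedComponentIn (F.preim N Y.base) w → 0 ∈ F.preim l (interior W) →
      IsCompact (F.pullBack W l 0) ∧ F.pullBack W l 0 ⊆ F.U ∧ 0 ∈ interior (F.pullBack W l 0) ∧
        ∃ N, interior (F.pullBack W l 0) = connectedComponentIn (F.preim N Y.base) 0 := by
    intro N l W w hW hWU hint h0
    have hsub := F.pullBack_subset_preim hW hWU l 0
    refine ⟨(F.isCompact_preim hW hWU l).of_isClosed_subset isClosed_closure hsub,
      hsub.trans (F.preim_subset_U hWU l), ?_, l + N, interior_pullBack_eq hW hWU hint h0⟩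
    rw [F.interior_pullBack hW hWU]
    exact mem_connectedComponentIn h0
  induction hV with
  | zero Z t hZ ht _ =>
    obtain ⟨hZc, hZU, z, hz⟩ := hZ.1.one_spec H hp
    exact key hZc hZU hz ht
  | succ n V l hV hl ih =>
    obtain ⟨hVc, hVU, -, N, hN⟩ := ih
    exact key hVc hVU hN hl.2.1

end YoccozPuzzle

/-! ### Bounded return times imply finite type -/

namespace QuadraticLike

variable (F : QuadraticLike)

theorem criticalOmega_subset {S : Set ℂ} (hS : IsClosed S) (h : ∀ n, F.toFun^[n] 0 ∈ S) :
    F.criticalOmega ⊆ S := by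
  intro x hx
  have h1 := mem_iInter₂.1 hx univ univ_mem
  refine closure_minimal ?_ hS h1
  rintro _ ⟨n, -, z, hz, rfl⟩
  rw [mem_singleton_iff.1 hz]
  exact h n

/-- If every point of `ω(0)` hits `int V` in at most `p` steps, then only finitely many pieces of
the first return map to `V` meet `ω(0)`. -/
theorem generalizedRenormPieces_finite {V G : Set ℂ} (hVU : V ⊆ F.U) (h0 : 0 ∈ interior V)
    (hV : interior V = connectedComponentIn G 0) (hG : ∀ n, F.preim n G ⊆ G) {p : ℕ}
    (hret : ∀ x ∈ F.criticalOmega, ∃ k, 0 < k ∧ k ≤ p ∧ x ∈ F.preim k (interior V)) :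
    (F.generalizedRenormPieces V).Finite := by
  have hVc : IsPreconnected (interior V) := hV ▸ isPreconnected_connectedComponentIn
  have hVG : interior V ⊆ G := hV ▸ connectedComponentIn_subset _ _
  have hfin : (⋃ l ∈ Finset.range (p + 1), (fun y => F.pullBack V l y) '' F.preim l {0}).Finite :=
    (Finset.range (p + 1)).finite_toSet.biUnion fun l _ => (F.finite_preim_singleton l 0).image _
  refine hfin.subset ?_
  rintro _ ⟨⟨z, -, l, hl, rfl⟩, x, hxP, hxω⟩
  set O := connectedComponentIn (F.preim l (interior V)) z with hO
  have hOsub : O ⊆ F.preim l (interior V) := connectedComponentIn_subset _ _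
  have hzO : z ∈ O := mem_connectedComponentIn hl.2.1
  have hlp : l ≤ p := by
    obtain ⟨k, hk, hkp, hxk⟩ := hret x hxω
    refine le_trans (not_lt.1 fun hkl => ?_) hkp
    -- An earlier visit of `x` to `int V` is shared by some point of `O`. The set `f^k O` is
    -- connected and lies in `G`, so it stays in the component `int V`, and `z` would return too
    -- early.
    obtain ⟨y, hyk, hyO⟩ := mem_closure_iff.1 hxP _ (F.isOpen_preim isOpen_interior k) hxk
    refine hl.2.2 k hk hkl ⟨fun j hj => (hOsub hzO).1 j (by omega), ?_⟩
    have hmem : ∀ w ∈ O, w ∈ F.preim k (F.preim (l - k) (interior V)) := fun w hw => by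
      rw [← F.mem_preim_add, Nat.add_sub_of_le hkl.le]
      exact hOsub hw
    have h1 : IsPreconnected (F.toFun^[k] '' O) :=
      isPreconnected_connectedComponentIn.image _ ((F.continuousOn_iterate k _).mono hmem)
    rw [hV, connectedComponentIn_eq (hV ▸ hyk.2)]
    refine h1.subset_connectedComponentIn ⟨y, hyO, rfl⟩ ?_ ⟨z, hzO, rfl⟩
    rintro _ ⟨w, hw, rfl⟩
    exact hG (l - k) (F.preim_mono hVG _ (hmem w hw).2)
  have himg := F.image_connectedComponentIn_preim isOpen_interior hVc
    (interior_subset.trans hVU) l hl.2.1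
  obtain ⟨y, hy, hy0⟩ := himg.symm ▸ h0
  refine mem_biUnion (Finset.mem_coe.2 (Finset.mem_range.2 (Nat.lt_succ_of_le hlp))) ⟨y, ?_, ?_⟩
  · exact ⟨(hOsub hy).1, hy0⟩
  · change closure (connectedComponentIn _ y) = closure (connectedComponentIn _ z)
    rw [connectedComponentIn_eq hy]

end QuadraticLike

/-! ### Renormalizations attached to `α` and away from `α` -/

namespace YoccozPuzzle

variable {F : QuadraticLike} {φ : PolyConjugacy F} {Y : YoccozPuzzle φ} {ψ : ℂ → ℂ}
  (H : IsBottcherInverse φ.c ψ)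
include H

/-- The nest is empty if the renormalization is attached to `α`. -/
theorem IsNestPiece.false_of_isCriticalPair {n : ℕ} {V : Set ℂ} (hV : Y.IsNestPiece n V)
    (h0 : (0 : ℂ) ∈ F.filledJulia) {x y : Circle}
    (D : IsDividingCycle φ.c ψ (φ.h Y.α) (φ.rayPeriod Y.α))
    (hxy : IsCriticalPair φ.c ψ (φ.h Y.α) x y)
    (hval : ∀ k, qmap φ.c ((qmap φ.c)^[φ.rayPeriod Y.α * k] 0) ∉
      sector ψ (y ^ 2) (x ^ 2) (qmap φ.c (φ.h Y.α))) : False := by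
  have hp := hV.rayPeriod_pos
  obtain ⟨Z, t, hZ, ht⟩ := hV.exists_zPiece
  obtain ⟨-, -, z, hint⟩ := hZ.1.one_spec H hp
  set ζ := F.toFun^[t * φ.rayPeriod Y.α] 0 with hζ
  have hζK : ζ ∈ F.filledJulia := F.iterate_mem_filledJulia h0 _
  have hζZ : ζ ∈ connectedComponentIn (F.preim 1 Y.base) z := hint ▸ ht.2
  have hζ1 : ζ ∈ F.preim 1 Y.base := connectedComponentIn_subset _ _ hζZ
  have hfζ : F.toFun ζ ∈ Y.base := (F.mem_preim_one.1 hζ1).2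
  have hpair := D.isRayPair_sq hxy
  have hvalζ : φ.h (F.toFun ζ) ∈ sector ψ (x ^ 2) (y ^ 2) (qmap φ.c (φ.h Y.α)) := by
    have h1 := hval t
    rw [mul_comm, ← φ.apply_zero h0, ← φ.apply_iterate h0, ← φ.apply_toFun hζK] at h1
    refine (H.mem_sector_or hpair fun hc => ?_).resolve_right h1
    have h2 := ((Y.mem_base_iff H).1 hfζ).2
    rw [Y.qmap_apply_alpha] at hc hpair
    exact hc.elim (h2 _ hpair.left) (h2 _ hpair.right)
  have hval0 : φ.h (F.toFun 0) ∈ sector ψ (x ^ 2) (y ^ 2) (qmap φ.c (φ.h Y.α)) := by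
    have h1 := hxy.value_mem
    rwa [← φ.apply_zero h0, ← φ.apply_toFun h0] at h1
  -- The truncated critical value sector is connected and free of rays at `α`, so `f ζ` and the
  -- critical value lie in the same component of the base.
  set S := sector ψ (x ^ 2) (y ^ 2) (qmap φ.c (φ.h Y.α)) ∩ levelDisk φ.c ψ Y.ρ with hS
  have hSc : IsPreconnected S := H.isPreconnected_sector_inter_levelDisk hpair Y.goodLevel.1
  have hSt : S ⊆ φ.h.target := by
    rintro _ ⟨-, h⟩
    refine φ.closedLevelDisk_subset H Y.goodLevel (h.imp_right ?_)
    rintro ⟨w, hw, rfl⟩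
    exact ⟨w, ⟨hw.1, hw.2.le⟩, rfl⟩
  have hSb : φ.h.symm '' S ⊆ Y.base := by
    rintro _ ⟨w, hw, rfl⟩
    refine (Y.mem_base_iff H).2 ⟨(φ.mem_disk_iff H).2 ⟨φ.h.map_target (hSt hw), ?_⟩, ?_⟩
    · rw [φ.h.right_inv (hSt hw)]
      exact hw.2
    · intro u hu
      rw [φ.h.right_inv (hSt hw)]
      rintro (rfl | ⟨r, hr, rfl⟩)
      · have h1 := hw.1
        rw [Y.qmap_apply_alpha] at h1
        exact landing_not_mem_sector h1
      · exact hxy.not_mem_arc u 0 hu ((H.ray_mem_sector_iff hpair hr).1 hw.1)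
  have hmem : ∀ w ∈ F.filledJulia,
      φ.h w ∈ sector ψ (x ^ 2) (y ^ 2) (qmap φ.c (φ.h Y.α)) → w ∈ φ.h.symm '' S := by
    intro w hw hws
    have h1 := φ.filledJulia_subset hw
    exact ⟨φ.h w, ⟨hws, Or.inl ((φ.apply_mem_iff h1).2 hw)⟩, φ.h.left_inv h1⟩
  have hf0 : F.toFun 0 ∈ connectedComponentIn Y.base (F.toFun ζ) :=
    (hSc.image _ (φ.h.continuousOn_symm.mono hSt)).subset_connectedComponentIn
      (hmem _ (F.iterate_mem_filledJulia hζK 1) hvalζ) hSb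
      (hmem _ (F.iterate_mem_filledJulia h0 1) hval0)
  have himg := F.image_connectedComponentIn_preim_one
    (W := connectedComponentIn Y.base (F.toFun ζ)) (z := ζ)
    (Y.isOpen_base H hp).connectedComponentIn isPreconnected_connectedComponentIn
    ((connectedComponentIn_subset _ _).trans
      ((Y.base_subset_closedDisk H).trans (Y.closedDisk_subset_U H)))
    (F.mem_preim_one.2 ⟨hζK 0, mem_connectedComponentIn hfζ⟩)
  -- The component of the preimage at `ζ` is mapped onto a set containing the critical value, whose
  -- only preimage is `0`.
  obtain ⟨w, hw, hw0⟩ := himg.symm ▸ hf0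
  have hwU : w ∈ F.U' := (F.mem_preim_one.1 (connectedComponentIn_subset _ _ hw)).1
  rw [F.fiber_critical_value w hwU hw0] at hw
  refine hZ.2.1 (interior_subset ?_)
  rw [hint, connectedComponentIn_eq hζZ]
  exact connectedComponentIn_mono ζ (F.preim_mono (connectedComponentIn_subset _ _) 1) hw

/-- A renormalization not attached to `α` is contained in all pieces of the nest. -/
theorem IsNestPiece.generalizedRenormPieces_finite {n : ℕ} {V : Set ℂ} (hV : Y.IsNestPiece n V)
    (h0 : (0 : ℂ) ∈ F.filledJulia) {p : ℕ} (hp : 0 < p) {C : Set ℂ} (hC : IsCompact C)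
    (hCc : IsPreconnected C) (hCK : C ⊆ polyFilledJulia φ.c) (h0C : 0 ∈ C)
    (hCm : MapsTo (qmap φ.c)^[p] C C)
    (hα : ∀ z ∈ C, ∀ i, (qmap φ.c)^[i] z ≠ φ.h Y.α) : (F.generalizedRenormPieces V).Finite := by
  obtain ⟨-, hVU, h0V, N, hN⟩ := hV.spec H
  have hCt : C ⊆ φ.h.target := hCK.trans φ.polyFilledJulia_subset
  set C' := φ.h.symm '' C with hC'
  have hC'K : C' ⊆ F.filledJulia := by
    rintro _ ⟨z, hz, rfl⟩
    rw [← φ.apply_mem_iff (φ.h.map_target (hCt hz)), φ.h.right_inv (hCt hz)]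
    exact hCK hz
  have hC'h : ∀ z ∈ F.filledJulia, φ.h z ∈ C → z ∈ C' := fun z hz h =>
    ⟨φ.h z, h, φ.h.left_inv (φ.filledJulia_subset hz)⟩
  have hhC' : ∀ z ∈ C', φ.h z ∈ C := by
    rintro _ ⟨z, hz, rfl⟩
    rwa [φ.h.right_inv (hCt hz)]
  have hC'c : IsCompact C' := hC.image_of_continuousOn (φ.h.continuousOn_symm.mono hCt)
  have h0C' : 0 ∈ C' := hC'h 0 h0 (by rwa [φ.apply_zero h0])
  have hC'm : ∀ z ∈ C', F.toFun^[p] z ∈ C' := fun z hz =>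
    hC'h _ (F.iterate_mem_filledJulia (hC'K hz) p) (by
      rw [φ.apply_iterate (hC'K hz)]
      exact hCm (hhC' z hz))
  have hC'V : C' ⊆ interior V := by
    rw [hN]
    refine (hCc.image _ (φ.h.continuousOn_symm.mono hCt)).subset_connectedComponentIn h0C' ?_
    intro z hz
    refine F.mem_preim_of_mem_filledJulia (hC'K hz)
      (Y.mem_base_of_mem_filledJulia H (F.iterate_mem_filledJulia (hC'K hz) N) fun h => ?_)
    refine hα _ (hhC' z hz) N ?_
    rw [← φ.apply_iterate (hC'K hz), h]
  have horb : ∀ q, F.toFun^[p * q] 0 ∈ C' := by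
    intro q
    rw [Function.iterate_mul]
    induction q with
    | zero => exact h0C'
    | succ q ih =>
      rw [Function.iterate_succ_apply']
      exact hC'm _ ih
  -- The cover by `p` images of `C'` is compact and contains the orbit of `0`, hence its limit set.
  -- A point of the `i`-th image is back in `C'`, and so in `int V`, after `p - i` steps.
  have hω : F.criticalOmega ⊆ ⋃ i ∈ Finset.range p, F.toFun^[i] '' C' := by
    refine F.criticalOmega_subset ?_ fun m => ?_
    · refine (Finset.isCompact_biUnion _ fun i _ => hC'c.image_of_continuousOn
        ((F.continuousOn_iterate i univ).mono fun z hz => ?_)).isClosed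
      exact F.mem_preim_of_mem_filledJulia (hC'K hz) (mem_univ _)
    · refine mem_biUnion (Finset.mem_coe.2 (Finset.mem_range.2 (Nat.mod_lt m hp)))
        ⟨_, horb (m / p), ?_⟩
      rw [← Function.iterate_add_apply, Nat.mod_add_div]
  refine F.generalizedRenormPieces_finite hVU h0V hN (fun m z hz => ?_) (p := p) fun x hx => ?_
  · rw [← F.mem_preim_add, add_comm, F.mem_preim_add] at hz
    exact F.preim_mono (Y.preim_base_subset H m) N hz
  · obtain ⟨i, hi, z, hz, rfl⟩ := mem_iUnion₂.1 (hω hx)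
    have hip := Finset.mem_range.1 hi
    refine ⟨p - i, by omega, by omega,
      F.mem_preim_of_mem_filledJulia (F.iterate_mem_filledJulia (hC'K hz) i) (hC'V ?_)⟩
    rw [← Function.iterate_add_apply, Nat.sub_add_cancel hip.le]
    exact hC'm z hz

end YoccozPuzzle

end

theorem lemma3p10 (F : QuadraticLike) (hfix : F.FixedPointsRepelling)
    (φ : PolyConjugacy F) (hren : φ.IsDHRenormalizable) (Y : YoccozPuzzle φ)
    (n : ℕ) (V : Set ℂ) (hV : Y.IsNestPiece n V) :
    (F.generalizedRenormPieces V).Finite := by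
  obtain ⟨ψ, H⟩ := Y.goodLevel.exists_isBottcherInverse
  obtain ⟨a, haK, h0, D, x, y, hxy, hval, C, hC, hCc, hCK, h0C, hCm, hβ⟩ :=
    φ.exists_renormalization H hren
  by_cases hα : φ.h Y.α = φ.h a
  · obtain rfl : Y.α = a := φ.h.injOn Y.alpha_mem_source (φ.filledJulia_subset haK) hα
    exact (hV.false_of_isCriticalPair H h0 D hxy hval).elim
  · exact hV.generalizedRenormPieces_finite H h0 D.pos hC hCc hCK h0C hCm
      (hβ _ Y.qmap_apply_alpha hα)
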